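/- Let $q$ be an odd prime, let $G$ be a finite $q$-group, and let $\ell\ge 0$ be an integer that is a primitive root modulo $|G|$, i.e. its residue class is a unit generating the group $(\mathbb{Z}/|G|)^\times$. A $G$-Green functor is a Mackey functor for $G$ with values in commutative rings whose restriction and conjugation maps are ring homomorphisms and whose transfers satisfy Frobenius reciprocity; a morphism (isomorphism) of Green functors is a family of ring homomorphisms (isomorphisms), one for each subgroup of $G$, commuting with restrictions, transfers and conjugations. For a subgroup $H\le G$ let $A(H)$ be the Burnside ring (the Grothendieck ring of finite left $H$-sets under disjoint union and product), and let $R\mathbb{Q}(H)$ and $RU(H)$ be the Grothendieck rings of finite-dimensional rational and complex representations of $H$ under direct sum and tensor product. With restriction, induction and conjugation these form $G$-Green functors $\underline{A}$, $\underline{R\mathbb{Q}}$, $\underline{RU}$, with value at $G/H$ the ring $A(H)$, $R\mathbb{Q}(H)$, $RU(H)$ respectively. Sending a finite $H$-set to its rational or complex permutation representation gives morphisms $\underline{A}\to\underline{R\mathbb{Q}}$ and $\underline{A}\to\underline{RU}$, and extension of scalars gives a morphism $\underline{R\mathbb{Q}}\to\underline{RU}$. Let $\underline{J}=\ker(\underline{A}\to\underline{RU})$,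 an ideal of $\underline{A}$, so that $\underline{A}/\underline{J}$ is a Green functor. Let $\psi^\ell:\underline{RU}\to\underline{RU}$ be the $\ell$-th Adams operation (the natural ring endomorphism expressed through exterior powers by Newton's formula; on characters, $\chi_{\psi^\ell x}(h)=\chi_x(h^\ell)$). Since $\ell$ is prime to $|G|$, it is an endomorphism of the Green functor $\underline{RU}$, so $\ker(\psi^\ell-1)$ is a sub-Green functor of $\underline{RU}$. Then there are isomorphisms of Green functors $$\underline{A}/\underline{J}\;\cong\;\underline{R\mathbb{Q}}\;\cong\;\ker\bigl(\psi^\ell-1:\underline{RU}\to\underline{RU}\bigr),$$ where the first is induced by the canonical morphism $\underline{A}\to\underline{R\mathbb{Q}}$, and the second, followed by the inclusion into $\underline{RU}$, is the extension of scalars $\underline{R\mathbb{Q}}\to\underline{RU}$. -/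

import Mathlib

open scoped TensorProduct Pointwise
open Module

universe u v

section CharacterTheory

namespace Representation

variable {k : Type} [Field k] {G : Type u} [Group G]

/-- A representation is the direct sum of two complementary subrepresentations. -/
theorem nonempty_equiv_of_isCompl {V : Type v} [AddCommGroup V] [Module k V]
    {ρ : Representation k G V} (P Q : Subrepresentation ρ) (h : IsCompl P Q) :
    Nonempty ((P.toRepresentation.prod Q.toRepresentation).Equiv ρ) := by
  have h' : IsCompl P.toSubmodule Q.toSubmodule := by
    constructor
    · rw [disjoint_iff]
      have := congrArg Subrepresentation.toSubmodule (disjoint_iff.1 h.1)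
      exact (Subrepresentation.toSubmodule_inf P Q).symm.trans this
    · rw [codisjoint_iff]
      have := congrArg Subrepresentation.toSubmodule (codisjoint_iff.1 h.2)
      exact (Subrepresentation.toSubmodule_sup P Q).symm.trans this
  refine ⟨.mk (Submodule.prodEquivOfIsCompl _ _ h') fun g => ?_⟩
  ext x <;> simp [Subrepresentation.toRepresentation]

theorem char_prod {V W : Type*} [AddCommGroup V] [Module k V] [Module.Finite k V]
    [AddCommGroup W] [Module k W] [Module.Finite k W]
    (ρ : Representation k G V) (σ : Representation k G W) :
    (ρ.prod σ).character = ρ.character + σ.character := by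
  ext g
  exact LinearMap.trace_prodMap' (ρ g) (σ g)

variable [CharZero k] [Finite G]

theorem nonempty_equiv_of_char_eq_aux (n : ℕ) :
    ∀ {V W : Type v} [AddCommGroup V] [Module k V] [Module.Finite k V]
    [AddCommGroup W] [Module k W] [Module.Finite k W]
    (ρ : Representation k G V) (σ : Representation k G W),
    finrank k V = n → ρ.character = σ.character → Nonempty (ρ.Equiv σ) := by
  induction n using Nat.strong_induction_on with
  | _ n ih =>
  intro V W _ _ _ _ _ _ ρ σ hn hχ
  have hdim : finrank k V = finrank k W := by
    have := congrFun hχ 1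
    rw [char_one, char_one] at this
    exact_mod_cast this
  by_cases h0 : n = 0
  · have hV : Subsingleton V := finrank_zero_iff.1 (hn.trans h0)
    have hW : Subsingleton W := finrank_zero_iff.1 (hdim ▸ hn.trans h0)
    exact ⟨.mk (LinearEquiv.ofFinrankEq V W hdim) fun g => by ext; exact Subsingleton.elim _ _⟩
  have : Fintype G := Fintype.ofFinite G
  have : NeZero (Nat.card G : k) := ⟨by exact_mod_cast Nat.card_pos.ne'⟩
  have : Invertible (Nat.card G : k) := invertibleOfNonzero (NeZero.ne _)
  have hhom : finrank k (IntertwiningMap ρ σ) = finrank k (IntertwiningMap ρ ρ) := by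
    have h1 := card_inv_mul_sum_char_mul_char_eq_finrank ρ σ
    have h2 := card_inv_mul_sum_char_mul_char_eq_finrank ρ ρ
    rw [← hχ, h2] at h1
    exact_mod_cast h1.symm
  have hnt : Nontrivial V := finrank_pos_iff (R := k).1 (by omega)
  have hne : ∃ f : IntertwiningMap ρ σ, f ≠ 0 := by
    by_contra! hcon
    have hs : Subsingleton (IntertwiningMap ρ σ) := ⟨fun a b => by rw [hcon a, hcon b]⟩
    have h1 : finrank k (IntertwiningMap ρ ρ) = 0 := by
      rw [← hhom, finrank_zero_iff]; exact hs
    rw [finrank_zero_iff] at h1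
    obtain ⟨v, hv⟩ := exists_ne (0 : V)
    apply hv
    have := Subsingleton.elim (IntertwiningMap.id ρ) 0
    simpa using congrArg (fun f : IntertwiningMap ρ ρ => f v) this
  obtain ⟨f, hf⟩ := hne
  have hc1 : ComplementedLattice (Subrepresentation ρ) :=
    inferInstanceAs (IsSemisimpleRepresentation ρ)
  have hc2 : ComplementedLattice (Subrepresentation σ) :=
    inferInstanceAs (IsSemisimpleRepresentation σ)
  obtain ⟨C, hC⟩ := exists_isCompl f.ker
  obtain ⟨D, hD⟩ := exists_isCompl f.range
  obtain ⟨e1⟩ := nonempty_equiv_of_isCompl _ _ hC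
  obtain ⟨e2⟩ := nonempty_equiv_of_isCompl _ _ hD
  have e3 : Nonempty (C.toRepresentation.Equiv f.range.toRepresentation) := by
    let F : C.toSubmodule →ₗ[k] f.range.toSubmodule :=
      (f.toLinearMap.domRestrict C.toSubmodule).codRestrict _ fun x => ⟨x.1, rfl⟩
    have hker : ∀ x, x ∈ f.ker ↔ f x = 0 := fun x => IntertwiningMap.mem_ker _ _ f x
    have hF : Function.Bijective F := by
      constructor
      · rw [← LinearMap.ker_eq_bot, LinearMap.ker_eq_bot']
        intro x hx
        have hx' : x.1 ∈ f.ker := (hker _).2 (congrArg Subtype.val hx)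
        have : x.1 ∈ f.ker ⊓ C := ⟨hx', x.2⟩
        rw [hC.inf_eq_bot] at this
        exact Subtype.ext this
      · rintro ⟨_, y, rfl⟩
        have hmem : y ∈ (f.ker ⊔ C).toSubmodule := by
          rw [hC.sup_eq_top]
          exact Submodule.mem_top
        rw [Subrepresentation.toSubmodule_sup] at hmem
        obtain ⟨a, ha, b, hb, hab⟩ := Submodule.mem_sup.1 hmem
        refine ⟨⟨b, hb⟩, Subtype.ext ?_⟩
        have : f a = 0 := (hker _).1 ha
        change f b = f y
        rw [← hab, map_add, this, zero_add]
    refine ⟨.mk (LinearEquiv.ofBijective F hF) fun g => ?_⟩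
    ext x
    exact IntertwiningMap.isIntertwining _ _ f g x.1
  obtain ⟨e3⟩ := e3
  have hlt : finrank k f.ker.toSubmodule < n := by
    rw [← hn]
    apply Submodule.finrank_lt
    intro htop
    apply hf
    ext x
    have : x ∈ f.ker.toSubmodule := by rw [htop]; trivial
    exact (IntertwiningMap.mem_ker _ _ f x).1 this
  have hχ' : f.ker.toRepresentation.character = D.toRepresentation.character := by
    have h1 := char_iso e1
    have h2 := char_iso e2
    have h3 := char_iso e3
    rw [char_prod] at h1 h2
    rw [← h3, ← hχ, ← h1, add_comm] at h2
    exact (add_right_cancel h2).symm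
  obtain ⟨e4⟩ := ih _ hlt _ _ rfl hχ'
  refine ⟨e1.symm.trans (Equiv.trans ?_ e2)⟩
  refine .mk ((LinearEquiv.prodCongr e4.toLinearEquiv e3.toLinearEquiv).trans
    (LinearEquiv.prodComm _ _ _)) fun g => ?_
  apply LinearMap.ext
  rintro ⟨a, b⟩
  exact Prod.ext (IntertwiningMap.isIntertwining _ _ e3.toIntertwiningMap g b)
    (IntertwiningMap.isIntertwining _ _ e4.toIntertwiningMap g a)

/-- In characteristic zero, representations of a finite group with the same character are
isomorphic. -/
theorem nonempty_equiv_of_char_eq {V W : Type v} [AddCommGroup V] [Module k V] [Module.Finite k V]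
    [AddCommGroup W] [Module k W] [Module.Finite k W]
    (ρ : Representation k G V) (σ : Representation k G W)
    (h : ρ.character = σ.character) : Nonempty (ρ.Equiv σ) :=
  nonempty_equiv_of_char_eq_aux _ ρ σ rfl h

end Representation

end CharacterTheory
section TraceFormulas

open scoped MonoidAlgebra

namespace Representation

variable {k : Type} [Field k]

open Classical in
theorem trace_mapDomain {X : Type*} [Fintype X] (f : X → X) :
    LinearMap.trace k k[X] (MonoidAlgebra.mapDomainLinearMap k k f) =
      ∑ x : X, if f x = x then (1 : k) else 0 := by
  let b : Basis X k k[X] := Basis.ofRepr (MonoidAlgebra.coeffLinearEquiv k)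
  have hb : ∀ x, b x = MonoidAlgebra.single x 1 := fun x => by
    apply b.repr.injective
    rw [Basis.repr_self]
    rfl
  rw [LinearMap.trace_eq_matrix_trace k b, Matrix.trace]
  refine Finset.sum_congr rfl fun x _ => ?_
  rw [Matrix.diag_apply, LinearMap.toMatrix_apply, hb]
  have : (MonoidAlgebra.mapDomainLinearMap k k f) (MonoidAlgebra.single x 1) = b (f x) := by
    rw [hb]; simp
  rw [this, Basis.repr_self, Finsupp.single_apply]

variable {G : Type*} [Group G]

open Classical in
theorem char_ofMulAction {X : Type*} [MulAction G X] [Fintype X] (g : G) :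
    (ofMulAction k G X).character g = ∑ x : X, if g • x = x then (1 : k) else 0 := by
  rw [character, ofMulAction_def]
  exact trace_mapDomain _

/-- The trace on coinvariants of an operator commuting with the action of a finite group. -/
theorem trace_coinvariants [CharZero k] [Fintype G] {W : Type*} [AddCommGroup W] [Module k W]
    [Module.Finite k W] (τ : Representation k G W) (T : W →ₗ[k] W)
    (T' : Coinvariants τ →ₗ[k] Coinvariants τ)
    (h : T' ∘ₗ Coinvariants.mk τ = Coinvariants.mk τ ∘ₗ T) :
    LinearMap.trace k _ T' =
      (Fintype.card G : k)⁻¹ * ∑ g : G, LinearMap.trace k _ (T ∘ₗ τ g) := by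
  have hc : (Fintype.card G : k) ≠ 0 := by exact_mod_cast Fintype.card_ne_zero
  let avg : W →ₗ[k] W := (Fintype.card G : k)⁻¹ • ∑ g : G, τ g
  let s : Coinvariants τ →ₗ[k] W := Coinvariants.lift τ avg fun g => by
    ext w
    simp only [avg, LinearMap.comp_apply, LinearMap.smul_apply, LinearMap.sum_apply]
    congr 1
    refine Fintype.sum_equiv (Equiv.mulRight g) _ _ fun x => ?_
    simp [map_mul]
  have hs : s ∘ₗ Coinvariants.mk τ = avg := Coinvariants.lift_comp_mk _ _ _
  have hπ : Coinvariants.mk τ ∘ₗ s = LinearMap.id := by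
    apply Coinvariants.hom_ext
    rw [LinearMap.comp_assoc, hs]
    ext w
    simp only [avg, LinearMap.comp_apply, LinearMap.smul_apply, LinearMap.sum_apply, map_smul,
      map_sum, Coinvariants.mk_self_apply]
    simp [← Nat.cast_smul_eq_nsmul k, smul_smul]
  calc LinearMap.trace k _ T'
      = LinearMap.trace k _ ((T' ∘ₗ Coinvariants.mk τ) ∘ₗ s) := by
        rw [LinearMap.comp_assoc, hπ, LinearMap.comp_id]
    _ = LinearMap.trace k _ (Coinvariants.mk τ ∘ₗ (T ∘ₗ s)) := by rw [h, LinearMap.comp_assoc]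
    _ = LinearMap.trace k _ (T ∘ₗ avg) := by
        rw [LinearMap.trace_comp_comm', LinearMap.comp_assoc, hs]
    _ = _ := by
        have : T ∘ₗ avg = (Fintype.card G : k)⁻¹ • ∑ g : G, T ∘ₗ τ g := by
          ext w
          simp [avg]
        rw [this, map_smul, map_sum, smul_eq_mul]

open Classical in
/-- The character of an induced representation. -/
theorem char_ind [CharZero k] {H : Type*} [Group H] [Fintype G] [Fintype H] (φ : G →* H)
    {A : Type*} [AddCommGroup A] [Module k A] [Module.Finite k A] (ρ : Representation k G A)
    (h : H) :
    (ind φ ρ).character h = (Fintype.card G : k)⁻¹ *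
      ∑ g : G, ∑ x : H, if φ g * x = x * h then ρ.character g else 0 := by
  rw [character, trace_coinvariants _
    ((MonoidAlgebra.mapDomainLinearMap k k fun x : H => x * h⁻¹).rTensor A) _ (by ext; simp)]
  congr 1
  refine Finset.sum_congr rfl fun g _ => ?_
  have : (MonoidAlgebra.mapDomainLinearMap k k fun x : H => x * h⁻¹).rTensor A ∘ₗ
      (tprod ((leftRegular k H).comp φ) ρ) g =
      TensorProduct.map (MonoidAlgebra.mapDomainLinearMap k k fun x : H => φ g * x * h⁻¹) (ρ g) := by
    ext; simp
  rw [this, LinearMap.trace_tensorProduct', trace_mapDomain, Finset.sum_mul]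
  refine Finset.sum_congr rfl fun x _ => ?_
  simp only [ite_mul, one_mul, zero_mul, mul_inv_eq_iff_eq_mul]
  rfl

/-- The exterior power of a representation. -/
noncomputable def extPower {V : Type*} [AddCommGroup V] [Module k V] (n : ℕ)
    (ρ : Representation k G V) : Representation k G (⋀[k]^n V) where
  toFun g := exteriorPower.map n (ρ g)
  map_one' := by rw [map_one]; exact exteriorPower.map_id
  map_mul' g h := by rw [map_mul]; exact exteriorPower.map_comp _ _

open Classical in
theorem trace_extPower {V : Type*} [AddCommGroup V] [Module k V] {d : ℕ}
    (b : Basis (Fin d) k V) (f : V →ₗ[k] V) (μ : Fin d → k) (hf : ∀ i, f (b i) = μ i • b i)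
    (n : ℕ) :
    LinearMap.trace k (⋀[k]^n V) (exteriorPower.map n f) =
      MvPolynomial.aeval μ (MvPolynomial.esymm (Fin d) k n) := by
  have key : ∀ s : Set.powersetCard (Fin d) n,
      exteriorPower.map n f (b.exteriorPower n s) =
        (∏ i ∈ (s : Finset (Fin d)), μ i) • b.exteriorPower n s := by
    intro s
    rw [exteriorPower.basis_apply, exteriorPower.ιMulti_family, exteriorPower.map_apply_ιMulti]
    have h1 : f ∘ b ∘ (Set.powersetCard.ofFinEmbEquiv.symm s) =
        fun i => μ (Set.powersetCard.ofFinEmbEquiv.symm s i) •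
          (b ∘ (Set.powersetCard.ofFinEmbEquiv.symm s)) i := by
      funext i
      exact hf _
    rw [h1]
    rw [AlternatingMap.map_smul_univ]
    congr 1
    have h2 : (s : Finset (Fin d)) = Finset.univ.map
        (Set.powersetCard.ofFinEmbEquiv.symm s).toEmbedding := by
      ext i
      simp only [Finset.mem_map, Finset.mem_univ, true_and]
      exact (Set.powersetCard.mem_range_ofFinEmbEquiv_symm_iff_mem s i).symm
    rw [h2, Finset.prod_map]
    rfl
  rw [LinearMap.trace_eq_matrix_trace k (b.exteriorPower n), Matrix.trace]
  rw [MvPolynomial.esymm, map_sum, Finset.sum_subtype (p := (· ∈ Set.powersetCard (Fin d) n)) _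
    (fun _ => Finset.mem_powersetCard_univ)]
  refine Finset.sum_congr rfl fun s _ => ?_
  rw [Matrix.diag_apply, LinearMap.toMatrix_apply, key, map_smul, Basis.repr_self]
  simp [map_prod]

/-- An operator of finite order on a complex vector space is diagonalizable. -/
theorem exists_eigenbasis {V : Type*} [AddCommGroup V] [Module ℂ V] [Module.Finite ℂ V]
    (f : End ℂ V) (N : ℕ) (hN : N ≠ 0) (hf : f ^ N = 1) :
    ∃ (d : ℕ) (b : Basis (Fin d) ℂ V) (μ : Fin d → ℂ), ∀ i, f (b i) = μ i • b i := by
  have hss : f.IsSemisimple := by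
    apply Module.End.isSemisimple_of_squarefree_aeval_eq_zero (p := Polynomial.X ^ N - 1)
    · exact (Polynomial.X_pow_sub_one_separable_iff.2 (by exact_mod_cast hN)).squarefree
    · simp [hf]
  have htop := hss.iSup_eigenspace_eq_top
  classical
  have hint : DirectSum.IsInternal f.eigenspace :=
    DirectSum.isInternal_submodule_of_iSupIndep_of_iSup_eq_top f.eigenspaces_iSupIndep htop
  let B := hint.collectedBasis fun μ => Module.finBasis ℂ (f.eigenspace μ)
  have hB : ∀ i, f (B i) = i.1 • B i := fun i =>
    Module.End.mem_eigenspace_iff.1 (hint.collectedBasis_mem _ i)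
  have : Fintype (Σ μ : ℂ, Fin (finrank ℂ (f.eigenspace μ))) := FiniteDimensional.fintypeBasisIndex B
  let e := Fintype.equivFin (Σ μ : ℂ, Fin (finrank ℂ (f.eigenspace μ)))
  exact ⟨_, B.reindex e, fun i => (e.symm i).1, fun i => by simpa using hB (e.symm i)⟩

theorem psum_newton (d n : ℕ) (μ : Fin d → ℂ) :
    MvPolynomial.aeval μ (MvPolynomial.psum (Fin d) ℂ (n + 1)) =
      (-1) ^ n * (n + 1 : ℕ) * MvPolynomial.aeval μ (MvPolynomial.esymm (Fin d) ℂ (n + 1)) -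
      ∑ i : Fin n, (-1) ^ (i.1 + 1) *
        MvPolynomial.aeval μ (MvPolynomial.esymm (Fin d) ℂ (i.1 + 1)) *
        MvPolynomial.aeval μ (MvPolynomial.psum (Fin d) ℂ (n - i.1)) := by
  rw [MvPolynomial.psum_eq_mul_esymm_sub_sum _ _ (n + 1) n.succ_pos]
  simp only [map_sub, map_mul, map_pow, map_neg, map_one, map_natCast, map_sum]
  congr 1
  · ring
  · symm
    refine Finset.sum_bij (fun i _ => (i.1 + 1, n - i.1)) ?_ ?_ ?_ ?_
    · intro i _
      have := i.2
      simp only [Finset.mem_filter, Finset.HasAntidiagonal.mem_antidiagonal, Set.mem_Ioo]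
      omega
    · intro i _ j _ h
      ext
      simpa using congrArg Prod.fst h
    · rintro ⟨a, c⟩ h
      simp only [Finset.mem_filter, Finset.HasAntidiagonal.mem_antidiagonal, Set.mem_Ioo] at h
      refine ⟨⟨a - 1, by omega⟩, Finset.mem_univ _, ?_⟩
      ext <;> simp <;> omega
    · intro i _
      rfl

theorem trace_pow_eq_psum {V : Type*} [AddCommGroup V] [Module ℂ V] {d : ℕ}
    (b : Basis (Fin d) ℂ V) (f : End ℂ V) (μ : Fin d → ℂ) (hf : ∀ i, f (b i) = μ i • b i)
    (n : ℕ) :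
    LinearMap.trace ℂ V (f ^ n) = MvPolynomial.aeval μ (MvPolynomial.psum (Fin d) ℂ n) := by
  have key : ∀ i, (f ^ n) (b i) = μ i ^ n • b i := by
    intro i
    induction n with
    | zero => simp
    | succ n ih => rw [pow_succ', Module.End.mul_apply, ih, map_smul, hf, smul_smul, pow_succ]
  rw [LinearMap.trace_eq_matrix_trace ℂ b, Matrix.trace, MvPolynomial.psum, map_sum]
  refine Finset.sum_congr rfl fun i _ => ?_
  rw [Matrix.diag_apply, LinearMap.toMatrix_apply, key, map_smul, Basis.repr_self]
  simp

end Representation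

end TraceFormulas
section GrothendieckRing

variable {S : Type*} [CommSemiring S]

variable (S) in
/-- The Grothendieck ring of a commutative semiring: the Grothendieck group of its additive
monoid, with the multiplication that extends the one of the semiring. -/
def GrothendieckRing : Type _ := Algebra.GrothendieckAddGroup S

namespace GrothendieckRing

noncomputable instance : AddCommGroup (GrothendieckRing S) :=
  inferInstanceAs (AddCommGroup (Algebra.GrothendieckAddGroup S))

/-- The class of an element of the semiring. -/
noncomputable def of : S →+ GrothendieckRing S := Algebra.GrothendieckAddGroup.of

/-- Extension of an additive map to the Grothendieck group. -/
noncomputable def lift {B : Type*} [AddCommGroup B] (f : S →+ B) : GrothendieckRing S →+ B :=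
  Algebra.GrothendieckAddGroup.lift f

theorem lift_of {B : Type*} [AddCommGroup B] (f : S →+ B) (a : S) : lift f (of a) = f a :=
  DFunLike.congr_fun (Algebra.GrothendieckAddGroup.lift.symm_apply_apply f) a

theorem exists_sub_aux (x : Algebra.GrothendieckAddGroup S) :
    ∃ a b : S, x = Algebra.GrothendieckAddGroup.of a - Algebra.GrothendieckAddGroup.of b := by
  induction x using AddLocalization.ind with
  | _ y =>
    obtain ⟨a, b⟩ := y
    refine ⟨a, b.1, eq_sub_iff_add_eq.2 ?_⟩
    change AddLocalization.mk a b + AddLocalization.mk b.1 0 = AddLocalization.mk a 0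
    rw [AddLocalization.mk_add, AddLocalization.mk_eq_mk_iff, AddLocalization.r_iff_exists]
    exact ⟨0, by simp [add_comm]⟩

theorem exists_sub (x : GrothendieckRing S) : ∃ a b : S, x = of a - of b := exists_sub_aux x

theorem hom_ext {B : Type*} [AddCommGroup B] {f g : GrothendieckRing S →+ B}
    (h : ∀ a, f (of a) = g (of a)) : f = g := by
  ext x
  obtain ⟨a, b, rfl⟩ := exists_sub x
  rw [map_sub, map_sub, h, h]

/-- The multiplication of the Grothendieck ring. -/
noncomputable def mulHom : GrothendieckRing S →+ GrothendieckRing S →+ GrothendieckRing S :=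
  lift
    { toFun a := lift (of.comp (AddMonoidHom.mulLeft a))
      map_zero' := hom_ext fun b => by simp [lift_of]
      map_add' a a' := hom_ext fun b => by simp [lift_of, add_mul] }

noncomputable instance : Mul (GrothendieckRing S) := ⟨fun x y => mulHom x y⟩

noncomputable instance : One (GrothendieckRing S) := ⟨of 1⟩

theorem mul_def (x y : GrothendieckRing S) : x * y = mulHom x y := rfl

theorem of_one : of (1 : S) = 1 := rfl

theorem of_mul (a b : S) : of (a * b) = of a * of b := by
  simp [mul_def, mulHom, lift_of]

noncomputable instance : CommRing (GrothendieckRing S) where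
  __ := (inferInstance : AddCommGroup (GrothendieckRing S))
  left_distrib x y z := by simp [mul_def]
  right_distrib x y z := by simp [mul_def]
  zero_mul x := by simp [mul_def]
  mul_zero x := by simp [mul_def]
  mul_assoc x y z := by
    obtain ⟨a, a', rfl⟩ := exists_sub x
    obtain ⟨b, b', rfl⟩ := exists_sub y
    obtain ⟨c, c', rfl⟩ := exists_sub z
    simp only [mul_def, map_sub, AddMonoidHom.sub_apply]
    simp only [← mul_def, ← of_mul, mul_assoc]
  mul_comm x y := by
    obtain ⟨a, a', rfl⟩ := exists_sub x
    obtain ⟨b, b', rfl⟩ := exists_sub y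
    simp only [mul_def, map_sub, AddMonoidHom.sub_apply]
    simp only [← mul_def, ← of_mul, mul_comm]
    abel
  one_mul x := by
    obtain ⟨a, a', rfl⟩ := exists_sub x
    simp only [mul_def, map_sub]
    simp only [← mul_def, ← of_one, ← of_mul, one_mul]
  mul_one x := by
    obtain ⟨a, a', rfl⟩ := exists_sub x
    simp only [mul_def, map_sub, AddMonoidHom.sub_apply]
    simp only [← mul_def, ← of_one, ← of_mul, mul_one]

/-- Extension of a semiring homomorphism to the Grothendieck ring. -/
noncomputable def liftRing {B : Type*} [CommRing B] (f : S →+* B) : GrothendieckRing S →+* B where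
  __ := lift f.toAddMonoidHom
  map_one' := (lift_of f.toAddMonoidHom 1).trans (map_one f)
  map_mul' x y := by
    obtain ⟨a, a', rfl⟩ := exists_sub x
    obtain ⟨b, b', rfl⟩ := exists_sub y
    have h : ∀ c, lift f.toAddMonoidHom (of c) = f c := lift_of _
    simp only [ZeroHom.toFun_eq_coe, AddMonoidHom.toZeroHom_coe]
    rw [mul_sub, sub_mul, sub_mul]
    simp only [← of_mul, map_sub, h, map_mul]
    ring

theorem liftRing_of {B : Type*} [CommRing B] (f : S →+* B) (a : S) : liftRing f (of a) = f a :=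
  lift_of f.toAddMonoidHom a

variable {S' : Type*} [CommSemiring S']

/-- The class map as a semiring homomorphism. -/
noncomputable def ofHom : S →+* GrothendieckRing S where
  __ := of
  map_one' := of_one
  map_mul' := of_mul

/-- Functoriality for additive maps. -/
noncomputable def mapAdd (f : S →+ S') : GrothendieckRing S →+ GrothendieckRing S' :=
  lift (of.comp f)

theorem mapAdd_of (f : S →+ S') (a : S) : mapAdd f (of a) = of (f a) := lift_of _ a

/-- Functoriality for semiring homomorphisms. -/
noncomputable def mapRing (f : S →+* S') : GrothendieckRing S →+* GrothendieckRing S' :=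
  liftRing (ofHom.comp f)

theorem mapRing_of (f : S →+* S') (a : S) : mapRing f (of a) = of (f a) := liftRing_of _ a

end GrothendieckRing

end GrothendieckRing

section GreenFunctors

/-- A Green functor for a group `G`: a Mackey functor given by its values on the subgroups `H`
of `G` (that is, on the orbits `G/H`), with values in commutative rings, such that restrictions
and conjugations are ring homomorphisms and transfers satisfy Frobenius reciprocity.
The conjugation by `g` goes from the value at `H` to the value at `K` whenever `K = gHg⁻¹`, and
the double coset formula is required for every finite system `T` of representatives of the double
cosets `L \ H / K`. -/
structure GreenFunctor (G : Type u) [Group G] where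
  obj : Subgroup G → Type v
  [commRing : ∀ H, CommRing (obj H)]
  res : ∀ {K H : Subgroup G}, K ≤ H → obj H →+* obj K
  tr : ∀ {K H : Subgroup G}, K ≤ H → obj K →+ obj H
  conj : ∀ (g : G) {H K : Subgroup G}, K = MulAut.conj g • H → obj H →+* obj K
  res_refl : ∀ {H : Subgroup G} (h : H ≤ H) (x : obj H), res h x = x
  res_res : ∀ {L K H : Subgroup G} (hLK : L ≤ K) (hKH : K ≤ H) (x : obj H),
    res hLK (res hKH x) = res (hLK.trans hKH) x
  tr_refl : ∀ {H : Subgroup G} (h : H ≤ H) (x : obj H), tr h x = x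
  tr_tr : ∀ {L K H : Subgroup G} (hLK : L ≤ K) (hKH : K ≤ H) (x : obj L),
    tr hKH (tr hLK x) = tr (hLK.trans hKH) x
  conj_mem : ∀ {H : Subgroup G} (g : G) (e : H = MulAut.conj g • H) (x : obj H),
    g ∈ H → conj g e x = x
  conj_conj : ∀ (g g' : G) {H K L : Subgroup G} (e : K = MulAut.conj g • H)
    (e' : L = MulAut.conj g' • K) (e'' : L = MulAut.conj (g' * g) • H) (x : obj H),
    conj g' e' (conj g e x) = conj (g' * g) e'' x
  conj_res : ∀ (g : G) {K H K' H' : Subgroup G} (h : K ≤ H) (h' : K' ≤ H')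
    (eK : K' = MulAut.conj g • K) (eH : H' = MulAut.conj g • H) (x : obj H),
    conj g eK (res h x) = res h' (conj g eH x)
  conj_tr : ∀ (g : G) {K H K' H' : Subgroup G} (h : K ≤ H) (h' : K' ≤ H')
    (eK : K' = MulAut.conj g • K) (eH : H' = MulAut.conj g • H) (x : obj K),
    conj g eH (tr h x) = tr h' (conj g eK x)
  mackey : ∀ {K L H : Subgroup G} (hK : K ≤ H) (hL : L ≤ H) (T : Finset G),
    (∀ t ∈ T, t ∈ H) → (∀ h ∈ H, ∃! t, t ∈ T ∧ ∃ l ∈ L, ∃ k ∈ K, h = l * t * k) →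
    ∀ x : obj K, res hL (tr hK x) =
      ∑ t ∈ T, tr (inf_le_left : L ⊓ MulAut.conj t • K ≤ L) (res inf_le_right (conj t rfl x))
  frobenius : ∀ {K H : Subgroup G} (h : K ≤ H) (x : obj H) (y : obj K),
    tr h (res h x * y) = x * tr h y

attribute [instance] GreenFunctor.commRing

namespace GreenFunctor

variable {G : Type u} [Group G]

/-- A morphism of Green functors. -/
structure Hom (M N : GreenFunctor.{u, v} G) where
  app : ∀ H, M.obj H →+* N.obj H
  app_res : ∀ {K H : Subgroup G} (h : K ≤ H) (x : M.obj H), app K (M.res h x) = N.res h (app H x)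
  app_tr : ∀ {K H : Subgroup G} (h : K ≤ H) (x : M.obj K), app H (M.tr h x) = N.tr h (app K x)
  app_conj : ∀ (g : G) {H K : Subgroup G} (e : K = MulAut.conj g • H) (x : M.obj H),
    app K (M.conj g e x) = N.conj g e (app H x)

/-- An isomorphism of Green functors. -/
structure Iso (M N : GreenFunctor.{u, v} G) where
  app : ∀ H, M.obj H ≃+* N.obj H
  app_res : ∀ {K H : Subgroup G} (h : K ≤ H) (x : M.obj H), app K (M.res h x) = N.res h (app H x)
  app_tr : ∀ {K H : Subgroup G} (h : K ≤ H) (x : M.obj K), app H (M.tr h x) = N.tr h (app K x)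
  app_conj : ∀ (g : G) {H K : Subgroup G} (e : K = MulAut.conj g • H) (x : M.obj H),
    app K (M.conj g e x) = N.conj g e (app H x)

/-- An ideal of a Green functor. -/
structure GreenIdeal (M : GreenFunctor.{u, v} G) where
  ideal : ∀ H, Ideal (M.obj H)
  res_mem : ∀ {K H : Subgroup G} (h : K ≤ H) {x : M.obj H}, x ∈ ideal H → M.res h x ∈ ideal K
  tr_mem : ∀ {K H : Subgroup G} (h : K ≤ H) {x : M.obj K}, x ∈ ideal K → M.tr h x ∈ ideal H
  conj_mem : ∀ (g : G) {H K : Subgroup G} (e : K = MulAut.conj g • H) {x : M.obj H},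
    x ∈ ideal H → M.conj g e x ∈ ideal K

/-- The kernel of a morphism of Green functors. -/
def Hom.ker {M N : GreenFunctor.{u, v} G} (f : Hom M N) : GreenIdeal M where
  ideal H := RingHom.ker (f.app H)
  res_mem h x hx := by
    rw [RingHom.mem_ker] at hx ⊢
    rw [f.app_res, hx, map_zero]
  tr_mem h x hx := by
    rw [RingHom.mem_ker] at hx ⊢
    rw [f.app_tr, hx, map_zero]
  conj_mem g H K e x hx := by
    rw [RingHom.mem_ker] at hx ⊢
    rw [f.app_conj, hx, map_zero]

/-- The quotient of a Green functor by an ideal. -/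
def quotient (M : GreenFunctor.{u, v} G) (I : GreenIdeal M) : GreenFunctor.{u, v} G where
  obj H := M.obj H ⧸ I.ideal H
  res {K H} h := Ideal.quotientMap (I.ideal K) (M.res h) fun _ hx => I.res_mem h hx
  tr {K H} h := QuotientAddGroup.map (I.ideal K).toAddSubgroup (I.ideal H).toAddSubgroup (M.tr h)
    fun _ hx => I.tr_mem h hx
  conj g {H K} e := Ideal.quotientMap (I.ideal K) (M.conj g e) fun _ hx => I.conj_mem g e hx
  res_refl h x := by
    obtain ⟨x, rfl⟩ := Ideal.Quotient.mk_surjective x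
    exact congrArg (Ideal.Quotient.mk _) (M.res_refl h x)
  res_res h h' x := by
    obtain ⟨x, rfl⟩ := Ideal.Quotient.mk_surjective x
    exact congrArg (Ideal.Quotient.mk _) (M.res_res h h' x)
  tr_refl h x := by
    obtain ⟨x, rfl⟩ := Ideal.Quotient.mk_surjective x
    exact congrArg (Ideal.Quotient.mk _) (M.tr_refl h x)
  tr_tr h h' x := by
    obtain ⟨x, rfl⟩ := Ideal.Quotient.mk_surjective x
    exact congrArg (Ideal.Quotient.mk _) (M.tr_tr h h' x)
  conj_mem g e x hg := by
    obtain ⟨x, rfl⟩ := Ideal.Quotient.mk_surjective x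
    exact congrArg (Ideal.Quotient.mk _) (M.conj_mem g e x hg)
  conj_conj g g' H K L e e' e'' x := by
    obtain ⟨x, rfl⟩ := Ideal.Quotient.mk_surjective x
    exact congrArg (Ideal.Quotient.mk _) (M.conj_conj g g' e e' e'' x)
  conj_res g K H K' H' h h' eK eH x := by
    obtain ⟨x, rfl⟩ := Ideal.Quotient.mk_surjective x
    exact congrArg (Ideal.Quotient.mk _) (M.conj_res g h h' eK eH x)
  conj_tr g K H K' H' h h' eK eH x := by
    obtain ⟨x, rfl⟩ := Ideal.Quotient.mk_surjective x
    exact congrArg (Ideal.Quotient.mk _) (M.conj_tr g h h' eK eH x)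
  mackey {K L H} hK hL T hT hT' x := by
    obtain ⟨x, rfl⟩ := Ideal.Quotient.mk_surjective x
    refine (congrArg (Ideal.Quotient.mk (I.ideal L)) (M.mackey hK hL T hT hT' x)).trans ?_
    rw [map_sum]
    rfl
  frobenius {K H} h x y := by
    obtain ⟨x, rfl⟩ := Ideal.Quotient.mk_surjective x
    obtain ⟨y, rfl⟩ := Ideal.Quotient.mk_surjective y
    exact congrArg (Ideal.Quotient.mk (I.ideal H)) (M.frobenius h x y)

/-- The projection onto a quotient. -/
def quotientMk (M : GreenFunctor.{u, v} G) (I : GreenIdeal M) : Hom M (M.quotient I) where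
  app H := Ideal.Quotient.mk (I.ideal H)
  app_res _ _ := rfl
  app_tr _ _ := rfl
  app_conj _ _ _ _ _ := rfl

/-- The kernel of the additive map `f - 1` at the subgroup `H`, for a ring endomorphism `f`. -/
def kerSubOneRing {M : GreenFunctor.{u, v} G} (f : Hom M M) (H : Subgroup G) :
    Subring (M.obj H) where
  __ := ((f.app H).toAddMonoidHom - AddMonoidHom.id (M.obj H)).ker
  one_mem' := by
    change f.app H 1 - 1 = 0
    rw [map_one, sub_self]
  mul_mem' {a b} ha hb := by
    change f.app H a - a = 0 at ha
    change f.app H b - b = 0 at hb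
    change f.app H (a * b) - a * b = 0
    rw [map_mul, sub_eq_zero.1 ha, sub_eq_zero.1 hb, sub_self]

theorem mem_kerSubOneRing {M : GreenFunctor.{u, v} G} (f : Hom M M) (H : Subgroup G)
    (x : M.obj H) : x ∈ kerSubOneRing f H ↔ f.app H x = x :=
  (Iff.rfl : _ ↔ f.app H x - x = 0).trans sub_eq_zero

/-- The kernel of `f - 1 : M → M` for an endomorphism `f` of a Green functor `M`, with the
restrictions, transfers and conjugations of `M`. -/
def kerSubOne {M : GreenFunctor.{u, v} G} (f : Hom M M) : GreenFunctor.{u, v} G where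
  obj H := kerSubOneRing f H
  res {K H} h := (M.res h).restrict _ _ fun x hx => by
    rw [mem_kerSubOneRing] at hx ⊢
    rw [f.app_res, hx]
  tr {K H} h := ((M.tr h).comp (kerSubOneRing f K).subtype.toAddMonoidHom).codRestrict
    (kerSubOneRing f H).toAddSubgroup fun x => by
      have hx := (mem_kerSubOneRing f K _).1 x.2
      refine (mem_kerSubOneRing f H _).2 ?_
      change f.app H (M.tr h x.1) = M.tr h x.1
      rw [f.app_tr, hx]
  conj g {H K} e := (M.conj g e).restrict _ _ fun x hx => by
    rw [mem_kerSubOneRing] at hx ⊢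
    rw [f.app_conj, hx]
  res_refl h x := Subtype.ext (M.res_refl h x.1)
  res_res h h' x := Subtype.ext (M.res_res h h' x.1)
  tr_refl h x := Subtype.ext (M.tr_refl h x.1)
  tr_tr h h' x := Subtype.ext (M.tr_tr h h' x.1)
  conj_mem g e x hg := Subtype.ext (M.conj_mem g e x.1 hg)
  conj_conj g g' H K L e e' e'' x := Subtype.ext (M.conj_conj g g' e e' e'' x.1)
  conj_res g K H K' H' h h' eK eH x := Subtype.ext (M.conj_res g h h' eK eH x.1)
  conj_tr g K H K' H' h h' eK eH x := Subtype.ext (M.conj_tr g h h' eK eH x.1)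
  mackey {K L H} hK hL T hT hT' x := by
    apply Subtype.ext
    refine (M.mackey hK hL T hT hT' x.1).trans ?_
    rw [AddSubmonoidClass.coe_finsetSum]
    rfl
  frobenius h x y := Subtype.ext (M.frobenius h x.1 y.1)

/-- The inclusion of the kernel of `f - 1`. -/
def kerSubOneIncl {M : GreenFunctor.{u, v} G} (f : Hom M M) : Hom (kerSubOne f) M where
  app H := (kerSubOneRing f H).subtype
  app_res _ _ := rfl
  app_tr _ _ := rfl
  app_conj _ _ _ _ _ := rfl

end GreenFunctor

theorem mem_conj_smul_iff {G : Type u} [Group G] {g x : G} {H : Subgroup G} :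
    x ∈ MulAut.conj g • H ↔ g⁻¹ * x * g ∈ H := by
  rw [Subgroup.mem_pointwise_smul_iff_inv_smul_mem]
  simp [MulAut.smul_def]

/-- The isomorphism `K → H`, `k ↦ g⁻¹kg`, for `K = gHg⁻¹`. -/
def conjEquiv {G : Type u} [Group G] (g : G) {H K : Subgroup G} (e : K = MulAut.conj g • H) :
    K ≃* H where
  toFun k := ⟨g⁻¹ * k * g, mem_conj_smul_iff.1 (e ▸ k.2)⟩
  invFun h := ⟨g * h * g⁻¹, by
    subst e
    rw [mem_conj_smul_iff]
    simp [mul_assoc]⟩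
  left_inv k := Subtype.ext (by simp [mul_assoc])
  right_inv h := Subtype.ext (by simp [mul_assoc])
  map_mul' k k' := Subtype.ext (by simp [mul_assoc])

/-- A Green functor from a pullback and a pushforward along all homomorphisms between subgroups:
restriction and conjugation are the pullbacks along inclusions and along `k ↦ g⁻¹kg`, transfer is
the pushforward along inclusions. -/
def GreenFunctor.ofPullPush {G : Type u} [Group G] (R : Subgroup G → Type v)
    [∀ H, CommRing (R H)] (pull : ∀ {K H : Subgroup G}, (K →* H) → R H →+* R K)
    (push : ∀ {K H : Subgroup G}, (K →* H) → R K →+ R H)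
    (pull_inner : ∀ {H : Subgroup G} (φ : H →* H) (g : H), (∀ h, φ h = g⁻¹ * h * g) →
      ∀ x : R H, pull φ x = x)
    (pull_pull : ∀ {L K H : Subgroup G} (φ : K →* H) (ψ : L →* K) (x : R H),
      pull ψ (pull φ x) = pull (φ.comp ψ) x)
    (push_push : ∀ {L K H : Subgroup G} (φ : K →* H) (ψ : H →* L) (x : R K),
      push ψ (push φ x) = push (ψ.comp φ) x)
    (push_mulEquiv : ∀ {K H : Subgroup G} (e : K ≃* H) (x : R K),
      push e.toMonoidHom x = pull e.symm.toMonoidHom x)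
    (push_mul : ∀ {K H : Subgroup G} (φ : K →* H) (y : R H) (x : R K),
      push φ (pull φ y * x) = y * push φ x)
    (pull_push : ∀ {K L H : Subgroup G} (hK : K ≤ H) (hL : L ≤ H) (T : Finset G),
      (∀ t ∈ T, t ∈ H) → (∀ h ∈ H, ∃! t, t ∈ T ∧ ∃ l ∈ L, ∃ k ∈ K, h = l * t * k) →
      ∀ x : R K, pull (Subgroup.inclusion hL) (push (Subgroup.inclusion hK) x) =
        ∑ t ∈ T, push (Subgroup.inclusion (inf_le_left : L ⊓ MulAut.conj t • K ≤ L))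
          (pull ((conjEquiv t rfl).toMonoidHom.comp (Subgroup.inclusion inf_le_right)) x)) :
    GreenFunctor.{u, v} G where
  obj := R
  res h := pull (Subgroup.inclusion h)
  tr h := push (Subgroup.inclusion h)
  conj g _ _ e := pull (conjEquiv g e).toMonoidHom
  res_refl h x := pull_inner _ 1 (fun h => by simp only [inv_one, one_mul, mul_one]; rfl) x
  res_res h h' x := pull_pull _ _ x
  tr_refl {H} h x := (push_mulEquiv (MulEquiv.refl H) x).trans
    (pull_inner _ 1 (fun h => by simp) x)
  tr_tr h h' x := push_push _ _ x
  conj_mem g e x hg := pull_inner _ ⟨g, hg⟩ (fun h => rfl) x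
  conj_conj g g' H K L e e' e'' x := by
    rw [pull_pull]
    congr 2
    ext x
    simp [conjEquiv, mul_assoc]
  conj_res g K H K' H' h h' eK eH x := by
    rw [pull_pull, pull_pull]
    rfl
  conj_tr g K H K' H' h h' eK eH x := by
    have h1 := push_mulEquiv (conjEquiv g eH).symm (push (Subgroup.inclusion h) x)
    have h2 := push_mulEquiv (conjEquiv g eK).symm x
    rw [MulEquiv.symm_symm] at h1 h2
    rw [← h1, ← h2, push_push, push_push]
    rfl
  mackey hK hL T hT hT' x := by
    refine (pull_push hK hL T hT hT' x).trans (Finset.sum_congr rfl fun t _ => ?_)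
    rw [pull_pull]
  frobenius h x y := push_mul _ _ _

end GreenFunctors
section Burnside

/-- A finite set with a left action of the group `H`. -/
structure FinGSet (H : Type u) [Group H] where
  carrier : Type u
  [action : MulAction H carrier]
  [finite : Finite carrier]

attribute [instance] FinGSet.action FinGSet.finite

namespace FinGSet

variable {H K L : Type u} [Group H] [Group K] [Group L]

/-- Isomorphism of finite `H`-sets. -/
instance setoid (H : Type u) [Group H] : Setoid (FinGSet H) where
  r X Y := ∃ e : X.carrier ≃ Y.carrier, ∀ (h : H) (x : X.carrier), e (h • x) = h • e x
  iseqv :=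
    { refl X := ⟨Equiv.refl _, fun _ _ => rfl⟩
      symm := fun ⟨e, he⟩ => ⟨e.symm, fun h x => e.injective (by simp [he])⟩
      trans := fun ⟨e, he⟩ ⟨f, hf⟩ => ⟨e.trans f, fun h x => by simp [he, hf]⟩ }

theorem equiv_of_bijective {X Y : FinGSet H} (f : X.carrier → Y.carrier)
    (hf : ∀ (h : H) (x : X.carrier), f (h • x) = h • f x) (hb : Function.Bijective f) : X ≈ Y :=
  ⟨Equiv.ofBijective f hb, hf⟩

/-- The disjoint union. -/
def sum (X Y : FinGSet H) : FinGSet H where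
  carrier := X.carrier ⊕ Y.carrier
  action :=
    { smul h := Sum.map (h • ·) (h • ·)
      one_smul := by rintro (x | x) <;> simp [HSMul.hSMul, SMul.smul] <;> exact one_smul _ _
      mul_smul := by rintro g h (x | x) <;> simp [HSMul.hSMul, SMul.smul] <;> exact mul_smul _ _ _ }

/-- The cartesian product with the diagonal action. -/
def prod (X Y : FinGSet H) : FinGSet H where
  carrier := X.carrier × Y.carrier

/-- The disjoint union of a finite family. -/
def sigma {ι : Type u} [Finite ι] (X : ι → FinGSet H) : FinGSet H where
  carrier := Σ i, (X i).carrier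
  action :=
    { smul h x := ⟨x.1, h • x.2⟩
      one_smul := by rintro ⟨i, x⟩; exact congrArg (Sigma.mk i) (one_smul H x)
      mul_smul := by rintro g h ⟨i, x⟩; exact congrArg (Sigma.mk i) (mul_smul g h x) }

/-- The empty set. -/
def empty (H : Type u) [Group H] : FinGSet H where
  carrier := PEmpty
  action := { smul _ x := x, one_smul _ := rfl, mul_smul _ _ _ := rfl }

/-- The one-point set. -/
def point (H : Type u) [Group H] : FinGSet H where
  carrier := PUnit
  action := { smul _ x := x, one_smul _ := rfl, mul_smul _ _ _ := rfl }

/-- The pullback of an action along a group homomorphism. -/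
def pull (φ : K →* H) (X : FinGSet H) : FinGSet K where
  carrier := X.carrier
  action := MulAction.compHom X.carrier φ

/-- The identification of the underlying set of a pullback. -/
def pull.val (φ : K →* H) (X : FinGSet H) : (X.pull φ).carrier ≃ X.carrier := Equiv.refl _

theorem pull.val_smul (φ : K →* H) (X : FinGSet H) (k : K) (x : (X.pull φ).carrier) :
    pull.val φ X (k • x) = φ k • pull.val φ X x := rfl

/-- The relation `(h * φ k, x) ∼ (h, k • x)` on `H × X`. -/
def pushSetoid (φ : K →* H) (X : FinGSet K) : Setoid (H × X.carrier) where
  r p p' := ∃ k : K, p'.1 = p.1 * φ k⁻¹ ∧ p'.2 = k • p.2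
  iseqv :=
    { refl p := ⟨1, by simp⟩
      symm := by
        rintro ⟨h, x⟩ ⟨h', x'⟩ ⟨k, rfl, rfl⟩
        exact ⟨k⁻¹, by simp⟩
      trans := by
        rintro ⟨h, x⟩ ⟨h', x'⟩ ⟨h'', x''⟩ ⟨k, rfl, rfl⟩ ⟨k', rfl, rfl⟩
        exact ⟨k' * k, by simp [mul_assoc], by simp [mul_smul]⟩ }

/-- The induced set `H ×_K X`. -/
def push [Finite H] (φ : K →* H) (X : FinGSet K) : FinGSet H where
  carrier := Quotient (pushSetoid φ X)
  action :=
    { smul h := Quotient.map (fun p => (h * p.1, p.2)) (by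
        rintro ⟨a, x⟩ ⟨b, y⟩ ⟨k, rfl, rfl⟩
        exact ⟨k, by simp [mul_assoc], rfl⟩)
      one_smul := by
        rintro ⟨p⟩
        exact congrArg (Quotient.mk _) (Prod.ext (one_mul _) rfl)
      mul_smul := by
        rintro g h ⟨p⟩
        exact congrArg (Quotient.mk _) (Prod.ext (mul_assoc _ _ _) rfl) }

/-- The class of `(h, x)` in `H ×_K X`. -/
def push.mk [Finite H] (φ : K →* H) (X : FinGSet K) (h : H) (x : X.carrier) :
    (push φ X).carrier := Quotient.mk (pushSetoid φ X) (h, x)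

theorem push.smul_mk [Finite H] (φ : K →* H) (X : FinGSet K) (g h : H) (x : X.carrier) :
    g • push.mk φ X h x = push.mk φ X (g * h) x := rfl

theorem push.mk_eq [Finite H] (φ : K →* H) (X : FinGSet K) {h h' : H} {x x' : X.carrier} :
    push.mk φ X h x = push.mk φ X h' x' ↔ ∃ k : K, h' = h * φ k⁻¹ ∧ x' = k • x :=
  Quotient.eq (r := pushSetoid φ X)

theorem push.exists_mk [Finite H] (φ : K →* H) (X : FinGSet K) (p : (push φ X).carrier) :
    ∃ h x, p = push.mk φ X h x := by
  obtain ⟨⟨h, x⟩, rfl⟩ := Quotient.exists_rep p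
  exact ⟨h, x, rfl⟩

theorem sum_congr {X X' Y Y' : FinGSet H} : X ≈ X' → Y ≈ Y' → X.sum Y ≈ X'.sum Y' := by
  rintro ⟨e, he⟩ ⟨f, hf⟩
  refine ⟨Equiv.sumCongr e f, ?_⟩
  rintro h (x | x)
  · exact congrArg Sum.inl (he h x)
  · exact congrArg Sum.inr (hf h x)

theorem prod_congr {X X' Y Y' : FinGSet H} : X ≈ X' → Y ≈ Y' → X.prod Y ≈ X'.prod Y' := by
  rintro ⟨e, he⟩ ⟨f, hf⟩
  refine ⟨Equiv.prodCongr e f, ?_⟩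
  rintro h ⟨x, y⟩
  exact Prod.ext (he h x) (hf h y)

theorem pull_congr (φ : K →* H) {X X' : FinGSet H} : X ≈ X' → X.pull φ ≈ X'.pull φ := by
  rintro ⟨e, he⟩
  exact ⟨e, fun k x => he (φ k) x⟩

theorem push_congr [Finite H] (φ : K →* H) {X X' : FinGSet K} :
    X ≈ X' → X.push φ ≈ X'.push φ := by
  rintro ⟨e, he⟩
  refine equiv_of_bijective (X := X.push φ) (Y := X'.push φ)
    (Quotient.map (fun p => (p.1, e p.2)) ?_) ?_ ⟨?_, ?_⟩
  · rintro ⟨a, x⟩ ⟨b, y⟩ ⟨k, rfl, rfl⟩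
    exact ⟨k, rfl, he k x⟩
  · rintro h ⟨p⟩
    rfl
  · intro p p' h
    obtain ⟨a, x, rfl⟩ := push.exists_mk _ _ p
    obtain ⟨b, y, rfl⟩ := push.exists_mk _ _ p'
    obtain ⟨k, h1, h2⟩ := (push.mk_eq φ X').1 h
    exact (push.mk_eq φ X).2 ⟨k, h1, e.injective (by rw [h2, he])⟩
  · intro p
    obtain ⟨a, x, rfl⟩ := push.exists_mk _ _ p
    exact ⟨push.mk φ X a (e.symm x), congrArg (push.mk φ X' a) (e.apply_symm_apply x)⟩

theorem push_sum [Finite H] (φ : K →* H) (X Y : FinGSet K) :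
    (X.sum Y).push φ ≈ (X.push φ).sum (Y.push φ) := by
  refine Setoid.symm (equiv_of_bijective (X := (X.push φ).sum (Y.push φ))
    (Y := (X.sum Y).push φ) (Sum.elim
      (Quotient.map (fun p => (p.1, Sum.inl p.2)) ?_)
      (Quotient.map (fun p => (p.1, Sum.inr p.2)) ?_)) ?_ ⟨?_, ?_⟩)
  · rintro ⟨a, x⟩ ⟨b, y⟩ ⟨k, rfl, rfl⟩
    exact ⟨k, rfl, rfl⟩
  · rintro ⟨a, x⟩ ⟨b, y⟩ ⟨k, rfl, rfl⟩
    exact ⟨k, rfl, rfl⟩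
  · rintro h (p | p)
    · obtain ⟨a, x, rfl⟩ := push.exists_mk _ _ p
      rfl
    · obtain ⟨a, x, rfl⟩ := push.exists_mk _ _ p
      rfl
  · rintro (p | p) (p' | p') h <;>
      obtain ⟨a, x, rfl⟩ := push.exists_mk _ _ p <;>
      obtain ⟨b, y, rfl⟩ := push.exists_mk _ _ p' <;>
      obtain ⟨k, h1, h2⟩ := (push.mk_eq φ (X.sum Y)).1 h
    · exact congrArg Sum.inl ((push.mk_eq φ X).2 ⟨k, h1, Sum.inl_injective h2⟩)
    · cases h2
    · cases h2
    · exact congrArg Sum.inr ((push.mk_eq φ Y).2 ⟨k, h1, Sum.inr_injective h2⟩)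
  · intro p
    obtain ⟨a, x | x, rfl⟩ := push.exists_mk _ _ p
    · exact ⟨Sum.inl (push.mk φ X a x), rfl⟩
    · exact ⟨Sum.inr (push.mk φ Y a x), rfl⟩

theorem push_empty [Finite H] (φ : K →* H) : (empty K).push φ ≈ empty H := by
  refine Setoid.symm (equiv_of_bijective (X := empty H) (Y := (empty K).push φ) PEmpty.elim
    (fun _ x => x.elim) ⟨fun x => x.elim, fun p => ?_⟩)
  obtain ⟨_, x, rfl⟩ := push.exists_mk _ _ p
  exact x.elim

theorem push_push [Finite H] [Finite L] (φ : K →* H) (ψ : H →* L) (X : FinGSet K) :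
    (X.push φ).push ψ ≈ X.push (ψ.comp φ) := by
  refine Setoid.symm (equiv_of_bijective (X := X.push (ψ.comp φ)) (Y := (X.push φ).push ψ)
    (Quotient.lift (fun p => push.mk ψ (X.push φ) p.1 (push.mk φ X 1 p.2)) ?_) ?_ ⟨?_, ?_⟩)
  · rintro ⟨a, x⟩ ⟨b, y⟩ ⟨k, rfl, rfl⟩
    refine (push.mk_eq _ _).2 ⟨φ k, by simp, ?_⟩
    rw [push.smul_mk]
    exact (push.mk_eq _ _).2 ⟨k⁻¹, by simp, by simp⟩
  · rintro h ⟨p⟩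
    rfl
  · intro p p' h
    obtain ⟨a, x, rfl⟩ := push.exists_mk _ _ p
    obtain ⟨b, y, rfl⟩ := push.exists_mk _ _ p'
    obtain ⟨m, h1, h2⟩ := (push.mk_eq _ _).1 h
    rw [push.smul_mk] at h2
    obtain ⟨k, h3, h4⟩ := (push.mk_eq _ _).1 h2
    refine (push.mk_eq _ _).2 ⟨k⁻¹, ?_, ?_⟩
    · have : m = φ k⁻¹ := by
        rw [mul_one] at h3
        rw [h3, one_mul]
      change b = a * ψ (φ k⁻¹⁻¹)
      change b = a * ψ m⁻¹ at h1
      rw [h1, this, map_inv φ k⁻¹]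
    · change x = k • y at h4
      rw [h4, inv_smul_smul]
  · intro p
    obtain ⟨a, q, rfl⟩ := push.exists_mk _ _ p
    obtain ⟨h, x, rfl⟩ := push.exists_mk _ _ q
    refine ⟨push.mk (ψ.comp φ) X (a * ψ h) x, (push.mk_eq _ _).2 ⟨h, by simp, ?_⟩⟩
    rw [push.smul_mk, mul_one]

theorem push_mulEquiv [Finite H] (e : K ≃* H) (X : FinGSet K) :
    X.push e.toMonoidHom ≈ X.pull e.symm.toMonoidHom := by
  let v := pull.val e.symm.toMonoidHom X
  refine Setoid.symm (equiv_of_bijective (X := X.pull e.symm.toMonoidHom)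
    (Y := X.push e.toMonoidHom) (fun x => push.mk e.toMonoidHom X 1 (v x)) ?_ ⟨?_, ?_⟩)
  · intro h x
    rw [push.smul_mk, pull.val_smul]
    exact (push.mk_eq _ _).2 ⟨(e.symm h)⁻¹, by simp, (inv_smul_smul (e.symm h) (v x)).symm⟩
  · intro x y h
    obtain ⟨k, h1, h2⟩ := (push.mk_eq _ _).1 h
    have : k = 1 := by
      have : e k = 1 := by simpa using h1
      simpa using this
    exact v.injective (by rw [h2, this, one_smul])
  · intro p
    obtain ⟨h, x, rfl⟩ := push.exists_mk _ _ p
    refine ⟨v.symm (e.symm h • x), (push.mk_eq _ _).2 ⟨(e.symm h)⁻¹, by simp, ?_⟩⟩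
    rw [Equiv.apply_symm_apply, inv_smul_smul]

theorem push_prod [Finite H] (φ : K →* H) (Y : FinGSet H) (X : FinGSet K) :
    ((Y.pull φ).prod X).push φ ≈ Y.prod (X.push φ) := by
  let v := pull.val φ Y
  refine equiv_of_bijective (X := ((Y.pull φ).prod X).push φ) (Y := Y.prod (X.push φ))
    (Quotient.lift (fun p => ((p.1 • v p.2.1, push.mk φ X p.1 p.2.2) :
      Y.carrier × (X.push φ).carrier)) ?_) ?_ ⟨?_, ?_⟩
  · rintro ⟨a, y, x⟩ ⟨b, y', x'⟩ ⟨k, h1, h2⟩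
    have h3 : y' = k • y := congrArg Prod.fst h2
    have h4 : x' = k • x := congrArg Prod.snd h2
    subst h3 h4
    change b = a * φ k⁻¹ at h1
    subst h1
    refine Prod.ext ?_ ((push.mk_eq _ _).2 ⟨k, rfl, rfl⟩)
    change a • v y = (a * φ k⁻¹) • v (k • y)
    rw [pull.val_smul, smul_smul]
    simp [v]
  · rintro h ⟨a, y, x⟩
    exact Prod.ext (mul_smul h a (v y)) rfl
  · intro p p' h
    obtain ⟨a, ⟨y, x⟩, rfl⟩ := push.exists_mk _ _ p
    obtain ⟨b, ⟨y', x'⟩, rfl⟩ := push.exists_mk _ _ p'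
    obtain ⟨k, h1, h2⟩ := (push.mk_eq _ _).1 (congrArg Prod.snd h)
    have h3 : a • v y = b • v y' := congrArg Prod.fst h
    refine (push.mk_eq _ _).2 ⟨k, h1, Prod.ext (v.injective ?_) h2⟩
    change v y' = φ k • v y
    change b = a * φ k⁻¹ at h1
    rw [h1, mul_smul] at h3
    have h4 := MulAction.injective a h3
    rw [h4, smul_smul]
    simp
  · rintro ⟨y, p⟩
    obtain ⟨a, x, rfl⟩ := push.exists_mk _ _ p
    refine ⟨push.mk φ ((Y.pull φ).prod X) a (v.symm (a⁻¹ • y), x), Prod.ext ?_ rfl⟩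
    change a • v (v.symm (a⁻¹ • y)) = y
    rw [Equiv.apply_symm_apply, smul_inv_smul]

/-- The double coset decomposition of the restriction of an induced set. -/
theorem pull_push {G : Type u} [Group G] [Finite G] {K L H : Subgroup G} (hK : K ≤ H) (hL : L ≤ H)
    (T : Finset G) (hT : ∀ t ∈ T, t ∈ H)
    (hT' : ∀ h ∈ H, ∃! t, t ∈ T ∧ ∃ l ∈ L, ∃ k ∈ K, h = l * t * k)
    (M : G → Subgroup G) (hM : ∀ t, M t ≤ L) (φ : ∀ t, M t →* K)
    (hφ : ∀ t (m : M t), (φ t m : G) = t⁻¹ * m * t)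
    (hMK : ∀ t, ∀ l ∈ L, t⁻¹ * l * t ∈ K → l ∈ M t) (X : FinGSet K) :
    (X.push (Subgroup.inclusion hK)).pull (Subgroup.inclusion hL) ≈
      sigma fun t : T => (X.pull (φ t)).push (Subgroup.inclusion (hM t)) := by
  let v := fun t => pull.val (φ t) X
  let w := pull.val (Subgroup.inclusion hL) (X.push (Subgroup.inclusion hK))
  let F : ∀ t : T, ((X.pull (φ t)).push (Subgroup.inclusion (hM t))).carrier →
      (X.push (Subgroup.inclusion hK)).carrier := fun t =>
    Quotient.lift (fun p => push.mk (Subgroup.inclusion hK) X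
      (Subgroup.inclusion hL p.1 * ⟨t, hT t t.2⟩) (v t p.2)) (by
        rintro ⟨a, x⟩ ⟨b, y⟩ ⟨m, h1, h2⟩
        change b = a * Subgroup.inclusion (hM t) m⁻¹ at h1
        change y = m • x at h2
        subst h1 h2
        refine (push.mk_eq _ _).2 ⟨φ t m, Subtype.ext ?_, pull.val_smul _ _ _ _⟩
        simp [hφ, mul_assoc])
  refine Setoid.symm (equiv_of_bijective
    (X := sigma fun t : T => (X.pull (φ t)).push (Subgroup.inclusion (hM t)))
    (Y := (X.push (Subgroup.inclusion hK)).pull (Subgroup.inclusion hL))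
    (fun p => w.symm (F p.1 p.2)) ?_ ⟨?_, ?_⟩)
  · rintro l ⟨t, p⟩
    obtain ⟨a, x, rfl⟩ := push.exists_mk _ _ p
    apply w.injective
    rw [pull.val_smul]
    refine (push.mk_eq _ _).2 ⟨1, ?_, (one_smul _ _).symm⟩
    simp [mul_assoc]
    rfl
  · rintro ⟨t, p⟩ ⟨t', p'⟩ h
    obtain ⟨a, x, rfl⟩ := push.exists_mk _ _ p
    obtain ⟨b, y, rfl⟩ := push.exists_mk _ _ p'
    obtain ⟨k, h1, h2⟩ := (push.mk_eq _ _).1 (w.symm.injective h)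
    have h1' : (b : G) * t' = a * t * (k : G)⁻¹ := by
      simpa using congrArg Subtype.val h1
    have htt : t = t' := by
      obtain ⟨s, -, hs⟩ := hT' (t : G) (hT t t.2)
      have e1 := hs t ⟨t.2, 1, L.one_mem, 1, K.one_mem, by simp⟩
      have e2 := hs t' ⟨t'.2, (a : G)⁻¹ * b, L.mul_mem (L.inv_mem a.2) b.2, k, k.2, by
        rw [mul_assoc _ (b : G), h1']; group⟩
      exact Subtype.ext (e1.trans e2.symm)
    subst htt
    have hk : (k : G) = (t : G)⁻¹ * ((b : G)⁻¹ * a) * t := by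
      have : (k : G) = ((b : G) * t)⁻¹ * (a * t) := by rw [h1']; group
      rw [this]; group
    have hm : (b : G)⁻¹ * a ∈ M t :=
      hMK t _ (L.mul_mem (L.inv_mem b.2) a.2) (by rw [← hk]; exact k.2)
    refine congrArg (Sigma.mk t) ((push.mk_eq _ _).2 ⟨⟨_, hm⟩, ?_, (v t).injective ?_⟩)
    · apply Subtype.ext
      simp
    · rw [pull.val_smul, h2]
      congr 1
      exact Subtype.ext (by rw [hφ, hk])
  · intro p
    obtain ⟨h, x, hp⟩ := push.exists_mk _ _ (w p)
    obtain ⟨t, ⟨ht, l, hl, k, hk, e⟩, -⟩ := hT' h h.2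
    refine ⟨⟨⟨t, ht⟩, push.mk _ _ ⟨l, hl⟩ ((v t).symm ((⟨k, hk⟩ : K) • x))⟩, w.injective ?_⟩
    rw [hp]
    refine (push.mk_eq _ _).2 ⟨(⟨k, hk⟩ : K)⁻¹, Subtype.ext ?_, ?_⟩
    · simp [e]
    · rw [Equiv.apply_symm_apply, inv_smul_smul]

end FinGSet


/-- The semiring of isomorphism classes of finite `H`-sets, with disjoint union and product. -/
def BurnsideSemiring (H : Type u) [Group H] : Type (u + 1) := Quotient (FinGSet.setoid H)

namespace BurnsideSemiring

variable {H K L : Type u} [Group H] [Group K] [Group L]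

/-- The isomorphism class of a finite `H`-set. -/
def mk (X : FinGSet H) : BurnsideSemiring H := Quotient.mk _ X

theorem sound {X Y : FinGSet H} (h : X ≈ Y) : mk X = mk Y := Quotient.sound h

theorem exists_mk (x : BurnsideSemiring H) : ∃ X, x = mk X := by
  obtain ⟨X, rfl⟩ := Quotient.exists_rep x
  exact ⟨X, rfl⟩

instance : Zero (BurnsideSemiring H) := ⟨mk (.empty H)⟩

instance : One (BurnsideSemiring H) := ⟨mk (.point H)⟩

instance : Add (BurnsideSemiring H) :=
  ⟨Quotient.map₂ FinGSet.sum fun _ _ h _ _ h' => FinGSet.sum_congr h h'⟩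

instance : Mul (BurnsideSemiring H) :=
  ⟨Quotient.map₂ FinGSet.prod fun _ _ h _ _ h' => FinGSet.prod_congr h h'⟩

theorem mk_add (X Y : FinGSet H) : mk X + mk Y = mk (X.sum Y) := rfl

theorem mk_mul (X Y : FinGSet H) : mk X * mk Y = mk (X.prod Y) := rfl

instance : CommSemiring (BurnsideSemiring H) where
  nsmul := nsmulRec
  npow := npowRec
  add_assoc := by
    rintro ⟨X⟩ ⟨Y⟩ ⟨Z⟩
    refine sound (X := (X.sum Y).sum Z) (Y := X.sum (Y.sum Z)) ⟨Equiv.sumAssoc _ _ _, ?_⟩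
    rintro h ((x | x) | x) <;> rfl
  zero_add := by
    rintro ⟨X⟩
    refine sound (X := (FinGSet.empty H).sum X) ⟨Equiv.emptySum PEmpty _, ?_⟩
    rintro h (x | x)
    · exact x.elim
    · rfl
  add_zero := by
    rintro ⟨X⟩
    refine sound (X := X.sum (FinGSet.empty H)) ⟨Equiv.sumEmpty _ PEmpty, ?_⟩
    rintro h (x | x)
    · rfl
    · exact x.elim
  add_comm := by
    rintro ⟨X⟩ ⟨Y⟩
    refine sound (X := X.sum Y) (Y := Y.sum X) ⟨Equiv.sumComm _ _, ?_⟩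
    rintro h (x | x) <;> rfl
  left_distrib := by
    rintro ⟨X⟩ ⟨Y⟩ ⟨Z⟩
    refine sound (X := X.prod (Y.sum Z)) (Y := (X.prod Y).sum (X.prod Z))
      ⟨Equiv.prodSumDistrib _ _ _, ?_⟩
    rintro h ⟨x, (y | y)⟩ <;> rfl
  right_distrib := by
    rintro ⟨X⟩ ⟨Y⟩ ⟨Z⟩
    refine sound (X := (X.sum Y).prod Z) (Y := (X.prod Z).sum (Y.prod Z))
      ⟨Equiv.sumProdDistrib _ _ _, ?_⟩
    rintro h ⟨(y | y), x⟩ <;> rfl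
  zero_mul := by
    rintro ⟨X⟩
    exact sound (X := (FinGSet.empty H).prod X) (Y := FinGSet.empty H)
      ⟨Equiv.pemptyProd _, fun h x => x.1.elim⟩
  mul_zero := by
    rintro ⟨X⟩
    exact sound (X := X.prod (FinGSet.empty H)) (Y := FinGSet.empty H)
      ⟨Equiv.prodPEmpty _, fun h x => x.2.elim⟩
  mul_assoc := by
    rintro ⟨X⟩ ⟨Y⟩ ⟨Z⟩
    exact sound (X := (X.prod Y).prod Z) (Y := X.prod (Y.prod Z))
      ⟨Equiv.prodAssoc _ _ _, fun _ _ => rfl⟩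
  one_mul := by
    rintro ⟨X⟩
    exact sound (X := (FinGSet.point H).prod X) ⟨Equiv.punitProd _, fun _ _ => rfl⟩
  mul_one := by
    rintro ⟨X⟩
    exact sound (X := X.prod (FinGSet.point H)) ⟨Equiv.prodPUnit _, fun _ _ => rfl⟩
  mul_comm := by
    rintro ⟨X⟩ ⟨Y⟩
    exact sound (X := X.prod Y) (Y := Y.prod X) ⟨Equiv.prodComm _ _, fun _ _ => rfl⟩

/-- Pullback along a group homomorphism. -/
def pull (φ : K →* H) : BurnsideSemiring H →+* BurnsideSemiring K where
  toFun := Quotient.map (FinGSet.pull φ) fun _ _ h => FinGSet.pull_congr φ h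
  map_zero' := sound (X := (FinGSet.empty H).pull φ) ⟨Equiv.refl _, fun _ _ => rfl⟩
  map_one' := sound (X := (FinGSet.point H).pull φ) ⟨Equiv.refl _, fun _ _ => rfl⟩
  map_add' := by
    rintro ⟨X⟩ ⟨Y⟩
    refine sound (X := (X.sum Y).pull φ) (Y := (X.pull φ).sum (Y.pull φ)) ⟨Equiv.refl _, ?_⟩
    rintro k (x | x) <;> rfl
  map_mul' := by
    rintro ⟨X⟩ ⟨Y⟩
    exact sound (X := (X.prod Y).pull φ) (Y := (X.pull φ).prod (Y.pull φ))
      ⟨Equiv.refl _, fun _ _ => rfl⟩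

theorem pull_mk (φ : K →* H) (X : FinGSet H) : pull φ (mk X) = mk (X.pull φ) := rfl

/-- Induction along a group homomorphism. -/
def push [Finite H] (φ : K →* H) : BurnsideSemiring K →+ BurnsideSemiring H where
  toFun := Quotient.map (FinGSet.push φ) fun _ _ h => FinGSet.push_congr φ h
  map_zero' := sound (FinGSet.push_empty φ)
  map_add' := by
    rintro ⟨X⟩ ⟨Y⟩
    exact sound (FinGSet.push_sum φ X Y)

theorem push_mk [Finite H] (φ : K →* H) (X : FinGSet K) : push φ (mk X) = mk (X.push φ) := rfl

theorem pull_pull (φ : K →* H) (ψ : L →* K) (x : BurnsideSemiring H) :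
    pull ψ (pull φ x) = pull (φ.comp ψ) x := by
  obtain ⟨X, rfl⟩ := exists_mk x
  exact sound (X := (X.pull φ).pull ψ) (Y := X.pull (φ.comp ψ)) ⟨Equiv.refl _, fun _ _ => rfl⟩

/-- Pullback along an inner automorphism is the identity. -/
theorem pull_inner (φ : H →* H) (g : H) (hφ : ∀ h, φ h = g⁻¹ * h * g) (x : BurnsideSemiring H) :
    pull φ x = x := by
  obtain ⟨X, rfl⟩ := exists_mk x
  let v := FinGSet.pull.val φ X
  refine sound (X := X.pull φ) (Y := X) ⟨v.trans (MulAction.toPerm g), fun h x => ?_⟩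
  change g • v (h • x) = h • g • v x
  rw [FinGSet.pull.val_smul, hφ, smul_smul, smul_smul]
  congr 1
  group

theorem push_push [Finite H] [Finite L] (φ : K →* H) (ψ : H →* L) (x : BurnsideSemiring K) :
    push ψ (push φ x) = push (ψ.comp φ) x := by
  obtain ⟨X, rfl⟩ := exists_mk x
  exact sound (FinGSet.push_push φ ψ X)

theorem push_mulEquiv [Finite H] (e : K ≃* H) (x : BurnsideSemiring K) :
    push e.toMonoidHom x = pull e.symm.toMonoidHom x := by
  obtain ⟨X, rfl⟩ := exists_mk x
  exact sound (FinGSet.push_mulEquiv e X)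

theorem push_mul [Finite H] (φ : K →* H) (y : BurnsideSemiring H) (x : BurnsideSemiring K) :
    push φ (pull φ y * x) = y * push φ x := by
  obtain ⟨X, rfl⟩ := exists_mk x
  obtain ⟨Y, rfl⟩ := exists_mk y
  exact sound (FinGSet.push_prod φ Y X)

theorem sum_mk {ι : Type u} (T : Finset ι) (X : ι → FinGSet H) :
    ∑ t ∈ T, mk (X t) = mk (.sigma fun t : T => X t) := by
  classical
  induction T using Finset.induction_on with
  | empty =>
    rw [Finset.sum_empty]
    refine sound (X := FinGSet.empty H) (Y := .sigma fun t : (∅ : Finset ι) => X t)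
      (FinGSet.equiv_of_bijective PEmpty.elim (fun _ x => x.elim)
        ⟨fun x => x.elim, fun p => ?_⟩)
    exact absurd p.1.2 (Finset.notMem_empty _)
  | insert a T ha ih =>
    rw [Finset.sum_insert ha, ih, mk_add]
    let F : (X a).carrier ⊕ (Σ t : T, (X t).carrier) →
        Σ t : (insert a T : Finset ι), (X t).carrier :=
      Sum.elim (fun x => ⟨⟨a, Finset.mem_insert_self a T⟩, x⟩)
        (fun p => ⟨⟨p.1, Finset.mem_insert_of_mem p.1.2⟩, p.2⟩)
    have hF : Function.Bijective F := by
      constructor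
      · rintro (x | ⟨⟨t, ht⟩, x⟩) (y | ⟨⟨s, hs⟩, y⟩) h
        · simp only [F, Sum.elim_inl, Sigma.mk.injEq, heq_eq_eq, true_and] at h
          rw [h]
        · simp only [F, Sum.elim_inl, Sum.elim_inr, Sigma.mk.injEq, Subtype.mk.injEq] at h
          exact absurd (h.1 ▸ hs) ha
        · simp only [F, Sum.elim_inl, Sum.elim_inr, Sigma.mk.injEq, Subtype.mk.injEq] at h
          exact absurd (h.1 ▸ ht) ha
        · simp only [F, Sum.elim_inr, Sigma.mk.injEq, Subtype.mk.injEq] at h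
          obtain ⟨rfl, h⟩ := h
          rw [eq_of_heq h]
      · rintro ⟨⟨t, ht⟩, x⟩
        rcases Finset.mem_insert.1 ht with rfl | ht'
        · exact ⟨Sum.inl x, rfl⟩
        · exact ⟨Sum.inr ⟨⟨t, ht'⟩, x⟩, rfl⟩
    refine sound (X := (X a).sum (.sigma fun t : T => X t))
      (Y := .sigma fun t : (insert a T : Finset ι) => X t)
      (FinGSet.equiv_of_bijective F ?_ hF)
    rintro h (x | x) <;> rfl

/-- The double coset formula for isomorphism classes of finite sets. -/
theorem pull_push {G : Type u} [Group G] [Finite G] {K L H : Subgroup G} (hK : K ≤ H) (hL : L ≤ H)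
    (T : Finset G) (hT : ∀ t ∈ T, t ∈ H)
    (hT' : ∀ h ∈ H, ∃! t, t ∈ T ∧ ∃ l ∈ L, ∃ k ∈ K, h = l * t * k) (a : BurnsideSemiring K) :
    pull (Subgroup.inclusion hL) (push (Subgroup.inclusion hK) a) =
      ∑ t ∈ T, push (Subgroup.inclusion (inf_le_left : L ⊓ MulAut.conj t • K ≤ L))
        (pull ((conjEquiv t rfl).toMonoidHom.comp (Subgroup.inclusion inf_le_right)) a) := by
  obtain ⟨X, rfl⟩ := BurnsideSemiring.exists_mk a
  let M : G → Subgroup G := fun t => L ⊓ MulAut.conj t • K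
  have hM : ∀ t, M t ≤ L := fun _ => inf_le_left
  let φ : ∀ t, M t →* K := fun t =>
    (conjEquiv t rfl).toMonoidHom.comp (Subgroup.inclusion inf_le_right)
  have key := FinGSet.pull_push hK hL T hT hT' M hM φ (fun _ _ => rfl)
    (fun t l hl h => ⟨hl, mem_conj_smul_iff.2 h⟩) X
  exact (sound key).trans
    (sum_mk T fun t => (X.pull (φ t)).push (Subgroup.inclusion (hM t))).symm

end BurnsideSemiring

/-- The Burnside ring: the Grothendieck ring of finite `H`-sets. -/
abbrev BurnsideRing (H : Type u) [Group H] : Type (u + 1) := GrothendieckRing (BurnsideSemiring H)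

open GrothendieckRing in
/-- The Burnside Green functor `G/H ↦ A(H)`: restriction and conjugation are given by pulling
back the action, and transfer is induction `X ↦ H ×_K X`. -/
noncomputable def burnsideGreen (G : Type u) [Group G] [Finite G] : GreenFunctor.{u, u + 1} G :=
  GreenFunctor.ofPullPush (fun H => BurnsideRing H)
    (fun φ => mapRing (BurnsideSemiring.pull φ))
    (fun φ => mapAdd (BurnsideSemiring.push φ))
    (fun φ g hφ x => by
      obtain ⟨a, b, rfl⟩ := exists_sub x
      simp only [map_sub, mapRing_of, BurnsideSemiring.pull_inner φ g hφ])
    (fun φ ψ x => by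
      obtain ⟨a, b, rfl⟩ := exists_sub x
      simp only [map_sub, mapRing_of, BurnsideSemiring.pull_pull])
    (fun φ ψ x => by
      obtain ⟨a, b, rfl⟩ := exists_sub x
      simp only [map_sub, mapAdd_of, BurnsideSemiring.push_push])
    (fun e x => by
      obtain ⟨a, b, rfl⟩ := exists_sub x
      simp only [map_sub, mapAdd_of, mapRing_of, BurnsideSemiring.push_mulEquiv])
    (fun φ y x => by
      obtain ⟨a, b, rfl⟩ := exists_sub x
      obtain ⟨c, d, rfl⟩ := exists_sub y
      simp only [map_sub, mul_sub, sub_mul, mapRing_of, ← of_mul, mapAdd_of,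
        BurnsideSemiring.push_mul])
    (fun {K L H} hK hL T hT hT' x => by
      obtain ⟨a, b, rfl⟩ := exists_sub x
      simp only [map_sub, mapAdd_of, mapRing_of, BurnsideSemiring.pull_push hK hL T hT hT',
        map_sum, Finset.sum_sub_distrib])

end Burnside
section RepresentationRing

/-- A finite-dimensional representation of the group `H` over the field `k`. -/
structure FinRep (k : Type) [Field k] (H : Type u) [Group H] where
  V : Type u
  [addCommGroup : AddCommGroup V]
  [module : Module k V]
  [finite : Module.Finite k V]
  ρ : Representation k H V

attribute [instance] FinRep.addCommGroup FinRep.module FinRep.finite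

namespace FinRep

variable {k : Type} [Field k] {H K : Type u} [Group H] [Group K]

/-- Isomorphism of representations. -/
instance setoid (k : Type) [Field k] (H : Type u) [Group H] : Setoid (FinRep k H) where
  r V W := Nonempty (V.ρ.Equiv W.ρ)
  iseqv :=
    { refl _ := ⟨.refl _⟩
      symm := fun ⟨e⟩ => ⟨e.symm⟩
      trans := fun ⟨e⟩ ⟨f⟩ => ⟨e.trans f⟩ }

theorem equiv_iff [CharZero k] [Finite H] {V W : FinRep k H} :
    V ≈ W ↔ V.ρ.character = W.ρ.character :=
  ⟨fun ⟨e⟩ => Representation.char_iso e, Representation.nonempty_equiv_of_char_eq _ _⟩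

/-- The zero representation. -/
def zero (k : Type) [Field k] (H : Type u) [Group H] : FinRep k H where
  V := PUnit
  ρ := Representation.trivial k H PUnit.{u + 1}

/-- The trivial one-dimensional representation. -/
def one (k : Type) [Field k] (H : Type u) [Group H] : FinRep k H where
  V := ULift k
  ρ := Representation.trivial k H (ULift k)

/-- The direct sum. -/
noncomputable def add (V W : FinRep k H) : FinRep k H where
  V := V.V × W.V
  ρ := V.ρ.prod W.ρ

/-- The tensor product. -/
noncomputable def mul (V W : FinRep k H) : FinRep k H where
  V := V.V ⊗[k] W.V
  ρ := V.ρ.tprod W.ρ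

/-- The pullback along a group homomorphism. -/
def pull (φ : K →* H) (V : FinRep k H) : FinRep k K where
  V := V.V
  ρ := V.ρ.comp φ

/-- The induced representation. -/
noncomputable def ind [Finite H] (φ : K →* H) (V : FinRep k K) : FinRep k H where
  V := Representation.IndV φ V.ρ
  finite := Module.Finite.of_surjective _ (Representation.Coinvariants.mk_surjective _)
  ρ := Representation.ind φ V.ρ

/-- The exterior power. -/
noncomputable def ext (n : ℕ) (V : FinRep k H) : FinRep k H where
  V := ⋀[k]^n V.V
  ρ := V.ρ.extPower n

/-- The permutation representation of a finite `H`-set. -/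
noncomputable def perm (k : Type) [Field k] (X : FinGSet H) : FinRep k H where
  V := MonoidAlgebra k X.carrier
  finite := Module.Finite.equiv (MonoidAlgebra.coeffLinearEquiv k).symm
  ρ := Representation.ofMulAction k H X.carrier

/-- The extension of scalars. -/
noncomputable def baseChange (k' : Type) [Field k'] [Algebra k k'] (V : FinRep k H) :
    FinRep k' H where
  V := k' ⊗[k] V.V
  ρ :=
    { toFun h := (V.ρ h).baseChange k'
      map_one' := by rw [map_one]; exact LinearMap.baseChange_id
      map_mul' g h := by rw [map_mul]; exact LinearMap.baseChange_comp _ _ }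

end FinRep

/-- The semiring of isomorphism classes of finite-dimensional representations, with direct sum and
tensor product. -/
def RepSemiring (k : Type) [Field k] (H : Type u) [Group H] : Type (u + 1) :=
  Quotient (FinRep.setoid k H)

namespace RepSemiring

variable {k : Type} [Field k] {H K : Type u} [Group H] [Group K]

/-- The isomorphism class of a representation. -/
def mk (V : FinRep k H) : RepSemiring k H := Quotient.mk _ V

theorem exists_mk (x : RepSemiring k H) : ∃ V, x = mk V := by
  obtain ⟨V, rfl⟩ := Quotient.exists_rep x
  exact ⟨V, rfl⟩

/-- The character. -/
noncomputable def char : RepSemiring k H → H → k :=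
  Quotient.lift (fun V => V.ρ.character) fun _ _ ⟨e⟩ => Representation.char_iso e

theorem char_mk (V : FinRep k H) : char (mk V) = V.ρ.character := rfl

variable [CharZero k] [Finite H] [Finite K]

theorem char_injective : Function.Injective (char : RepSemiring k H → H → k) := by
  rintro ⟨V⟩ ⟨W⟩ h
  exact Quotient.sound (FinRep.equiv_iff.2 h)

theorem mk_eq {V W : FinRep k H} (h : V.ρ.character = W.ρ.character) : mk V = mk W :=
  char_injective h

instance : Zero (RepSemiring k H) := ⟨mk (.zero k H)⟩

instance : One (RepSemiring k H) := ⟨mk (.one k H)⟩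

theorem char_add_aux (V W : FinRep k H) :
    (V.add W).ρ.character = V.ρ.character + W.ρ.character := Representation.char_prod _ _

theorem char_mul_aux (V W : FinRep k H) :
    (V.mul W).ρ.character = V.ρ.character * W.ρ.character := Representation.char_tensor _ _

noncomputable instance : Add (RepSemiring k H) :=
  ⟨Quotient.map₂ FinRep.add fun _ _ h _ _ h' => FinRep.equiv_iff.2 (by
    rw [char_add_aux, char_add_aux, FinRep.equiv_iff.1 h, FinRep.equiv_iff.1 h'])⟩

noncomputable instance : Mul (RepSemiring k H) :=
  ⟨Quotient.map₂ FinRep.mul fun _ _ h _ _ h' => FinRep.equiv_iff.2 (by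
    rw [char_mul_aux, char_mul_aux, FinRep.equiv_iff.1 h, FinRep.equiv_iff.1 h'])⟩

theorem mk_add (V W : FinRep k H) : mk V + mk W = mk (V.add W) := rfl

theorem mk_mul (V W : FinRep k H) : mk V * mk W = mk (V.mul W) := rfl

theorem char_zero : char (0 : RepSemiring k H) = 0 := by
  ext h
  change LinearMap.trace k PUnit.{u + 1} LinearMap.id = 0
  rw [LinearMap.trace_id, finrank_zero_of_subsingleton, Nat.cast_zero]

theorem char_one : char (1 : RepSemiring k H) = 1 := by
  ext h
  change LinearMap.trace k (ULift k) LinearMap.id = 1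
  rw [LinearMap.trace_id]
  simp

theorem char_add (x y : RepSemiring k H) : char (x + y) = char x + char y := by
  obtain ⟨V, rfl⟩ := exists_mk x
  obtain ⟨W, rfl⟩ := exists_mk y
  exact char_add_aux V W

theorem char_mul (x y : RepSemiring k H) : char (x * y) = char x * char y := by
  obtain ⟨V, rfl⟩ := exists_mk x
  obtain ⟨W, rfl⟩ := exists_mk y
  exact char_mul_aux V W

noncomputable instance : CommSemiring (RepSemiring k H) where
  nsmul := nsmulRec
  npow := npowRec
  add_assoc x y z := char_injective (by simp only [char_add, add_assoc])
  zero_add x := char_injective (by simp only [char_add, char_zero, zero_add])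
  add_zero x := char_injective (by simp only [char_add, char_zero, add_zero])
  add_comm x y := char_injective (by simp only [char_add, add_comm])
  left_distrib x y z := char_injective (by simp only [char_add, char_mul, mul_add])
  right_distrib x y z := char_injective (by simp only [char_add, char_mul, add_mul])
  zero_mul x := char_injective (by simp only [char_mul, char_zero, zero_mul])
  mul_zero x := char_injective (by simp only [char_mul, char_zero, mul_zero])
  mul_assoc x y z := char_injective (by simp only [char_mul, mul_assoc])
  one_mul x := char_injective (by simp only [char_mul, char_one, one_mul])
  mul_one x := char_injective (by simp only [char_mul, char_one, mul_one])
  mul_comm x y := char_injective (by simp only [char_mul, mul_comm])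

/-- The character as a semiring homomorphism. -/
noncomputable def charHom : RepSemiring k H →+* (H → k) where
  toFun := char
  map_zero' := char_zero
  map_one' := char_one
  map_add' := char_add
  map_mul' := char_mul

theorem char_pull_aux (φ : K →* H) (V : FinRep k H) (g : K) :
    (V.pull φ).ρ.character g = V.ρ.character (φ g) := rfl

/-- Pullback of isomorphism classes along a group homomorphism. -/
noncomputable def pullFun (φ : K →* H) : RepSemiring k H → RepSemiring k K :=
  Quotient.map (FinRep.pull φ) fun _ _ h => FinRep.equiv_iff.2 (by
    ext g
    rw [char_pull_aux, char_pull_aux, FinRep.equiv_iff.1 h])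

theorem char_pullFun (φ : K →* H) (x : RepSemiring k H) (g : K) :
    char (pullFun φ x) g = char x (φ g) := by
  obtain ⟨V, rfl⟩ := exists_mk x
  rfl

/-- Pullback along a group homomorphism. -/
noncomputable def pull (φ : K →* H) : RepSemiring k H →+* RepSemiring k K where
  toFun := pullFun φ
  map_zero' := char_injective (by ext; simp [char_pullFun, char_zero])
  map_one' := char_injective (by ext; simp [char_pullFun, char_one])
  map_add' x y := char_injective (by ext; simp [char_pullFun, char_add])
  map_mul' x y := char_injective (by ext; simp [char_pullFun, char_mul])

theorem char_pull (φ : K →* H) (x : RepSemiring k H) (g : K) :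
    char (pull φ x) g = char x (φ g) := char_pullFun φ x g

end RepSemiring

open Classical in
/-- The formula for an induced character. -/
noncomputable def indChar {k : Type} [Field k] {H K : Type u} [Group H] [Group K] [Finite H]
    [Finite K] (φ : K →* H) : (K → k) →+ (H → k) :=
  letI := Fintype.ofFinite H
  letI := Fintype.ofFinite K
  { toFun f h := (Fintype.card K : k)⁻¹ * ∑ g : K, ∑ x : H, if φ g * x = x * h then f g else 0
    map_zero' := by ext; simp
    map_add' f f' := by
      ext h
      simp only [Pi.add_apply, ← mul_add, ← Finset.sum_add_distrib]
      congr 1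
      refine Finset.sum_congr rfl fun g _ => Finset.sum_congr rfl fun x _ => ?_
      split_ifs <;> simp }

namespace RepSemiring

variable {k : Type} [Field k] {H K : Type u} [Group H] [Group K] [CharZero k] [Finite H] [Finite K]

theorem char_ind_aux (φ : K →* H) (V : FinRep k K) :
    (V.ind φ).ρ.character = indChar φ V.ρ.character := by
  let _ := Fintype.ofFinite H
  let _ := Fintype.ofFinite K
  ext h
  exact Representation.char_ind φ V.ρ h

/-- Induction of isomorphism classes along a group homomorphism. -/
noncomputable def indFun (φ : K →* H) : RepSemiring k K → RepSemiring k H :=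
  Quotient.map (FinRep.ind φ) fun _ _ h => FinRep.equiv_iff.2 (by
    rw [char_ind_aux, char_ind_aux, FinRep.equiv_iff.1 h])

theorem char_indFun (φ : K →* H) (x : RepSemiring k K) :
    char (indFun φ x) = indChar φ (char x) := by
  obtain ⟨V, rfl⟩ := exists_mk x
  exact char_ind_aux φ V

/-- Induction along a group homomorphism. -/
noncomputable def ind (φ : K →* H) : RepSemiring k K →+ RepSemiring k H where
  toFun := indFun φ
  map_zero' := char_injective (by rw [char_indFun, char_zero, char_zero, map_zero])
  map_add' x y := char_injective (by simp only [char_indFun, char_add, map_add])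

theorem char_ind (φ : K →* H) (x : RepSemiring k K) : char (ind φ x) = indChar φ (char x) :=
  char_indFun φ x

theorem char_perm_aux (X : FinGSet H) (h : H) :
    (FinRep.perm k X).ρ.character h = (Nat.card {x : X.carrier // h • x = x} : k) := by
  classical
  let _ := Fintype.ofFinite X.carrier
  refine (Representation.char_ofMulAction h).trans ?_
  rw [Nat.card_eq_fintype_card, Fintype.card_subtype, Finset.sum_boole]

/-- The isomorphism class of the permutation representation of a finite `H`-set. -/
noncomputable def linFun (k : Type) [Field k] [CharZero k] (H : Type u) [Group H] [Finite H] :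
    BurnsideSemiring H → RepSemiring k H :=
  Quotient.lift (fun X => mk (FinRep.perm k X)) (by
    rintro X Y ⟨e, he⟩
    refine mk_eq (funext fun h => ?_)
    rw [char_perm_aux, char_perm_aux]
    refine congrArg _ (Nat.card_congr (e.subtypeEquiv fun x => ?_))
    rw [← he, e.injective.eq_iff])

theorem char_linFun (X : FinGSet H) (h : H) :
    char (linFun k H (.mk X)) h = (Nat.card {x : X.carrier // h • x = x} : k) :=
  char_perm_aux X h

/-- Linearization, sending a finite `H`-set to its permutation representation. -/
noncomputable def lin (k : Type) [Field k] [CharZero k] (H : Type u) [Group H] [Finite H] :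
    BurnsideSemiring H →+* RepSemiring k H where
  toFun := linFun k H
  map_zero' := char_injective (by
    rw [char_zero]
    ext h
    refine (char_linFun _ h).trans ?_
    have : IsEmpty {x : (FinGSet.empty H).carrier // h • x = x} := ⟨fun x => x.1.elim⟩
    simp)
  map_one' := char_injective (by
    rw [char_one]
    ext h
    refine (char_linFun _ h).trans ?_
    have : Unique {x : (FinGSet.point H).carrier // h • x = x} :=
      ⟨⟨⟨PUnit.unit, rfl⟩⟩, fun _ => rfl⟩
    simp)
  map_add' x y := by
    obtain ⟨X, rfl⟩ := BurnsideSemiring.exists_mk x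
    obtain ⟨Y, rfl⟩ := BurnsideSemiring.exists_mk y
    apply char_injective
    rw [char_add, BurnsideSemiring.mk_add]
    ext h
    rw [Pi.add_apply, char_linFun, char_linFun, char_linFun, ← Nat.cast_add, ← Nat.card_sum]
    refine congrArg _ (Nat.card_congr (Equiv.subtypeSum.trans (Equiv.sumCongr
      (Equiv.subtypeEquivRight fun x => ?_) (Equiv.subtypeEquivRight fun x => ?_))))
    · exact Sum.inl_injective.eq_iff
    · exact Sum.inr_injective.eq_iff
  map_mul' x y := by
    obtain ⟨X, rfl⟩ := BurnsideSemiring.exists_mk x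
    obtain ⟨Y, rfl⟩ := BurnsideSemiring.exists_mk y
    apply char_injective
    rw [char_mul, BurnsideSemiring.mk_mul]
    ext h
    rw [Pi.mul_apply, char_linFun, char_linFun, char_linFun, ← Nat.cast_mul, ← Nat.card_prod]
    refine congrArg _ (Nat.card_congr (Equiv.trans (Equiv.subtypeEquivRight fun x => ?_)
      Equiv.subtypeProdEquivProd))
    exact Prod.ext_iff

theorem char_lin (X : FinGSet H) (h : H) :
    char (lin k H (.mk X)) h = (Nat.card {x : X.carrier // h • x = x} : k) :=
  char_linFun X h

theorem char_baseChange_aux (k' : Type) [Field k'] [Algebra k k'] (V : FinRep k H) (h : H) :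
    (V.baseChange k').ρ.character h = algebraMap k k' (V.ρ.character h) :=
  LinearMap.trace_baseChange _ _

/-- Extension of scalars of isomorphism classes. -/
noncomputable def baseChangeFun (k' : Type) [Field k'] [CharZero k'] [Algebra k k'] (H : Type u)
    [Group H] [Finite H] : RepSemiring k H → RepSemiring k' H :=
  Quotient.map (FinRep.baseChange k') fun _ _ h => FinRep.equiv_iff.2 (by
    ext g
    rw [char_baseChange_aux, char_baseChange_aux, FinRep.equiv_iff.1 h])

theorem char_baseChangeFun (k' : Type) [Field k'] [CharZero k'] [Algebra k k']
    (x : RepSemiring k H) (h : H) :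
    char (baseChangeFun k' H x) h = algebraMap k k' (char x h) := by
  obtain ⟨V, rfl⟩ := exists_mk x
  exact char_baseChange_aux k' V h

/-- Extension of scalars. -/
noncomputable def baseChange (k' : Type) [Field k'] [CharZero k'] [Algebra k k'] (H : Type u)
    [Group H] [Finite H] : RepSemiring k H →+* RepSemiring k' H where
  toFun := baseChangeFun k' H
  map_zero' := char_injective (by ext; simp [char_baseChangeFun, char_zero])
  map_one' := char_injective (by ext; simp [char_baseChangeFun, char_one])
  map_add' x y := char_injective (by ext; simp [char_baseChangeFun, char_add])
  map_mul' x y := char_injective (by ext; simp [char_baseChangeFun, char_mul])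

theorem char_baseChange (k' : Type) [Field k'] [CharZero k'] [Algebra k k']
    (x : RepSemiring k H) (h : H) :
    char (baseChange k' H x) h = algebraMap k k' (char x h) := char_baseChangeFun k' x h

end RepSemiring

/-- The representation ring `R_k(H)`: the Grothendieck ring of finite-dimensional representations
of `H` over `k`. -/
abbrev RepRing (k : Type) [Field k] [CharZero k] (H : Type u) [Group H] [Finite H] : Type (u + 1) :=
  GrothendieckRing (RepSemiring k H)

namespace RepRing

open GrothendieckRing

variable {k : Type} [Field k] [CharZero k] {H K : Type u} [Group H] [Group K] [Finite H] [Finite K]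

/-- The character of a virtual representation. -/
noncomputable def char : RepRing k H →+* (H → k) := liftRing RepSemiring.charHom

theorem char_of (a : RepSemiring k H) : char (of a) = RepSemiring.char a := liftRing_of _ a

theorem char_injective : Function.Injective (char : RepRing k H →+* (H → k)) := by
  rw [injective_iff_map_eq_zero]
  intro x hx
  obtain ⟨a, b, rfl⟩ := exists_sub x
  rw [map_sub, char_of, char_of, sub_eq_zero] at hx
  rw [RepSemiring.char_injective hx, sub_self]

/-- Pullback along a group homomorphism. -/
noncomputable def pull (φ : K →* H) : RepRing k H →+* RepRing k K :=
  mapRing (RepSemiring.pull φ)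

/-- Induction along a group homomorphism. -/
noncomputable def ind (φ : K →* H) : RepRing k K →+ RepRing k H := mapAdd (RepSemiring.ind φ)

theorem char_pull (φ : K →* H) (x : RepRing k H) (g : K) : char (pull φ x) g = char x (φ g) := by
  obtain ⟨a, b, rfl⟩ := exists_sub x
  simp only [map_sub, pull, mapRing_of, char_of, Pi.sub_apply, RepSemiring.char_pull]

theorem char_ind (φ : K →* H) (x : RepRing k K) : char (ind φ x) = indChar φ (char x) := by
  obtain ⟨a, b, rfl⟩ := exists_sub x
  simp only [map_sub, ind, mapAdd_of, char_of, RepSemiring.char_ind]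

theorem char_conj (x : RepRing k H) (g h : H) : char x (h * g * h⁻¹) = char x g := by
  obtain ⟨a, b, rfl⟩ := exists_sub x
  obtain ⟨V, rfl⟩ := RepSemiring.exists_mk a
  obtain ⟨W, rfl⟩ := RepSemiring.exists_mk b
  simp only [map_sub, char_of, Pi.sub_apply, RepSemiring.char_mk, Representation.char_conj]

end RepRing

end RepresentationRing
section InducedCharacters

variable {k : Type} [Field k] [CharZero k] {H K L : Type u} [Group H] [Group K] [Group L]
  [Finite H] [Finite K] [Finite L]

open Classical in
theorem indChar_apply [Fintype H] [Fintype K] (φ : K →* H) (f : K → k) (h : H) :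
    indChar φ f h = (Fintype.card K : k)⁻¹ *
      ∑ g : K, ∑ x : H, if φ g * x = x * h then f g else 0 := by
  rw [indChar]
  change (@Fintype.card K (Fintype.ofFinite K) : k)⁻¹ *
    @Finset.sum _ _ _ (@Finset.univ K (Fintype.ofFinite K)) (fun g =>
      @Finset.sum _ _ _ (@Finset.univ H (Fintype.ofFinite H)) _) = _
  rw [Subsingleton.elim (Fintype.ofFinite K) ‹Fintype K›,
    Subsingleton.elim (Fintype.ofFinite H) ‹Fintype H›]

theorem indChar_indChar (φ : K →* H) (ψ : H →* L) (f : K → k) :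
    indChar ψ (indChar φ f) = indChar (ψ.comp φ) f := by
  classical
  have := Fintype.ofFinite H
  have := Fintype.ofFinite K
  have := Fintype.ofFinite L
  ext l
  have hc : (Fintype.card H : k) ≠ 0 := by exact_mod_cast Fintype.card_ne_zero
  have key : ∀ (g : K) (x : H), (∑ h : H, ∑ y : L, if ψ h * y = y * l then
      (if φ g * x = x * h then f g else 0) else 0) =
      ∑ y : L, if ψ (φ g) * y = y * l then f g else 0 := by
    intro g x
    rw [Finset.sum_eq_single (x⁻¹ * φ g * x)]
    · refine Fintype.sum_equiv (Equiv.mulLeft (ψ x)) _ _ fun y => ?_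
      have h1 : φ g * x = x * (x⁻¹ * φ g * x) := by group
      rw [if_pos h1]
      congr 1
      simp only [map_mul, map_inv, Equiv.coe_mulLeft, eq_iff_iff]
      constructor
      · intro h
        have := congrArg (ψ x * ·) h
        simpa [mul_assoc] using this
      · intro h
        have := congrArg ((ψ x)⁻¹ * ·) h
        simpa [mul_assoc] using this
    · intro h _ hne
      have h1 : ¬ φ g * x = x * h := fun e => hne (by rw [mul_assoc, e, inv_mul_cancel_left])
      simp [h1]
    · simp
  simp only [indChar_apply]
  have e1 : ∀ (h : H) (y : L), (if ψ h * y = y * l then (Fintype.card K : k)⁻¹ *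
      ∑ g : K, ∑ x : H, (if φ g * x = x * h then f g else 0) else 0) =
      (Fintype.card K : k)⁻¹ * ∑ g : K, ∑ x : H, (if ψ h * y = y * l then
        (if φ g * x = x * h then f g else 0) else 0) := by
    intro h y
    split_ifs <;> simp
  simp only [e1, ← Finset.mul_sum]
  have e2 : (∑ h : H, ∑ y : L, ∑ g : K, ∑ x : H, (if ψ h * y = y * l then
        (if φ g * x = x * h then f g else 0) else 0)) =
      ∑ g : K, ∑ x : H, ∑ h : H, ∑ y : L, (if ψ h * y = y * l then
        (if φ g * x = x * h then f g else 0) else 0) := by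
    calc _ = ∑ h : H, ∑ g : K, ∑ x : H, ∑ y : L, (if ψ h * y = y * l then
        (if φ g * x = x * h then f g else 0) else 0) := by
          refine Finset.sum_congr rfl fun h _ => ?_
          rw [Finset.sum_comm]
          exact Finset.sum_congr rfl fun g _ => Finset.sum_comm
      _ = _ := by
          rw [Finset.sum_comm]
          exact Finset.sum_congr rfl fun g _ => Finset.sum_comm
  rw [e2]
  simp only [key, Finset.sum_const, Finset.card_univ, nsmul_eq_mul, ← Finset.mul_sum]
  rw [mul_left_comm, inv_mul_cancel_left₀ hc]
  rfl

theorem indChar_mulEquiv (e : K ≃* H) (f : K → k) (hf : ∀ g x, f (x * g * x⁻¹) = f g) (h : H) :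
    indChar e.toMonoidHom f h = f (e.symm h) := by
  classical
  have := Fintype.ofFinite H
  have := Fintype.ofFinite K
  have hc : (Fintype.card K : k) ≠ 0 := by exact_mod_cast Fintype.card_ne_zero
  rw [indChar_apply, Finset.sum_comm]
  have key : ∀ x : H, (∑ g : K, if e.toMonoidHom g * x = x * h then f g else 0) =
      f (e.symm h) := by
    intro x
    rw [Finset.sum_eq_single (e.symm (x * h * x⁻¹))]
    · rw [if_pos (by simp)]
      simpa using hf (e.symm h) (e.symm x)
    · intro g _ hne
      refine if_neg fun h1 => hne ?_
      rw [← h1]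
      simp
    · simp
  simp only [key, Finset.sum_const, Finset.card_univ, nsmul_eq_mul]
  rw [← Fintype.card_congr (α := K) (β := H) e.toEquiv, inv_mul_cancel_left₀ hc]

theorem indChar_mul (φ : K →* H) (a : H → k) (ha : ∀ g x, a (x * g * x⁻¹) = a g) (f : K → k) :
    indChar φ ((fun g => a (φ g)) * f) = a * indChar φ f := by
  classical
  have := Fintype.ofFinite H
  have := Fintype.ofFinite K
  ext h
  rw [Pi.mul_apply, indChar_apply, indChar_apply, mul_left_comm]
  congr 1
  rw [Finset.mul_sum]
  refine Finset.sum_congr rfl fun g _ => ?_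
  rw [Finset.mul_sum]
  refine Finset.sum_congr rfl fun x _ => ?_
  split_ifs with h1
  · have : φ g = x * h * x⁻¹ := by rw [← h1]; group
    rw [Pi.mul_apply, this, ha]
  · simp

theorem indChar_algebraMap {k' : Type} [Field k'] [CharZero k'] [Algebra k k'] (φ : K →* H)
    (f : K → k) (h : H) :
    indChar φ (fun g => algebraMap k k' (f g)) h = algebraMap k k' (indChar φ f h) := by
  classical
  have := Fintype.ofFinite H
  have := Fintype.ofFinite K
  rw [indChar_apply, indChar_apply, map_mul, map_inv₀, map_natCast, map_sum]
  congr 1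
  refine Finset.sum_congr rfl fun g _ => ?_
  rw [map_sum]
  refine Finset.sum_congr rfl fun x _ => ?_
  split_ifs <;> simp

theorem indChar_pow (φ : K →* H) (f : K → k) (n : ℕ) (hK : (Nat.card K).Coprime n)
    (hH : (Nat.card H).Coprime n) (h : H) :
    indChar φ (fun g => f (g ^ n)) h = indChar φ f (h ^ n) := by
  classical
  have := Fintype.ofFinite H
  have := Fintype.ofFinite K
  rw [indChar_apply, indChar_apply]
  congr 1
  refine Fintype.sum_equiv (powCoprime hK) _ _ fun g => Finset.sum_congr rfl fun x _ => ?_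
  congr 1
  have hconj : ∀ (a b : H), a * x = x * b ↔ a = x * b * x⁻¹ := fun a b =>
    ⟨fun e => by rw [← e]; group, fun e => by rw [e]; group⟩
  rw [powCoprime_apply, map_pow, hconj, hconj, eq_iff_iff, ← conj_pow]
  exact ⟨fun e => by rw [e], fun e => (powCoprime hH).injective (by simpa using e)⟩

end InducedCharacters

section DoubleCosets

variable {k : Type} [Field k] [CharZero k] {G : Type u} [Group G] [Finite G]

theorem card_doubleCoset_fiber {K L M : Subgroup G} (t : G)
    (hM : ∀ m, m ∈ M ↔ m ∈ L ∧ t⁻¹ * m * t ∈ K) (z : G) (hz : ∃ l ∈ L, ∃ c ∈ K, z = l * t * c) :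
    Nat.card {p : L × K // (p.1 : G) * t * p.2 = z} = Nat.card M := by
  obtain ⟨l, hl, c, hc, rfl⟩ := hz
  symm
  have hmK : ∀ m : M, t⁻¹ * (m : G)⁻¹ * t ∈ K := fun m => ((hM _).1 (M.inv_mem m.2)).2
  refine Nat.card_eq_of_bijective (fun m : M => (⟨(⟨l * m, L.mul_mem hl ((hM _).1 m.2).1⟩,
    ⟨t⁻¹ * (m : G)⁻¹ * t * c, K.mul_mem (hmK m) hc⟩), by simp; group⟩ :
    {p : L × K // (p.1 : G) * t * p.2 = l * t * c})) ⟨?_, ?_⟩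
  · intro m m' h
    have := congrArg (fun p => (p.1.1 : G)) h
    exact Subtype.ext (mul_left_cancel this)
  · rintro ⟨⟨⟨y, hy⟩, ⟨d, hd⟩⟩, hp⟩
    change y * t * d = l * t * c at hp
    have hd' : d = t⁻¹ * (l⁻¹ * y)⁻¹ * t * c := by
      have : d = (y * t)⁻¹ * (l * t * c) := by rw [← hp]; group
      rw [this]; group
    have hm : l⁻¹ * y ∈ M := by
      refine (hM _).2 ⟨L.mul_mem (L.inv_mem hl) hy, ?_⟩
      have : t⁻¹ * (l⁻¹ * y) * t = c * d⁻¹ := by rw [hd']; group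
      rw [this]
      exact K.mul_mem hc (K.inv_mem hd)
    refine ⟨⟨_, hm⟩, Subtype.ext (Prod.ext (Subtype.ext ?_) (Subtype.ext ?_))⟩
    · simp
    · exact hd'.symm

theorem sum_doubleCosets [Fintype G] {K L H : Subgroup G} [Fintype K] [Fintype L] [Fintype H]
    (T : Finset G) (hK : K ≤ H) (hL : L ≤ H) (hT : ∀ t ∈ T, t ∈ H)
    (hT' : ∀ h ∈ H, ∃! t, t ∈ T ∧ ∃ l ∈ L, ∃ c ∈ K, h = l * t * c)
    (M : G → Subgroup G) (hM : ∀ t m, m ∈ M t ↔ m ∈ L ∧ t⁻¹ * m * t ∈ K)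
    (Φ : G → k) (hΦ : ∀ z, ∀ c ∈ K, Φ (z * c) = Φ z) :
    (Fintype.card K : k)⁻¹ * ∑ x : H, Φ x =
      ∑ t ∈ T, (Nat.card (M t) : k)⁻¹ * ∑ y : L, Φ (y * t) := by
  classical
  have hcK : (Fintype.card K : k) ≠ 0 := by exact_mod_cast Fintype.card_ne_zero
  have step : ∀ t ∈ T, (Nat.card (M t) : k)⁻¹ * ∑ y : L, Φ (y * t) =
      (Fintype.card K : k)⁻¹ * ∑ x : H,
        if ∃ l ∈ L, ∃ c ∈ K, (x : G) = l * t * c then Φ x else 0 := by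
    intro t ht
    have hcM : (Nat.card (M t) : k) ≠ 0 := by exact_mod_cast Nat.card_pos.ne'
    have e1 : (Fintype.card K : k) * ∑ y : L, Φ (y * t) =
        ∑ p : L × K, Φ ((p.1 : G) * t * p.2) := by
      rw [Fintype.sum_prod_type, Finset.mul_sum]
      refine Finset.sum_congr rfl fun y _ => ?_
      simp [hΦ]
    have e2 : ∑ p : L × K, Φ ((p.1 : G) * t * p.2) = (Nat.card (M t) : k) * ∑ x : H,
        if ∃ l ∈ L, ∃ c ∈ K, (x : G) = l * t * c then Φ x else 0 := by
      let π : L × K → H := fun p =>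
        ⟨(p.1 : G) * t * p.2, H.mul_mem (H.mul_mem (hL p.1.2) (hT t ht)) (hK p.2.2)⟩
      have e3 : ∑ p : L × K, Φ ((p.1 : G) * t * p.2) = ∑ p : L × K, Φ (π p) := rfl
      rw [e3, ← Finset.sum_fiberwise (s := Finset.univ) (g := π), Finset.mul_sum]
      refine Finset.sum_congr rfl fun x _ => ?_
      have e4 : ∑ p ∈ Finset.univ.filter (fun p => π p = x), Φ (π p) =
          ∑ p ∈ Finset.univ.filter (fun p => π p = x), Φ x :=
        Finset.sum_congr rfl fun p hp => by rw [(Finset.mem_filter.1 hp).2]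
      rw [e4, Finset.sum_const, nsmul_eq_mul]
      split_ifs with hx
      · rw [← card_doubleCoset_fiber t (hM t) x hx, Nat.card_eq_fintype_card,
          Fintype.card_subtype]
        simp only [π, Subtype.ext_iff]
      · have : Finset.univ.filter (fun p => π p = x) = ∅ := by
          refine Finset.filter_eq_empty_iff.2 fun p _ hp => hx ?_
          exact ⟨p.1, p.1.2, p.2, p.2.2, congrArg Subtype.val hp.symm⟩
        simp [this]
    rw [e2] at e1
    field_simp
    rw [mul_comm _ (Fintype.card K : k), e1]
  rw [Finset.sum_congr rfl step, ← Finset.mul_sum, Finset.sum_comm]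
  congr 1
  refine Finset.sum_congr rfl fun x _ => ?_
  obtain ⟨t, ⟨ht, hx⟩, huniq⟩ := hT' x x.2
  rw [Finset.sum_eq_single t]
  · rw [if_pos hx]
  · intro s hs hne
    exact if_neg fun h => hne (huniq s ⟨hs, h⟩)
  · intro h
    exact absurd ht h

/-- The double coset formula for induced class functions. -/
theorem indChar_mackey {K L H : Subgroup G} (hK : K ≤ H) (hL : L ≤ H)
    (T : Finset G) (hT : ∀ t ∈ T, t ∈ H)
    (hT' : ∀ h ∈ H, ∃! t, t ∈ T ∧ ∃ l ∈ L, ∃ c ∈ K, h = l * t * c)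
    (M : G → Subgroup G) (hML : ∀ t, M t ≤ L)
    (hM : ∀ t m, m ∈ M t ↔ m ∈ L ∧ t⁻¹ * m * t ∈ K) (φ : ∀ t, M t →* K)
    (hφ : ∀ t (m : M t), (φ t m : G) = t⁻¹ * m * t)
    (f : K → k) (hf : ∀ g x, f (x * g * x⁻¹) = f g) (l : L) :
    indChar (Subgroup.inclusion hK) f (Subgroup.inclusion hL l) =
      ∑ t ∈ T, indChar (Subgroup.inclusion (hML t)) (fun m => f (φ t m)) l := by
  classical
  have := Fintype.ofFinite G
  let F : G → k := fun z => if hz : z ∈ K then f ⟨z, hz⟩ else 0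
  have hF : ∀ z, ∀ c ∈ K, F (c * z * c⁻¹) = F z := by
    intro z c hc
    by_cases hz : z ∈ K
    · have h1 : c * z * c⁻¹ ∈ K := K.mul_mem (K.mul_mem hc hz) (K.inv_mem hc)
      simp only [F, dif_pos hz, dif_pos h1]
      exact hf ⟨z, hz⟩ ⟨c, hc⟩
    · have h1 : c * z * c⁻¹ ∉ K := fun h => hz (by
        have := K.mul_mem (K.mul_mem (K.inv_mem hc) h) hc
        simpa [mul_assoc] using this)
      simp only [F, dif_neg hz, dif_neg h1]
  have hA : ∀ x : H, (∑ g : K, if Subgroup.inclusion hK g * x = x * Subgroup.inclusion hL l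
      then f g else 0) = F (x * l * (x : G)⁻¹) := by
    intro x
    by_cases hz : (x : G) * l * (x : G)⁻¹ ∈ K
    · simp only [F, dif_pos hz]
      rw [Finset.sum_eq_single ⟨_, hz⟩]
      · rw [if_pos (Subtype.ext (by simp))]
      · intro g _ hne
        refine if_neg fun h => hne (Subtype.ext ?_)
        have h1 : (g : G) * x = x * l := congrArg Subtype.val h
        exact eq_mul_inv_of_mul_eq h1
      · simp
    · simp only [F, dif_neg hz]
      refine Finset.sum_eq_zero fun g _ => if_neg fun h => hz ?_
      have h1 : (g : G) * x = x * l := congrArg Subtype.val h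
      rw [← h1]; simp
  have hB : ∀ t, ∀ y : L, (∑ m : M t, if Subgroup.inclusion (hML t) m * y = y * l
      then f (φ t m) else 0) = F (t⁻¹ * (y * l * (y : G)⁻¹) * t) := by
    intro t y
    by_cases hz : t⁻¹ * ((y : G) * l * (y : G)⁻¹) * t ∈ K
    · have hm : (y : G) * l * (y : G)⁻¹ ∈ M t :=
        (hM t _).2 ⟨L.mul_mem (L.mul_mem y.2 l.2) (L.inv_mem y.2), hz⟩
      simp only [F, dif_pos hz]
      rw [Finset.sum_eq_single ⟨_, hm⟩]
      · rw [if_pos (Subtype.ext (by simp))]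
        congr 1
        exact Subtype.ext (hφ _ _)
      · intro g _ hne
        refine if_neg fun h => hne (Subtype.ext ?_)
        have h1 : (g : G) * y = y * l := congrArg Subtype.val h
        exact eq_mul_inv_of_mul_eq h1
      · simp
    · simp only [F, dif_neg hz]
      refine Finset.sum_eq_zero fun m _ => if_neg fun h => hz ?_
      have h1 : (m : G) * y = y * l := congrArg Subtype.val h
      have h2 : t⁻¹ * ((y : G) * l * (y : G)⁻¹) * t = φ t m := by
        rw [← h1, hφ, mul_inv_cancel_right]
      rw [h2]
      exact (φ t m).2
  let Φ : G → k := fun z => F (z⁻¹ * l * z)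
  have hΦ : ∀ z, ∀ c ∈ K, Φ (z * c) = Φ z := by
    intro z c hc
    have := hF (z⁻¹ * l * z) c⁻¹ (K.inv_mem hc)
    simp only [Φ]
    rw [← this]
    congr 1
    group
  have main := sum_doubleCosets T hK hL hT hT' M hM Φ hΦ
  rw [indChar_apply, Finset.sum_comm]
  refine Eq.trans ?_ (main.trans ?_)
  · congr 1
    refine (Finset.sum_congr rfl fun x _ => (by convert hA x)).trans ?_
    refine Fintype.sum_equiv (Equiv.inv H) _ _ fun x => ?_
    simp [Φ]
  · refine Finset.sum_congr rfl fun t _ => ?_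
    rw [indChar_apply, Finset.sum_comm, Nat.card_eq_fintype_card]
    congr 1
    symm
    refine (Finset.sum_congr rfl fun y _ => (by convert hB t y)).trans ?_
    refine Fintype.sum_equiv (Equiv.inv L) _ _ fun y => ?_
    simp only [Φ, Equiv.inv_apply, Subgroup.coe_inv]
    congr 1
    group

end DoubleCosets
section RepresentationGreenFunctors

namespace RepRing

open GrothendieckRing

variable {k : Type} [Field k] [CharZero k] {H K L : Type u} [Group H] [Group K] [Group L]
  [Finite H] [Finite K] [Finite L]

theorem pull_inner (φ : H →* H) (g : H) (hφ : ∀ h, φ h = g⁻¹ * h * g) (x : RepRing k H) :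
    pull φ x = x := by
  refine char_injective (funext fun h => ?_)
  rw [char_pull, hφ]
  simpa using char_conj x h g⁻¹

theorem pull_pull (φ : K →* H) (ψ : L →* K) (x : RepRing k H) :
    pull ψ (pull φ x) = pull (φ.comp ψ) x := by
  refine char_injective (funext fun h => ?_)
  rw [char_pull, char_pull, char_pull]
  rfl

theorem ind_ind (φ : K →* H) (ψ : H →* L) (x : RepRing k K) :
    ind ψ (ind φ x) = ind (ψ.comp φ) x := by
  apply char_injective
  rw [char_ind, char_ind, char_ind, indChar_indChar]

theorem ind_mulEquiv (e : K ≃* H) (x : RepRing k K) :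
    ind e.toMonoidHom x = pull e.symm.toMonoidHom x := by
  refine char_injective (funext fun h => ?_)
  rw [char_ind, char_pull, indChar_mulEquiv e _ fun g h => char_conj x g h]
  rfl

theorem ind_mul (φ : K →* H) (y : RepRing k H) (x : RepRing k K) :
    ind φ (pull φ y * x) = y * ind φ x := by
  apply char_injective
  rw [char_ind, map_mul char, map_mul char, char_ind,
    ← indChar_mul φ _ fun g h => char_conj y g h]
  have h1 : char (pull φ y) = fun g => char y (φ g) := funext (char_pull φ y)
  rw [h1]

/-- The double coset formula for virtual representations. -/
theorem pull_ind {G : Type u} [Group G] [Finite G] {K L H : Subgroup G} (hK : K ≤ H) (hL : L ≤ H)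
    (T : Finset G) (hT : ∀ t ∈ T, t ∈ H)
    (hT' : ∀ h ∈ H, ∃! t, t ∈ T ∧ ∃ l ∈ L, ∃ k ∈ K, h = l * t * k) (x : RepRing k K) :
    pull (Subgroup.inclusion hL) (ind (Subgroup.inclusion hK) x) =
      ∑ t ∈ T, ind (Subgroup.inclusion (inf_le_left : L ⊓ MulAut.conj t • K ≤ L))
        (pull ((conjEquiv t rfl).toMonoidHom.comp (Subgroup.inclusion inf_le_right)) x) := by
  let M : G → Subgroup G := fun t => L ⊓ MulAut.conj t • K
  have hM : ∀ t, M t ≤ L := fun _ => inf_le_left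
  let φ : ∀ t, M t →* K := fun t =>
    (conjEquiv t rfl).toMonoidHom.comp (Subgroup.inclusion inf_le_right)
  refine char_injective (funext fun l => ?_)
  rw [char_pull, char_ind, map_sum, Finset.sum_apply,
    indChar_mackey hK hL T hT hT' M hM (fun t m => and_congr_right fun _ => mem_conj_smul_iff) φ
      (fun _ _ => rfl) (char x) (fun g h => char_conj x g h) l]
  refine Finset.sum_congr rfl fun t _ => ?_
  rw [char_ind]
  have h1 : char (pull (φ t) x) = fun m => char x (φ t m) := funext (char_pull (φ t) x)
  exact congrFun (congrArg _ h1.symm) l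

/-- Linearization, sending a finite `H`-set to its permutation representation. -/
noncomputable def lin (k : Type) [Field k] [CharZero k] (H : Type u) [Group H] [Finite H] :
    BurnsideRing H →+* RepRing k H :=
  mapRing (RepSemiring.lin k H)

/-- Extension of scalars. -/
noncomputable def baseChange (k' : Type) [Field k'] [CharZero k'] [Algebra k k'] (H : Type u)
    [Group H] [Finite H] : RepRing k H →+* RepRing k' H :=
  mapRing (RepSemiring.baseChange k' H)

theorem char_baseChange (k' : Type) [Field k'] [CharZero k'] [Algebra k k'] (x : RepRing k H)
    (h : H) : char (baseChange k' H x) h = algebraMap k k' (char x h) := by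
  obtain ⟨a, b, rfl⟩ := exists_sub x
  simp only [map_sub, baseChange, mapRing_of, char_of, Pi.sub_apply, RepSemiring.char_baseChange]

theorem baseChange_pull (k' : Type) [Field k'] [CharZero k'] [Algebra k k'] (φ : K →* H)
    (x : RepRing k H) : baseChange k' K (pull φ x) = pull φ (baseChange k' H x) := by
  refine char_injective (funext fun g => ?_)
  rw [char_baseChange, char_pull, char_pull, char_baseChange]

theorem baseChange_ind (k' : Type) [Field k'] [CharZero k'] [Algebra k k'] (φ : K →* H)
    (x : RepRing k K) : baseChange k' H (ind φ x) = ind φ (baseChange k' K x) := by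
  refine char_injective (funext fun h => ?_)
  have h1 : char (baseChange k' K x) = fun g => algebraMap k k' (char x g) :=
    funext (char_baseChange k' x)
  rw [char_baseChange, char_ind, char_ind, h1, indChar_algebraMap]

open Classical in
theorem sum_push [Fintype H] [Fintype K] (φ : K →* H) (hφ : Function.Injective φ) (X : FinGSet K)
    [Fintype X.carrier] [Fintype (X.push φ).carrier] (F : (X.push φ).carrier → k) :
    ∑ x : H, ∑ p : X.carrier, F (FinGSet.push.mk φ X x⁻¹ p) = (Fintype.card K : k) * ∑ c, F c := by
  let π : H × X.carrier → (X.push φ).carrier := fun p => FinGSet.push.mk φ X p.1⁻¹ p.2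
  rw [← Fintype.sum_prod_type' (f := fun x p => F (FinGSet.push.mk φ X x⁻¹ p))]
  have e1 : ∑ p : H × X.carrier, F (FinGSet.push.mk φ X p.1⁻¹ p.2) = ∑ p, F (π p) := rfl
  rw [e1, ← Finset.sum_fiberwise (s := Finset.univ) (g := π), Finset.mul_sum]
  refine Finset.sum_congr rfl fun c _ => ?_
  have e2 : ∑ p ∈ Finset.univ.filter (fun p => π p = c), F (π p) =
      ∑ p ∈ Finset.univ.filter (fun p => π p = c), F c :=
    Finset.sum_congr rfl fun p hp => by rw [(Finset.mem_filter.1 hp).2]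
  rw [e2, Finset.sum_const, nsmul_eq_mul]
  congr 2
  obtain ⟨a, p, rfl⟩ := FinGSet.push.exists_mk _ _ c
  symm
  refine Finset.card_bij (fun m _ => ((a * φ m⁻¹)⁻¹, m • p)) ?_ ?_ ?_
  · intro m _
    refine Finset.mem_filter.2 ⟨Finset.mem_univ _, ?_⟩
    change FinGSet.push.mk φ X (a * φ m⁻¹)⁻¹⁻¹ (m • p) = _
    exact ((FinGSet.push.mk_eq φ X).2 ⟨m, inv_inv _, rfl⟩).symm
  · intro m _ m' _ h
    have h1 := mul_left_cancel (inv_injective (congrArg Prod.fst h))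
    exact inv_injective (hφ h1)
  · rintro ⟨x, p'⟩ h
    obtain ⟨m, h1, h2⟩ := (FinGSet.push.mk_eq φ X).1 (Finset.mem_filter.1 h).2.symm
    refine ⟨m, Finset.mem_univ _, Prod.ext ?_ h2.symm⟩
    change (a * φ m⁻¹)⁻¹ = x
    rw [← h1, inv_inv]

theorem card_fixed_push (φ : K →* H) (hφ : Function.Injective φ) (X : FinGSet K) (h : H) :
    (Nat.card {c : (X.push φ).carrier // h • c = c} : k) =
      indChar φ (fun g => (Nat.card {p : X.carrier // g • p = p} : k)) h := by
  classical
  have := Fintype.ofFinite H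
  have := Fintype.ofFinite K
  have := Fintype.ofFinite X.carrier
  have := Fintype.ofFinite (X.push φ).carrier
  have hc : (Fintype.card K : k) ≠ 0 := by exact_mod_cast Fintype.card_ne_zero
  have key : ∀ (x : H) (p : X.carrier), (∑ g : K, if φ g * x = x * h then
      (if g • p = p then (1 : k) else 0) else 0) =
      if h • FinGSet.push.mk φ X x⁻¹ p = FinGSet.push.mk φ X x⁻¹ p then 1 else 0 := by
    intro x p
    have hiff : ∀ g : K, φ g * x = x * h ↔ x⁻¹ = h * x⁻¹ * φ g⁻¹ := by
      intro g
      rw [map_inv, eq_mul_inv_iff_mul_eq, inv_mul_eq_iff_eq_mul, ← mul_assoc,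
        eq_mul_inv_iff_mul_eq]
    by_cases hx : h • FinGSet.push.mk φ X x⁻¹ p = FinGSet.push.mk φ X x⁻¹ p
    · rw [if_pos hx]
      rw [FinGSet.push.smul_mk] at hx
      obtain ⟨g, h1, h2⟩ := (FinGSet.push.mk_eq φ X).1 hx
      rw [Finset.sum_eq_single g]
      · rw [if_pos ((hiff g).2 h1), if_pos h2.symm]
      · intro g' _ hne
        refine if_neg fun h' => hne (hφ (mul_right_cancel (h'.trans ((hiff g).2 h1).symm)))
      · simp
    · rw [if_neg hx]
      refine Finset.sum_eq_zero fun g _ => ?_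
      split_ifs with h1 h2
      · refine absurd ?_ hx
        rw [FinGSet.push.smul_mk]
        exact (FinGSet.push.mk_eq φ X).2 ⟨g, (hiff g).1 h1, h2.symm⟩
      · rfl
      · rfl
  have hcard : ∀ g : K, (Nat.card {p : X.carrier // g • p = p} : k) =
      ∑ p : X.carrier, if g • p = p then 1 else 0 := by
    intro g
    rw [Nat.card_eq_fintype_card, Fintype.card_subtype, Finset.sum_boole]
  rw [indChar_apply]
  have e1 : (∑ g : K, ∑ x : H, if φ g * x = x * h then
      (Nat.card {p : X.carrier // g • p = p} : k) else 0) =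
      ∑ x : H, ∑ p : X.carrier, if h • FinGSet.push.mk φ X x⁻¹ p = FinGSet.push.mk φ X x⁻¹ p
        then (1 : k) else 0 := by
    rw [Finset.sum_comm]
    refine Finset.sum_congr rfl fun x _ => ?_
    rw [← Finset.sum_congr rfl fun p _ => key x p, Finset.sum_comm]
    refine Finset.sum_congr rfl fun g _ => ?_
    rw [hcard]
    split_ifs <;> simp
  refine Eq.trans ?_ (congrArg _ (Eq.trans e1.symm ?_))
  · rw [sum_push φ hφ X (fun c => if h • c = c then (1 : k) else 0), inv_mul_cancel_left₀ hc,
      Nat.card_eq_fintype_card, Fintype.card_subtype, Finset.sum_boole]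
  · refine Finset.sum_congr rfl fun g _ => Finset.sum_congr rfl fun x _ => ?_
    congr

theorem lin_push (φ : K →* H) (hφ : Function.Injective φ) (x : BurnsideRing K) :
    lin k H (mapAdd (BurnsideSemiring.push φ) x) = ind φ (lin k K x) := by
  obtain ⟨a, b, rfl⟩ := exists_sub x
  have key : ∀ a : BurnsideSemiring K,
      RepSemiring.lin k H (BurnsideSemiring.push φ a) = RepSemiring.ind φ (RepSemiring.lin k K a) := by
    intro a
    obtain ⟨X, rfl⟩ := BurnsideSemiring.exists_mk a
    refine RepSemiring.char_injective (funext fun h => ?_)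
    rw [RepSemiring.char_ind, BurnsideSemiring.push_mk, RepSemiring.char_lin,
      card_fixed_push φ hφ X h]
    have h1 : RepSemiring.char (RepSemiring.lin k K (.mk X)) =
        fun g => (Nat.card {p : X.carrier // g • p = p} : k) := funext (RepSemiring.char_lin X)
    rw [h1]
  simp only [map_sub, mapAdd_of, lin, ind, mapRing_of, key]

theorem lin_pull (φ : K →* H) (x : BurnsideRing H) :
    lin k K (mapRing (BurnsideSemiring.pull φ) x) = pull φ (lin k H x) := by
  obtain ⟨a, b, rfl⟩ := exists_sub x
  have key : ∀ a : BurnsideSemiring H,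
      RepSemiring.lin k K (BurnsideSemiring.pull φ a) =
        RepSemiring.pull φ (RepSemiring.lin k H a) := by
    intro a
    obtain ⟨X, rfl⟩ := BurnsideSemiring.exists_mk a
    refine RepSemiring.char_injective (funext fun h => ?_)
    rw [RepSemiring.char_pull, BurnsideSemiring.pull_mk, RepSemiring.char_lin,
      RepSemiring.char_lin]
    rfl
  simp only [map_sub, lin, pull, mapRing_of, key]

end RepRing

/-- The Green functor `G/H ↦ R_k(H)` of representation rings over `k`: restriction and conjugation
are given by pulling back the action, and transfer is induction. -/
noncomputable def repGreen (k : Type) [Field k] [CharZero k] (G : Type u) [Group G] [Finite G] :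
    GreenFunctor.{u, u + 1} G :=
  GreenFunctor.ofPullPush (fun H => RepRing k H) (fun φ => RepRing.pull φ)
    (fun φ => RepRing.ind φ) RepRing.pull_inner RepRing.pull_pull RepRing.ind_ind
    RepRing.ind_mulEquiv RepRing.ind_mul RepRing.pull_ind

/-- The linearization morphism `A → R_k`. -/
noncomputable def linHom (k : Type) [Field k] [CharZero k] (G : Type u) [Group G] [Finite G] :
    GreenFunctor.Hom (burnsideGreen G) (repGreen k G) where
  app H := RepRing.lin k H
  app_res h x := RepRing.lin_pull (Subgroup.inclusion h) x
  app_tr h x := RepRing.lin_push (Subgroup.inclusion h) (Subgroup.inclusion_injective h) x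
  app_conj g _ _ e x := RepRing.lin_pull (conjEquiv g e).toMonoidHom x

/-- The extension of scalars `R_k → R_k'`. -/
noncomputable def baseChangeHom (k k' : Type) [Field k] [CharZero k] [Field k'] [CharZero k']
    [Algebra k k'] (G : Type u) [Group G] [Finite G] :
    GreenFunctor.Hom (repGreen k G) (repGreen k' G) where
  app H := RepRing.baseChange k' H
  app_res h x := RepRing.baseChange_pull k' (Subgroup.inclusion h) x
  app_tr h x := RepRing.baseChange_ind k' (Subgroup.inclusion h) x
  app_conj g _ _ e x := RepRing.baseChange_pull k' (conjEquiv g e).toMonoidHom x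

end RepresentationGreenFunctors

section AdamsOperations

namespace RepRing

open GrothendieckRing

variable {H : Type u} [Group H] [Finite H]

/-- The class of the exterior power `Λⁿ V` in the complex representation ring. -/
noncomputable def extClass (V : FinRep ℂ H) (n : ℕ) : RepRing ℂ H := of (RepSemiring.mk (V.ext n))

/-- The Adams operation `ψⁿ` on the class of a complex representation `V`, defined recursively by
Newton's formula
`ψⁿ⁺¹ V = (-1)ⁿ (n + 1) Λⁿ⁺¹ V - ∑_{i < n} (-1)ⁱ⁺¹ Λⁱ⁺¹ V · ψⁿ⁻ⁱ V`, with `ψ⁰ V = dim V`. -/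
noncomputable def adamsRep (V : FinRep ℂ H) : ℕ → RepRing ℂ H
  | 0 => (finrank ℂ V.V : ℕ)
  | n + 1 => (-1) ^ n * (n + 1 : ℕ) * extClass V (n + 1) -
      ∑ i : Fin n, (-1) ^ (i.1 + 1) * extClass V (i.1 + 1) * adamsRep V (n - i.1)
termination_by n => n

theorem char_adamsRep (V : FinRep ℂ H) (n : ℕ) (h : H) :
    char (adamsRep V n) h = V.ρ.character (h ^ n) := by
  have hN : (V.ρ h) ^ Nat.card H = 1 := by rw [← map_pow, pow_card_eq_one', map_one]
  obtain ⟨d, b, μ, hμ⟩ := Representation.exists_eigenbasis (V.ρ h) _ Nat.card_pos.ne' hN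
  have hpow : ∀ n, V.ρ.character (h ^ n) =
      MvPolynomial.aeval μ (MvPolynomial.psum (Fin d) ℂ n) := fun n => by
    rw [Representation.character, map_pow, Representation.trace_pow_eq_psum b _ μ hμ]
  have hext : ∀ n, char (extClass V n) h =
      MvPolynomial.aeval μ (MvPolynomial.esymm (Fin d) ℂ n) := fun n => by
    rw [extClass, char_of, RepSemiring.char_mk]
    exact Representation.trace_extPower b _ μ hμ n
  rw [hpow]
  induction n using Nat.strong_induction_on with
  | _ n ih =>
    cases n with
    | zero =>
      rw [adamsRep, map_natCast, ← hpow, pow_zero, Representation.char_one]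
      rfl
    | succ n =>
      rw [adamsRep, Representation.psum_newton, ← hext]
      simp only [map_sub, map_mul, map_pow, map_neg, map_one, map_natCast, map_sum, Pi.sub_apply,
        Pi.mul_apply, Pi.pow_apply, Pi.neg_apply, Pi.one_apply, Pi.natCast_apply, Finset.sum_apply,
        ← hext]
      congr 1
      refine Finset.sum_congr rfl fun i _ => ?_
      rw [ih _ (by omega)]

/-- The Adams operation on isomorphism classes of representations. -/
noncomputable def adamsFun (n : ℕ) : RepSemiring ℂ H → RepRing ℂ H :=
  Quotient.lift (fun V => adamsRep V n) fun V W h => char_injective (funext fun g => by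
    rw [char_adamsRep, char_adamsRep, FinRep.equiv_iff.1 h])

theorem char_adamsFun (n : ℕ) (a : RepSemiring ℂ H) (h : H) :
    char (adamsFun n a) h = RepSemiring.char a (h ^ n) := by
  obtain ⟨V, rfl⟩ := RepSemiring.exists_mk a
  exact char_adamsRep V n h

/-- The Adams operation `ψⁿ` on the complex representation ring. -/
noncomputable def adams (n : ℕ) (H : Type u) [Group H] [Finite H] : RepRing ℂ H →+* RepRing ℂ H :=
  liftRing
    { toFun := adamsFun n
      map_zero' := char_injective (by ext; simp [char_adamsFun, RepSemiring.char_zero])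
      map_one' := char_injective (by ext; simp [char_adamsFun, RepSemiring.char_one])
      map_add' x y := char_injective (by ext; simp [char_adamsFun, RepSemiring.char_add])
      map_mul' x y := char_injective (by ext; simp [char_adamsFun, RepSemiring.char_mul]) }

theorem char_adams (n : ℕ) (x : RepRing ℂ H) (h : H) :
    char (adams n H x) h = char x (h ^ n) := by
  obtain ⟨a, b, rfl⟩ := exists_sub x
  simp only [map_sub, adams, liftRing_of, Pi.sub_apply, char_of]
  exact congrArg₂ _ (char_adamsFun n a h) (char_adamsFun n b h)

theorem adams_pull {K : Type u} [Group K] [Finite K] (n : ℕ) (φ : K →* H) (x : RepRing ℂ H) :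
    adams n K (pull φ x) = pull φ (adams n H x) := by
  refine char_injective (funext fun g => ?_)
  rw [char_adams, char_pull, char_pull, char_adams, map_pow]

theorem adams_ind {K : Type u} [Group K] [Finite K] (n : ℕ) (hK : (Nat.card K).Coprime n)
    (hH : (Nat.card H).Coprime n) (φ : K →* H) (x : RepRing ℂ K) :
    adams n H (ind φ x) = ind φ (adams n K x) := by
  refine char_injective (funext fun h => ?_)
  have h1 : char (adams n K x) = fun g => char x (g ^ n) := funext (char_adams n x)
  rw [char_adams, char_ind, char_ind, h1, indChar_pow φ _ n hK hH]

end RepRing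

/-- The Adams operation `ψⁿ` on the Green functor of complex representation rings, for `n` prime to
the order of the group. -/
noncomputable def adamsHom (G : Type u) [Group G] [Finite G] (n : ℕ)
    (hn : (Nat.card G).Coprime n) : GreenFunctor.Hom (repGreen ℂ G) (repGreen ℂ G) where
  app H := RepRing.adams n H
  app_res h x := RepRing.adams_pull n (Subgroup.inclusion h) x
  app_tr {K H} h x := RepRing.adams_ind n (hn.coprime_dvd_left K.card_subgroup_dvd_card)
    (hn.coprime_dvd_left H.card_subgroup_dvd_card) (Subgroup.inclusion h) x
  app_conj g _ _ e x := RepRing.adams_pull n (conjEquiv g e).toMonoidHom x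

end AdamsOperations

/-- `ℓ` is a primitive root modulo `n`: its residue class is a unit that generates `(ℤ/n)ˣ`. -/
def IsPrimitiveRootMod (ℓ n : ℕ) : Prop :=
  ∃ u : (ZMod n)ˣ, (u : ZMod n) = ℓ ∧ ∀ v : (ZMod n)ˣ, v ∈ Subgroup.zpowers u

theorem IsPrimitiveRootMod.coprime {ℓ n : ℕ} (h : IsPrimitiveRootMod ℓ n) : n.Coprime ℓ := by
  obtain ⟨u, hu, -⟩ := h
  exact ((ZMod.isUnit_iff_coprime ℓ n).1 ⟨u, hu⟩).symm

/-! ### Finite p-groups: normal subgroups of type C_p × C_p -/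

section PGroups

/-! In characteristic zero a virtual representation is determined by its character, so every
comparison below is one of class functions. Extension of scalars from ℚ to ℂ is injective on
representation rings; hence the linearizations over ℚ and over ℂ have the same kernel, and `A/J`
embeds in the rational representation ring. A rational character is Galois invariant, that is,
χ(h^n) = χ(h) for n prime to |H| (`char_rat_pow`), so it is fixed by ψ^ℓ. Conversely, if ψ^ℓ fixes
x, then its character is invariant under h ↦ h^(ℓ^j) for all j; since ℓ generates (ℤ/|G|)ˣ, it is
invariant under all powers prime to q (`powInvariant_of_adams`).

Both isomorphisms therefore reduce to one surjectivity statement, `PowInvariant.mem_range_lin`: for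
odd q, a virtual complex character of a q-group H that is invariant under powers prime to q is a
virtual permutation character. Applied to rational characters it makes `A → RQ` onto, without any
discussion of Schur indices.

The statement is proved by induction on |H|. For a normal subgroup N ≠ 1 the coinvariants `avg N x`
are inflated from H/N, so the induction hypothesis covers them; power invariance survives
restriction, induction and inflation. It remains to write x in terms of such averages and of
inductions from proper subgroups.

If H is cyclic and N is its subgroup of order q, then x - `avg N x` vanishes off N, and it is an
integral multiple of the difference of the regular representations of H and H/N
(`mem_range_lin_of_isCyclic`).

If H is not cyclic, oddness of q provides a normal E ≅ C_q × C_q (`IsPGroup.exists_normal_card_sq`).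
When E is central, inclusion-exclusion over the q + 1 subgroups L of order q in E gives x = ∑ `avg L
x` - q `avg E x` (`mem_range_lin_of_central`). When E is not central, let Z be the intersection of E
with the center, take e in E outside Z, let C be the centralizer of e and D = ⟨e⟩. Then x differs
from the induction to H of the D-coinvariants of x restricted to C by a class inflated from H/Z
(`exists_eq_ind_add_avg`), and both pieces are covered by induction. -/

/-- Moving one y past one x costs a central factor c, and sorting (xy)^n takes n(n-1)/2 such
exchanges. For an odd prime p the exponent p(p-1)/2 is a multiple of p, which makes p-th powers
multiplicative when c^p = 1. -/
theorem mul_pow_of_commutator_central {G : Type*} [Group G] {x y c : G} (h : y * x = x * y * c)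
    (hx : Commute c x) (hy : Commute c y) (n : ℕ) :
    (x * y) ^ n = x ^ n * y ^ n * c ^ n.choose 2 := by
  have key : ∀ n : ℕ, y ^ n * x = x * y ^ n * c ^ n := by
    intro n
    induction n with
    | zero => simp
    | succ n ih =>
      calc y ^ (n + 1) * x = y * (y ^ n * x) := by rw [pow_succ', mul_assoc]
        _ = y * x * y ^ n * c ^ n := by rw [ih]; group
        _ = x * y * (c * y ^ n) * c ^ n := by rw [h]; group
        _ = x * y ^ (n + 1) * c ^ (n + 1) := by
          rw [(hy.pow_right n).eq, pow_succ' y, pow_succ' c]; group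
  induction n with
  | zero => simp
  | succ n ih =>
    calc (x * y) ^ (n + 1) = x ^ n * y ^ n * (c ^ n.choose 2 * x) * y := by
          rw [pow_succ, ih]; group
      _ = x ^ n * (y ^ n * x) * (c ^ n.choose 2 * y) := by
          rw [(hx.pow_left _).eq]; group
      _ = x ^ n * x * y ^ n * (c ^ n * y) * c ^ n.choose 2 := by
          rw [(hy.pow_left (n.choose 2)).eq, key]; group
      _ = x ^ (n + 1) * y ^ (n + 1) * (c ^ n * c ^ n.choose 2) := by
          rw [(hy.pow_left n).eq, pow_succ x, pow_succ y]; group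
      _ = _ := by rw [← pow_add, Nat.choose_succ_succ' n 1, Nat.choose_one_right]

theorem Subgroup.normal_of_le_center {G : Type*} [Group G] {N : Subgroup G}
    (h : N ≤ Subgroup.center G) : N.Normal :=
  ⟨fun n hn g => by rwa [Subgroup.mem_center_iff.1 (h hn) g, mul_inv_cancel_right]⟩

variable {p : ℕ} [hp : Fact p.Prime] {G : Type u} [Group G] [Finite G]

/-- A nontrivial normal subgroup of a finite `p`-group contains a nontrivial central element. -/
theorem IsPGroup.exists_mem_center_of_normal (hG : IsPGroup p G) (N : Subgroup G) [N.Normal]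
    (hN : N ≠ ⊥) : ∃ g ∈ N, g ∈ Subgroup.center G ∧ g ≠ 1 := by
  have hdvd : p ∣ Nat.card N := by
    rcases (hG.to_subgroup N).card_eq_or_dvd with h | h
    · exact absurd (Subgroup.card_eq_one.1 h) hN
    · exact h
  -- The fixed points of conjugation on `N` are its elements central in `G`. Their number is
  -- divisible by `p` because |N| is, and 1 is one of them, so there is another.
  have h1 : (1 : N) ∈ MulAction.fixedPoints (ConjAct G) N := fun g => by
    exact smul_one g
  obtain ⟨b, hb, hne⟩ := (hG.of_equiv ConjAct.toConjAct).exists_fixed_point_of_prime_dvd_card_of_fixed_point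
    N hdvd h1
  refine ⟨b, b.2, Subgroup.mem_center_iff.2 fun g => ?_, fun h => hne (Subtype.ext h.symm)⟩
  have := congrArg Subtype.val (hb (ConjAct.toConjAct g))
  rw [ConjAct.Subgroup.val_conj_smul, ConjAct.toConjAct_smul] at this
  exact mul_inv_eq_iff_eq_mul.1 this

/-- A normal subgroup of order `p` of a finite `p`-group is central. -/
theorem IsPGroup.le_center_of_card_eq (hG : IsPGroup p G) (N : Subgroup G) [N.Normal]
    (hN : Nat.card N = p) : N ≤ Subgroup.center G := by
  obtain ⟨g, hgN, hgc, hg⟩ := hG.exists_mem_center_of_normal N fun h => by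
    rw [h, Subgroup.card_bot] at hN
    exact hp.out.one_lt.ne hN
  intro x hx
  have hne : (⟨g, hgN⟩ : N) ≠ 1 := fun h => hg (congrArg Subtype.val h)
  have : (⟨x, hx⟩ : N) ∈ Subgroup.zpowers (⟨g, hgN⟩ : N) := mem_zpowers_of_prime_card hN hne
  obtain ⟨k, hk⟩ := Subgroup.mem_zpowers_iff.1 this
  have hk' : g ^ k = x := by simpa using congrArg Subtype.val hk
  rw [← hk']
  exact zpow_mem hgc k

theorem Subgroup.card_comap_mk' (N : Subgroup G) [N.Normal] (K : Subgroup (G ⧸ N)) :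
    Nat.card (K.comap (QuotientGroup.mk' N)) = Nat.card N * Nat.card K := by
  have h1 := (K.comap (QuotientGroup.mk' N)).card_mul_index
  have h2 := N.card_eq_card_quotient_mul_card_subgroup
  have h3 := K.card_mul_index
  have h4 := K.index_comap_of_surjective (QuotientGroup.mk'_surjective N)
  rw [h4, h2, ← h3] at h1
  have h5 : K.index ≠ 0 := Subgroup.index_ne_zero_of_finite
  apply Nat.eq_of_mul_eq_mul_right (Nat.pos_of_ne_zero h5)
  rw [h1]; ring

/-- The nontrivial normal subgroup K/Z of G/Z contains a central element of order p; the preimage of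
the subgroup it generates is normal of order p², and it lies in K, whose elements satisfy k^p = 1.
This reduces the search for C_p × C_p to finding a normal K of exponent p strictly larger than Z. -/
theorem IsPGroup.exists_normal_card_sq_of_exponent (hG : IsPGroup p G) (Z K : Subgroup G)
    [Z.Normal] [K.Normal] (hZ : Nat.card Z = p) (hZK : Z < K) (hK : ∀ k ∈ K, k ^ p = 1) :
    ∃ E : Subgroup G, E.Normal ∧ Nat.card E = p ^ 2 ∧ ∀ e ∈ E, e ^ p = 1 := by
  let π := QuotientGroup.mk' Z
  have hπ : Function.Surjective π := QuotientGroup.mk'_surjective Z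
  have hKn : (K.map π).Normal := ‹K.Normal›.map π hπ
  obtain ⟨y, hyK, hyc, hy⟩ := (hG.to_quotient Z).exists_mem_center_of_normal (K.map π) fun h => by
    rw [Subgroup.map_eq_bot_iff, QuotientGroup.ker_mk'] at h
    exact not_le_of_gt hZK h
  have hyn : (Subgroup.zpowers y).Normal :=
    Subgroup.normal_of_le_center (Subgroup.zpowers_le.2 hyc)
  have hyp : orderOf y = p := by
    obtain ⟨x, hx, rfl⟩ := hyK
    refine orderOf_eq_prime ?_ hy
    rw [← map_pow, hK x hx, map_one]
  refine ⟨(Subgroup.zpowers y).comap π, inferInstance, ?_, fun e he => hK e ?_⟩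
  · rw [Subgroup.card_comap_mk', hZ, Nat.card_zpowers, hyp, sq]
  · have h1 : π e ∈ K.map π := (Subgroup.zpowers_le.2 hyK) he
    have h2 : e ∈ (K.map π).comap π := h1
    -- Since Z ≤ K, the preimage of K/Z is K itself.
    rwa [Subgroup.comap_map_eq_self (by rw [QuotientGroup.ker_mk']; exact hZK.le)] at h2

/-- A lift a of a generator of G/Z has the same order m as its image, since otherwise it would
generate G. Then a^(m/p) has order p and lies outside Z, because no smaller positive power of a than
a^m lies in Z. -/
theorem IsPGroup.exists_pow_eq_one_notMem (hcyc : ¬ IsCyclic G) (Z : Subgroup G) [Z.Normal]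
    (hG : IsPGroup p G) (hZ : Nat.card Z = p) (hq : IsCyclic (G ⧸ Z)) :
    ∃ y : G, y ∉ Z ∧ y ^ p = 1 := by
  obtain ⟨b, hb⟩ := hq.exists_generator
  obtain ⟨a, rfl⟩ := QuotientGroup.mk'_surjective Z b
  have hm : orderOf (QuotientGroup.mk' Z a) = Nat.card (G ⧸ Z) :=
    orderOf_eq_card_of_forall_mem_zpowers hb
  have hcard := Z.card_eq_card_quotient_mul_card_subgroup
  rw [hZ, ← hm] at hcard
  set m := orderOf (QuotientGroup.mk' Z a) with hm'
  have hdvd : m ∣ orderOf a := orderOf_map_dvd _ _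
  have hmpos : 0 < m := orderOf_pos _
  -- The order of `a` is a multiple of `m` dividing |G| = mp; the value mp is excluded because `G`
  -- is not cyclic.
  have ha : orderOf a = m := by
    obtain ⟨c, hc⟩ := hdvd
    have h1 : orderOf a ∣ Nat.card G := orderOf_dvd_natCard a
    rw [hc, hcard] at h1
    rcases (Nat.dvd_prime hp.out).1 (Nat.dvd_of_mul_dvd_mul_left hmpos h1) with h | h
    · rw [hc, h, mul_one]
    · exact absurd (isCyclic_of_orderOf_eq_card a (by rw [hc, h, hcard])) hcyc
  have hmZ : ∀ n : ℕ, a ^ n ∈ Z → m ∣ n := fun n hn => by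
    rw [hm']
    apply orderOf_dvd_of_pow_eq_one
    rw [← map_pow]
    exact (QuotientGroup.eq_one_iff _).2 hn
  -- Otherwise G/Z is trivial and |G| = p, which again makes `G` cyclic.
  have hpm : p ∣ m := by
    have hqp := hG.to_quotient Z
    rw [hm]
    rcases hqp.card_eq_or_dvd with h | h
    · rw [← hm] at h
      rw [h, one_mul] at hcard
      exact absurd (isCyclic_of_prime_card hcard) hcyc
    · exact h
  obtain ⟨c, hc⟩ := hpm
  have hcpos : 0 < c := Nat.pos_of_ne_zero fun h => by simp [h] at hc; omega
  refine ⟨a ^ c, fun h => ?_, ?_⟩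
  · have h1 := Nat.le_of_dvd hcpos (hmZ c h)
    have := hp.out.one_lt
    nlinarith
  · rw [← pow_mul, mul_comm, ← hc, ← ha, pow_orderOf_eq_one]

/-- Induction through G/Z for a central Z of order p. If G/Z is cyclic, G is abelian and the
elements with x^p = 1 form a subgroup larger than Z. Otherwise G/Z has a normal subgroup of type C_p
× C_p; on its preimage N, of order p³, the p-th power is a homomorphism to Z, and its kernel is a
normal subgroup of G of exponent p and of order at least p². -/
theorem exists_normal_card_sq_aux (hodd : Odd p) (n : ℕ) :
    ∀ {G : Type u} [Group G] [Finite G], Nat.card G = n → IsPGroup p G → ¬ IsCyclic G →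
      ∃ E : Subgroup G, E.Normal ∧ Nat.card E = p ^ 2 ∧ ∀ e ∈ E, e ^ p = 1 := by
  induction n using Nat.strong_induction_on with
  | _ n ih =>
  intro G _ _ hn hG hcyc
  have hnt : Nontrivial G := by
    by_contra h
    rw [not_nontrivial_iff_subsingleton] at h
    exact hcyc inferInstance
  have hcn := hG.center_nontrivial
  have hpd : p ∣ Nat.card (Subgroup.center G) := by
    rcases (hG.to_subgroup (Subgroup.center G)).card_eq_or_dvd with h | h
    · exact absurd h Finite.one_lt_card.ne'
    · exact h
  obtain ⟨z, hz⟩ := exists_prime_orderOf_dvd_card' p hpd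
  let Z : Subgroup G := Subgroup.zpowers (z : G)
  have hZc : Z ≤ Subgroup.center G := Subgroup.zpowers_le.2 z.2
  have hZn : Z.Normal := Subgroup.normal_of_le_center hZc
  have hZ : Nat.card Z = p := by
    rw [Nat.card_zpowers, ← hz]
    exact Subgroup.orderOf_coe z
  have hZp : ∀ x ∈ Z, x ^ p = 1 := fun x hx => by
    have := pow_card_eq_one' (x := (⟨x, hx⟩ : Z))
    rw [hZ] at this
    exact congrArg Subtype.val this
  by_cases hq : IsCyclic (G ⧸ Z)
  · have hcomm : ∀ a b : G, a * b = b * a :=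
      (MonoidHom.isMulCommutative_of_isCyclic_of_ker_le_center (QuotientGroup.mk' Z)
        (by rw [QuotientGroup.ker_mk']; exact hZc)).is_comm.comm
    let K : Subgroup G :=
      { carrier := {x | x ^ p = 1}
        one_mem' := one_pow p
        mul_mem' := fun {a b} ha hb => by
          change (a * b) ^ p = 1
          rw [(show Commute a b from hcomm a b).mul_pow, ha, hb, one_mul]
        inv_mem' := fun {a} ha => by
          change a⁻¹ ^ p = 1
          rw [inv_pow, ha, inv_one] }
    have hKn : K.Normal := Subgroup.normal_of_le_center fun x _ =>
      Subgroup.mem_center_iff.2 fun g => hcomm g x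
    obtain ⟨y, hyZ, hy⟩ := IsPGroup.exists_pow_eq_one_notMem hcyc Z hG hZ hq
    exact hG.exists_normal_card_sq_of_exponent Z K hZ
      (lt_of_le_of_ne hZp fun h => hyZ (h ▸ (hy : y ∈ K))) fun k hk => hk
  · have hlt : Nat.card (G ⧸ Z) < n := by
      rw [← hn, Z.card_eq_card_quotient_mul_card_subgroup, hZ]
      exact lt_mul_of_one_lt_right Nat.card_pos hp.out.one_lt
    obtain ⟨N', hN'n, hN'c, hN'p⟩ := ih _ hlt rfl (hG.to_quotient Z) hq
    let π := QuotientGroup.mk' Z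
    let N := N'.comap π
    have hNc : Nat.card N = p ^ 3 := by
      rw [Subgroup.card_comap_mk', hZ, hN'c]; ring
    have hNp : ∀ x ∈ N, x ^ p ∈ Z := fun x hx => by
      rw [← QuotientGroup.eq_one_iff]
      exact hN'p _ hx
    have hmul : ∀ x ∈ N, ∀ y ∈ N, (x * y) ^ p = x ^ p * y ^ p := by
      intro x hx y hy
      -- N/Z has order p² and is therefore abelian, so commutators of elements of `N` lie in the
      -- central subgroup `Z`.
      have hc : (y⁻¹ * x⁻¹) * (y * x) ∈ Z := by
        rw [← QuotientGroup.eq_one_iff]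
        have := congrArg Subtype.val
          ((IsPGroup.isMulCommutative_of_card_eq_prime_sq hN'c).is_comm.comm ⟨π y, hy⟩ ⟨π x, hx⟩)
        have h2 : (y : G ⧸ Z) * x = x * y := this
        rw [QuotientGroup.mk_mul, QuotientGroup.mk_mul, QuotientGroup.mk_mul, h2]
        simp [mul_assoc]
      have hcc := Subgroup.mem_center_iff.1 (hZc hc)
      rw [mul_pow_of_commutator_central (c := (y⁻¹ * x⁻¹) * (y * x)) (by group) (hcc x).symm
        (hcc y).symm]
      -- Here oddness enters: for p = 2k + 1 the exponent p(p-1)/2 equals pk and kills the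
      -- commutator, whose p-th power is 1.
      obtain ⟨k, hk⟩ := hodd
      have : p.choose 2 = p * k := by
        rw [Nat.choose_two_right, show p - 1 = 2 * k by omega, mul_left_comm]
        exact Nat.mul_div_cancel_left _ two_pos
      rw [this, pow_mul, hZp _ hc, one_pow, mul_one]
    let F : N →* Z :=
      { toFun := fun x => ⟨x ^ p, hNp x x.2⟩
        map_one' := Subtype.ext (one_pow p)
        map_mul' := fun x y => Subtype.ext (hmul x x.2 y y.2) }
    let K : Subgroup G := F.ker.map N.subtype
    have hKmem : ∀ x, x ∈ K ↔ x ∈ N ∧ x ^ p = 1 := by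
      intro x
      constructor
      · rintro ⟨y, hy, rfl⟩
        exact ⟨y.2, congrArg Subtype.val hy⟩
      · rintro ⟨hx, h⟩
        exact ⟨⟨x, hx⟩, Subtype.ext h, rfl⟩
    have hNn : N.Normal := hN'n.comap π
    have hKn : K.Normal := ⟨fun x hx g => by
      rw [hKmem] at hx ⊢
      exact ⟨hNn.conj_mem x hx.1 g, by rw [conj_pow, hx.2]; simp⟩⟩
    have hZK : Z ≤ K := fun x hx => (hKmem x).2 ⟨by
      change π x ∈ N'
      rw [show π x = 1 from (QuotientGroup.eq_one_iff x).2 hx]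
      exact N'.one_mem, hZp x hx⟩
    -- K = Z is impossible: the kernel of `F` would have order p inside `N` of order p³, forcing an
    -- image of order p² in a group of order p.
    refine hG.exists_normal_card_sq_of_exponent Z K hZ (lt_of_le_of_ne hZK fun h => ?_)
      fun k hk => ((hKmem k).1 hk).2
    have h1 : Nat.card F.ker = p := by
      rw [← hZ, congrArg (fun S : Subgroup G => Nat.card S) h]
      exact (Subgroup.card_map_of_injective N.subtype_injective).symm
    have h2 := F.ker.card_mul_index
    rw [h1, Subgroup.index_ker, hNc] at h2
    have h3 : Nat.card F.range ≤ p := hZ ▸ Subgroup.card_le_card_group F.range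
    have := hp.out.one_lt
    nlinarith [Nat.mul_le_mul_left p h3, mul_pos hp.out.pos hp.out.pos]

/-- For odd `p`, a finite `p`-group that is not cyclic has a normal subgroup isomorphic to
`C_p × C_p`. -/
theorem IsPGroup.exists_normal_card_sq (hodd : Odd p) (hG : IsPGroup p G) (hcyc : ¬ IsCyclic G) :
    ∃ E : Subgroup G, E.Normal ∧ Nat.card E = p ^ 2 ∧ ∀ e ∈ E, e ^ p = 1 :=
  exists_normal_card_sq_aux hodd _ rfl hG hcyc

end PGroups

/-! ### Induced class functions for quotient maps and normal subgroups -/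

section ClassFunctions

theorem sum_ite_map_eq {G Q M : Type*} [Group G] [Group Q] [AddCommMonoid M] [Fintype G]
    [DecidableEq Q] (φ : G →* Q) (N : Subgroup G) [Fintype N] (hN : φ.ker = N) (F : G → M)
    (a : G) : (∑ g : G, if φ g = φ a then F g else 0) = ∑ n : N, F (n * a) := by
  have hN' : ∀ g, φ g = 1 ↔ g ∈ N := fun g => by rw [← hN, MonoidHom.mem_ker]
  rw [← Finset.sum_filter]
  symm
  refine Finset.sum_bij (fun n _ => n * a) ?_ ?_ ?_ ?_
  · intro n _
    simp [(hN' n).2 n.2]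
  · intro n _ m _ h
    exact Subtype.ext (mul_right_cancel h)
  · intro g hg
    refine ⟨⟨g * a⁻¹, (hN' _).1 ?_⟩, Finset.mem_univ _, by simp⟩
    rw [map_mul, map_inv, (Finset.mem_filter.1 hg).2, mul_inv_cancel]
  · intro n _
    rfl

variable {k : Type} [Field k] [CharZero k] {H : Type u} [Group H] [Finite H]

/-- Pushing forward along H → H/N takes N-coinvariants, so the character is averaged over cosets of
N. In the induction formula all |H/N| choices of x contribute the same sum, and |H| = |H/N| |N|
leaves the factor 1/|N|. -/
theorem indChar_mk' (N : Subgroup H) [N.Normal] [Fintype N] (f : H → k)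
    (hf : ∀ g x, f (x * g * x⁻¹) = f g) (h : H) :
    indChar (QuotientGroup.mk' N) f (QuotientGroup.mk' N h) =
      (Nat.card N : k)⁻¹ * ∑ n : N, f (n * h) := by
  classical
  have := Fintype.ofFinite H
  have := Fintype.ofFinite (H ⧸ N)
  have hcQ : (Fintype.card (H ⧸ N) : k) ≠ 0 := by exact_mod_cast Fintype.card_ne_zero
  rw [indChar_apply, Finset.sum_comm]
  have key : ∀ x : H ⧸ N, (∑ g : H, if QuotientGroup.mk' N g * x = x * QuotientGroup.mk' N h
      then f g else 0) = ∑ n : N, f (n * h) := by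
    intro x
    obtain ⟨a, rfl⟩ := QuotientGroup.mk'_surjective N x
    have e : ∀ g : H, QuotientGroup.mk' N g * QuotientGroup.mk' N a =
        QuotientGroup.mk' N a * QuotientGroup.mk' N h ↔
        QuotientGroup.mk' N g = QuotientGroup.mk' N (a * h * a⁻¹) := fun g => by
      rw [map_mul, map_mul, map_inv, eq_mul_inv_iff_mul_eq]
    simp only [e]
    rw [sum_ite_map_eq _ N (QuotientGroup.ker_mk' N)]
    -- For x = aN the relevant g run over the coset of aha⁻¹; conjugation by a⁻¹ carries it to the
    -- coset of h, and `f` is a class function.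
    refine Fintype.sum_equiv (MulAut.conjNormal (H := N) a⁻¹).toEquiv _ _ fun n => ?_
    rw [← hf _ a⁻¹]
    congr 1
    simp only [MulEquiv.toEquiv_eq_coe, EquivLike.coe_coe, MulAut.conjNormal_apply]
    group
  rw [Finset.sum_congr rfl fun x _ => (by convert key x), Finset.sum_const, Finset.card_univ,
    nsmul_eq_mul]
  rw [← Nat.card_eq_fintype_card (α := H), N.card_eq_card_quotient_mul_card_subgroup,
    Nat.card_eq_fintype_card (α := H ⧸ N), Nat.cast_mul, mul_inv, mul_comm (_⁻¹) (_⁻¹), mul_assoc,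
    inv_mul_cancel_left₀ hcQ]

/-- For each t the only g with gt = th is tht⁻¹, which normality puts back into C. -/
theorem indChar_subtype_of_normal [Fintype H] (C : Subgroup H) [hC : C.Normal] (f : C → k) (h : C) :
    indChar C.subtype f h = (Nat.card C : k)⁻¹ * ∑ t : H, f ⟨t * h * t⁻¹, hC.conj_mem h h.2 t⟩ := by
  classical
  have := Fintype.ofFinite C
  rw [indChar_apply, Finset.sum_comm, Nat.card_eq_fintype_card]
  congr 1
  refine Finset.sum_congr rfl fun t _ => ?_
  rw [Finset.sum_eq_single ⟨t * h * t⁻¹, hC.conj_mem h h.2 t⟩]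
  · rw [if_pos (by simp)]
  · intro g _ hne
    refine if_neg fun e => hne (Subtype.ext ?_)
    exact eq_mul_inv_of_mul_eq e
  · simp

theorem indChar_subtype_of_notMem (C : Subgroup H) [hC : C.Normal] (f : C → k) {h : H}
    (hh : h ∉ C) : indChar C.subtype f h = 0 := by
  classical
  have := Fintype.ofFinite C
  have := Fintype.ofFinite H
  rw [indChar_apply]
  refine mul_eq_zero_of_right _ (Finset.sum_eq_zero fun g _ => Finset.sum_eq_zero fun x _ =>
    if_neg fun e => hh ?_)
  have := hC.conj_mem g g.2 x⁻¹
  rwa [inv_inv, mul_assoc, show (g : H) * x = x * h from e, inv_mul_cancel_left] at this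

end ClassFunctions

namespace RepRing

open GrothendieckRing

/-! ### Averaging over a normal subgroup and integral multiplicities -/

section Averaging

variable {k : Type} [Field k] [CharZero k] {H : Type u} [Group H] [Finite H]

/-- The class of the `N`-coinvariants of a representation, for a normal subgroup `N`. -/
noncomputable def avg (N : Subgroup H) [N.Normal] (x : RepRing k H) : RepRing k H :=
  pull (QuotientGroup.mk' N) (ind (QuotientGroup.mk' N) x)

theorem char_avg (N : Subgroup H) [N.Normal] [Fintype N] (x : RepRing k H) (h : H) :
    char (avg N x) h = (Nat.card N : k)⁻¹ * ∑ n : N, char x (n * h) := by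
  rw [avg, char_pull, char_ind, indChar_mk' N _ fun g h => char_conj x g h]

/-- Serves to recognise a class inflated from H/N, where induction on the order applies, from the
N-invariance of its character alone. -/
theorem avg_eq_self (N : Subgroup H) [N.Normal] (x : RepRing k H)
    (hx : ∀ n ∈ N, ∀ h, char x (n * h) = char x h) : avg N x = x := by
  have := Fintype.ofFinite N
  refine char_injective (funext fun h => ?_)
  have hc : (Nat.card N : k) ≠ 0 := by exact_mod_cast Nat.card_pos.ne'
  rw [char_avg, Finset.sum_congr rfl fun (n : N) _ => hx n n.2 h]
  simp [← Nat.card_eq_fintype_card, hc]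

/-- The value at 1 is a virtual dimension. This is the source of integrality: applied to
coinvariants, it makes multiplicities integers. -/
theorem exists_int_char_one (x : RepRing k H) : ∃ n : ℤ, char x 1 = n := by
  obtain ⟨a, b, rfl⟩ := exists_sub x
  obtain ⟨V, rfl⟩ := RepSemiring.exists_mk a
  obtain ⟨W, rfl⟩ := RepSemiring.exists_mk b
  refine ⟨finrank k V.V - finrank k W.V, ?_⟩
  simp only [map_sub, char_of, Pi.sub_apply, RepSemiring.char_mk, Representation.char_one]
  simp

/-- The regular representation, as an element of the Burnside ring. -/
noncomputable def _root_.BurnsideRing.regular (H : Type u) [Group H] [Finite H] : BurnsideRing H :=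
  of (BurnsideSemiring.mk ⟨H⟩)

open Classical in
theorem char_lin_regular (h : H) :
    char (lin k H (BurnsideRing.regular H)) h = if h = 1 then (Nat.card H : k) else 0 := by
  rw [lin, BurnsideRing.regular, mapRing_of, char_of, RepSemiring.char_lin]
  split_ifs with h1
  · subst h1
    refine congrArg _ (Nat.card_congr (Equiv.subtypeUnivEquiv fun x => one_smul _ _))
  · have : IsEmpty {x : H // h • x = x} := ⟨fun x => h1 (mul_eq_right.1 x.2)⟩
    exact (congrArg _ Nat.card_of_isEmpty).trans Nat.cast_zero

/-- The one-dimensional representation given by a linear character. -/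
noncomputable def linearChar (χ : H →* k) : RepRing k H :=
  of (RepSemiring.mk
    { V := ULift.{u} k
      ρ :=
        { toFun := fun h => χ h • LinearMap.id
          map_one' := by rw [map_one, one_smul]; rfl
          map_mul' := fun g h => by
            ext
            simp [map_mul, mul_assoc, mul_left_comm] } })

theorem char_linearChar (χ : H →* k) (h : H) : char (linearChar χ) h = χ h := by
  rw [linearChar, char_of, RepSemiring.char_mk]
  change LinearMap.trace k (ULift.{u} k) (χ h • LinearMap.id) = χ h
  rw [map_smul, LinearMap.trace_id]
  simp

/-- The multiplicity of a linear character in a virtual representation is an integer. -/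
theorem exists_int_pairing [Fintype H] (x : RepRing k H) (χ : H →* k) :
    ∃ n : ℤ, (Nat.card H : k)⁻¹ * ∑ h : H, char x h * χ h = n := by
  -- The average over the whole group takes coinvariants of x ⊗ χ, so its value at 1 is a virtual
  -- dimension. No complex conjugate appears: the integer is the multiplicity of χ⁻¹.
  obtain ⟨n, hn⟩ := exists_int_char_one (avg ⊤ (x * linearChar χ))
  refine ⟨n, hn ▸ ?_⟩
  have := Fintype.ofFinite (⊤ : Subgroup H)
  rw [char_avg, Subgroup.card_top]
  congr 1
  refine Fintype.sum_equiv Subgroup.topEquiv.symm.toEquiv _ _ fun h => ?_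
  rw [map_mul, Pi.mul_apply, char_linearChar, mul_one]
  rfl

end Averaging

/-! ### Stability of virtual permutation classes and of power invariance -/

section LinRange

variable {k : Type} [Field k] [CharZero k] {H K : Type u} [Group H] [Finite H] [Group K] [Finite K]

theorem pull_mem_range_lin (φ : K →* H) {x : RepRing k H} (hx : x ∈ (lin k H).range) :
    pull φ x ∈ (lin k K).range := by
  obtain ⟨a, rfl⟩ := hx
  exact ⟨_, lin_pull φ a⟩

theorem ind_mem_range_lin (φ : K →* H) (hφ : Function.Injective φ) {x : RepRing k K}
    (hx : x ∈ (lin k K).range) : ind φ x ∈ (lin k H).range := by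
  obtain ⟨a, rfl⟩ := hx
  exact ⟨_, lin_push φ hφ a⟩

end LinRange

/-- The character is invariant under all powers prime to `q`. -/
def PowInvariant {k : Type} [Field k] [CharZero k] {H : Type u} [Group H] [Finite H] (q : ℕ)
    (x : RepRing k H) : Prop :=
  ∀ n, q.Coprime n → ∀ h, char x (h ^ n) = char x h

namespace PowInvariant

variable {k : Type} [Field k] [CharZero k] {H K : Type u} [Group H] [Finite H] [Group K] [Finite K]
  {q : ℕ}

theorem sub {x y : RepRing k H} (hx : PowInvariant q x) (hy : PowInvariant q y) :
    PowInvariant q (x - y) := fun n hn h => by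
  rw [map_sub, Pi.sub_apply, Pi.sub_apply, hx n hn, hy n hn]

theorem pull (φ : K →* H) {x : RepRing k H} (hx : PowInvariant q x) :
    PowInvariant q (pull φ x) := fun n hn h => by
  rw [char_pull, char_pull, map_pow, hx n hn]

/-- For n prime to q, the n-th power map permutes both q-groups, so the substitution h ↦ h^n passes
through the induction formula. The homomorphism need not be injective, so this covers pushing
forward to a quotient as well. -/
theorem ind [Fact q.Prime] (hH : IsPGroup q H) (hK : IsPGroup q K) (φ : K →* H) {x : RepRing k K}
    (hx : PowInvariant q x) : PowInvariant q (ind φ x) := fun n hn h => by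
  obtain ⟨a, ha⟩ := IsPGroup.iff_card.1 hH
  obtain ⟨b, hb⟩ := IsPGroup.iff_card.1 hK
  rw [char_ind, ← indChar_pow φ _ n (hb ▸ hn.pow_left b) (ha ▸ hn.pow_left a)]
  exact congrArg (fun f => indChar φ f h) (funext (hx n hn))

theorem avg [Fact q.Prime] (hH : IsPGroup q H) (N : Subgroup H) [N.Normal] {x : RepRing k H}
    (hx : PowInvariant q x) : PowInvariant q (avg N x) :=
  (hx.ind (hH.to_quotient N) hH _).pull _

end PowInvariant

end RepRing

namespace RepRing

open GrothendieckRing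

variable {q : ℕ} [hq : Fact q.Prime] {H : Type u} [Group H] [Finite H]

/-! ### The cyclic case -/

section Cyclic

/-- In a cyclic q-group, N consists of all solutions of g^q = 1, so for h outside N some power of
h^q generates N. Thus n = h^(qi) for some i, and nh = h^(qi+1) has an exponent prime to q.
Consequently, a power-invariant character is constant on each coset of N other than N. -/
theorem exists_coprime_pow_eq_mul [IsCyclic H] (hH : IsPGroup q H) (N : Subgroup H)
    (hN : Nat.card N = q) {n h : H} (hn : n ∈ N) (hh : h ∉ N) :
    ∃ k, q.Coprime k ∧ n * h = h ^ k := by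
  classical
  have := Fintype.ofFinite H
  have hNmem : ∀ g : H, g ^ q = 1 → g ∈ N := by
    have hsub : (Finset.univ.filter (· ∈ N)) ⊆ Finset.univ.filter fun g : H => g ^ q = 1 := by
      intro g hg
      rw [Finset.mem_filter] at hg ⊢
      refine ⟨hg.1, ?_⟩
      have := pow_card_eq_one' (x := (⟨g, hg.2⟩ : N))
      rw [hN] at this
      exact congrArg Subtype.val this
    -- A cyclic group has at most q solutions of g^q = 1, and `N` already supplies q of them.
    have heq := Finset.eq_of_subset_of_card_le hsub (by
      refine (IsCyclic.card_pow_eq_one_le hq.out.pos).trans ?_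
      rw [← Fintype.card_subtype, ← Nat.card_eq_fintype_card]
      exact hN.ge)
    intro g hg
    have : g ∈ Finset.univ.filter (· ∈ N) := by
      rw [heq, Finset.mem_filter]
      exact ⟨Finset.mem_univ _, hg⟩
    exact (Finset.mem_filter.1 this).2
  have h1 : h ^ q ≠ 1 := fun e => hh (hNmem h e)
  have h2 := hH.dvd_orderOf h1
  obtain ⟨c, hc⟩ := h2
  have hcpos : 0 < c := Nat.pos_of_ne_zero fun e => by
    rw [e, mul_zero] at hc
    exact (orderOf_pos (h ^ q)).ne' hc
  have hyq : ((h ^ q) ^ c) ^ q = 1 := by rw [← pow_mul, mul_comm c, ← hc, pow_orderOf_eq_one]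
  have hy1 : (h ^ q) ^ c ≠ 1 := fun e => by
    have h3 := Nat.le_of_dvd hcpos (orderOf_dvd_of_pow_eq_one e)
    have := hq.out.one_lt
    nlinarith
  have hne : (⟨_, hNmem _ hyq⟩ : N) ≠ 1 := fun e => hy1 (congrArg Subtype.val e)
  have hmem : (⟨n, hn⟩ : N) ∈ Submonoid.powers (⟨_, hNmem _ hyq⟩ : N) :=
    mem_powers_of_prime_card hN hne
  obtain ⟨j, hj⟩ := (Submonoid.mem_powers_iff _ _).1 hmem
  have hj' : ((h ^ q) ^ c) ^ j = n := congrArg Subtype.val hj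
  refine ⟨q * (c * j) + 1, ?_, ?_⟩
  · exact (Nat.coprime_mul_left_add_right _ _ _).2 (Nat.coprime_one_right q)
  · rw [← hj', pow_succ, ← pow_mul, ← pow_mul]

theorem avg_sub {k : Type} [Field k] [CharZero k] (N : Subgroup H) [N.Normal] (x y : RepRing k H) :
    avg N (x - y) = avg N x - avg N y := by
  simp only [avg, map_sub]

theorem avg_avg {k : Type} [Field k] [CharZero k] (N : Subgroup H) [N.Normal] (x : RepRing k H) :
    avg N (avg N x) = avg N x := by
  refine avg_eq_self N _ fun n hn h => ?_
  rw [avg, char_pull, char_pull, map_mul]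
  rw [show QuotientGroup.mk' N n = 1 from (QuotientGroup.eq_one_iff n).2 hn, one_mul]

/-- The character of z sums to zero on every coset of N. It is constant on each coset other than N,
hence zero there; on N it takes one value b at all nontrivial elements and -(q-1)b at 1. This is the
shape of the difference of the regular representations of H and of H/N, and only the integrality of
the factor c = -b/|H/N| needs an argument. -/
theorem mem_range_lin_of_isCyclic [IsCyclic H] (hH : IsPGroup q H) (N : Subgroup H) [N.Normal]
    (hN : Nat.card N = q) {z : RepRing ℂ H} (hz : PowInvariant q z) (hzN : avg N z = 0) :
    z ∈ (lin ℂ H).range := by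
  classical
  have := Fintype.ofFinite H
  have := Fintype.ofFinite N
  have hq0 : (q : ℂ) ≠ 0 := by exact_mod_cast hq.out.ne_zero
  have hsum : ∀ h, ∑ n : N, char z (n * h) = 0 := fun h => by
    have h1 := char_avg N z h
    rw [hzN, hN, map_zero, Pi.zero_apply] at h1
    exact (mul_eq_zero.1 h1.symm).resolve_left (inv_ne_zero hq0)
  have hout : ∀ h ∉ N, char z h = 0 := by
    intro h hh
    have h1 := hsum h
    have h2 : ∀ n : N, char z (n * h) = char z h := fun n => by
      obtain ⟨k, hk, e⟩ := exists_coprime_pow_eq_mul hH N hN n.2 hh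
      rw [e, hz k hk]
    simp only [h2, Finset.sum_const, Finset.card_univ, nsmul_eq_mul, ← Nat.card_eq_fintype_card,
      hN] at h1
    exact (mul_eq_zero.1 h1).resolve_left hq0
  have hNnt : Nontrivial N := Finite.one_lt_card_iff_nontrivial.1 (hN ▸ hq.out.one_lt)
  obtain ⟨g, hg⟩ := exists_ne (1 : N)
  set b := char z g with hb
  -- Nontrivial elements of `N` are powers of g with exponent prime to q; the value at 1 is then
  -- forced by the vanishing of the sum over `N`.
  have hin : ∀ n : N, char z n = b - if n = 1 then (q : ℂ) * b else 0 := by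
    have hne : ∀ n : N, n ≠ 1 → char z n = b := by
      intro n hn
      obtain ⟨k, rfl⟩ := (Submonoid.mem_powers_iff _ _).1
        (mem_powers_of_prime_card hN hg : n ∈ Submonoid.powers g)
      refine hz k ((Nat.Prime.coprime_iff_not_dvd hq.out).2 fun hd => hn ?_) g
      obtain ⟨c, rfl⟩ := hd
      rw [← hN, pow_mul, pow_card_eq_one', one_pow]
    intro n
    by_cases hn : n = 1
    · subst hn
      have h1 := hsum 1
      rw [← Finset.add_sum_erase _ _ (Finset.mem_univ 1)] at h1
      have h2 : ∑ n ∈ Finset.univ.erase (1 : N), char z (n * 1) = ((q : ℂ) - 1) * b := by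
        rw [Finset.sum_congr rfl fun n hn => by rw [mul_one, hne n (Finset.ne_of_mem_erase hn)],
          Finset.sum_const, Finset.card_erase_of_mem (Finset.mem_univ _), Finset.card_univ,
          ← Nat.card_eq_fintype_card, hN, nsmul_eq_mul, Nat.cast_sub hq.out.one_le, Nat.cast_one]
      rw [h2, mul_one] at h1
      rw [if_pos rfl]
      linear_combination h1
    · rw [if_neg hn, hne n hn, sub_zero]
  have hcard : (Nat.card H : ℂ) = Nat.card (H ⧸ N) * q := by
    rw [N.card_eq_card_quotient_mul_card_subgroup, hN, Nat.cast_mul]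
  have hc0 : (Nat.card (H ⧸ N) : ℂ) ≠ 0 := by exact_mod_cast Nat.card_pos.ne'
  -- Pair z with a linear character χ that is nontrivial on `N`: since ∑ χ = 0 over `N`, only the
  -- correction at 1 survives, and the multiplicity is -qb/|H| = -b/|H/N|.
  obtain ⟨c, hc⟩ : ∃ c : ℤ, -b = c * Nat.card (H ⧸ N) := by
    let _ : CommGroup H := IsCyclic.commGroup
    obtain ⟨φ, hφ⟩ := CommGroup.exists_apply_ne_one_of_hasEnoughRootsOfUnity H ℂ
      (a := (g : H)) fun e => hg (Subtype.ext e)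
    let χ : H →* ℂ := (Units.coeHom ℂ).comp φ
    obtain ⟨c, hc⟩ := exists_int_pairing z χ
    refine ⟨c, ?_⟩
    have h1 : ∑ h : H, char z h * χ h = ∑ n : N, char z n * χ n := by
      symm
      refine (Finset.sum_subtype (Finset.univ.filter (· ∈ N)) (by simp)
        fun h => char z h * χ h).symm.trans ?_
      refine Finset.sum_subset (Finset.subset_univ _) fun h _ hh => ?_
      rw [hout h (by simpa using hh), zero_mul]
    have h2 : ∑ n : N, χ n = 0 := sum_hom_units_eq_zero (χ.comp N.subtype) fun e =>
      hφ (Units.ext (DFunLike.congr_fun e g))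
    have h3 : ∑ n : N, char z n * χ n = -(q * b) := by
      simp only [hin, sub_mul, ite_mul, zero_mul, Finset.sum_sub_distrib, ← Finset.mul_sum, h2,
        Finset.sum_ite_eq', Finset.mem_univ, if_true]
      simp
    rw [h1, h3, hcard] at hc
    rw [← hc]
    field_simp
  have hmem : lin ℂ H (BurnsideRing.regular H) -
      pull (QuotientGroup.mk' N) (lin ℂ (H ⧸ N) (BurnsideRing.regular (H ⧸ N))) ∈
      (lin ℂ H).range :=
    sub_mem ⟨_, rfl⟩ (pull_mem_range_lin _ ⟨_, rfl⟩)
  have hzc : z = c • (lin ℂ H (BurnsideRing.regular H) -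
      pull (QuotientGroup.mk' N) (lin ℂ (H ⧸ N) (BurnsideRing.regular (H ⧸ N)))) := by
    refine char_injective (funext fun h => ?_)
    rw [map_zsmul, Pi.smul_apply, map_sub, Pi.sub_apply, char_pull, char_lin_regular,
      char_lin_regular, zsmul_eq_mul]
    have hiff : QuotientGroup.mk' N h = 1 ↔ h ∈ N := QuotientGroup.eq_one_iff h
    by_cases hh : h ∈ N
    · have h1 := hin ⟨h, hh⟩
      have h2 : ((⟨h, hh⟩ : N) = 1) ↔ h = 1 := Subtype.ext_iff
      rw [if_pos (hiff.2 hh)]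
      simp only [h2] at h1
      rw [h1]
      split_ifs
      · rw [hcard]
        linear_combination ((q : ℂ) - 1) * hc
      · linear_combination -hc
    · rw [if_neg (mt hiff.1 hh), hout h hh, if_neg fun e : h = 1 => hh (e ▸ N.one_mem)]
      simp
  rw [hzc]
  exact zsmul_mem hmem c

end Cyclic

/-! ### A central subgroup of type C_q × C_q -/

section CentralElementary

/-- The nontrivial elements of a group of exponent `q` are partitioned by its subgroups of
order `q`. -/
theorem sum_lines {M : Type*} [AddCommMonoid M] (E : Subgroup H) (hE : ∀ e ∈ E, e ^ q = 1)
    [Fintype E] [Fintype {L : Subgroup H // L ≤ E ∧ Nat.card L = q}]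
    [∀ L : {L : Subgroup H // L ≤ E ∧ Nat.card L = q}, Fintype L.1] (F : H → M) (hF : F 1 = 0) :
    ∑ L : {L : Subgroup H // L ≤ E ∧ Nat.card L = q}, ∑ f : L.1, F f = ∑ f : E, F f := by
  classical
  have := Fintype.ofFinite H
  have e1 : ∀ (S : Subgroup H) [Fintype S], ∑ f : S, F f = ∑ f : H, if f ∈ S then F f else 0 := by
    intro S _
    rw [← Finset.sum_filter]
    exact (Finset.sum_subtype (Finset.univ.filter (· ∈ S)) (by simp) F).symm
  simp only [e1]
  rw [Finset.sum_comm]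
  refine Finset.sum_congr rfl fun f _ => ?_
  by_cases hf1 : f = 1
  · subst hf1
    simp [hF]
  by_cases hf : f ∈ E
  · rw [if_pos hf]
    have hord : orderOf f = q := orderOf_eq_prime (hE f hf) hf1
    -- The only subgroup of order q containing f ≠ 1 is the one that f generates; f = 1 lies in all
    -- of them, whence the requirement F 1 = 0.
    rw [Finset.sum_eq_single ⟨Subgroup.zpowers f, Subgroup.zpowers_le.2 hf, by
      rw [Nat.card_zpowers, hord]⟩]
    · rw [if_pos (Subgroup.mem_zpowers f)]
    · rintro ⟨L, hLE, hL⟩ _ hne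
      refine if_neg fun hfL => hne (Subtype.ext ?_)
      have hle : Subgroup.zpowers f ≤ L := Subgroup.zpowers_le.2 hfL
      exact (Subgroup.eq_of_le_of_card_ge hle (by rw [hL, Nat.card_zpowers, hord])).symm
    · simp
  · rw [if_neg hf]
    exact Finset.sum_eq_zero fun L _ => if_neg fun h => hf (L.2.1 h)

/-- On an irreducible representation E acts through one linear character, whose kernel is either a
single line L or all of E. In the first case exactly one of the averages over lines keeps the
representation and `avg E` kills it; in the second all q + 1 lines keep it, and (q + 1) - q = 1.
Hence x = ∑ `avg L x` - q `avg E x`. The verification on characters counts with the partition of E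
minus 1 into lines; centrality makes every line normal. -/
theorem mem_range_lin_of_central {k : Type} [Field k] [CharZero k] (E : Subgroup H)
    (hE : E ≤ Subgroup.center H) (hcard : Nat.card E = q ^ 2) (hexp : ∀ e ∈ E, e ^ q = 1)
    (x : RepRing k H)
    (hx : ∀ (N : Subgroup H) [N.Normal], N ≠ ⊥ → avg N x ∈ (lin k H).range) :
    x ∈ (lin k H).range := by
  classical
  have := Fintype.ofFinite H
  have := Fintype.ofFinite {L : Subgroup H // L ≤ E ∧ Nat.card L = q}
  have hn : ∀ L : {L : Subgroup H // L ≤ E ∧ Nat.card L = q}, L.1.Normal := fun L =>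
    Subgroup.normal_of_le_center (L.2.1.trans hE)
  have hEn : E.Normal := Subgroup.normal_of_le_center hE
  have hq0 : (q : k) ≠ 0 := by exact_mod_cast hq.out.ne_zero
  have hq1 : (q : k) - 1 ≠ 0 := by
    rw [sub_ne_zero]
    exact_mod_cast hq.out.one_lt.ne'
  have hcE : Finset.card (Finset.univ : Finset E) = q ^ 2 := by
    rw [Finset.card_univ, ← Nat.card_eq_fintype_card, hcard]
  have hcL : ∀ L : {L : Subgroup H // L ≤ E ∧ Nat.card L = q},
      Finset.card (Finset.univ : Finset L.1) = q := fun L => by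
    rw [Finset.card_univ, ← Nat.card_eq_fintype_card, L.2.2]
  set m := Fintype.card {L : Subgroup H // L ≤ E ∧ Nat.card L = q}
  -- Counting nontrivial elements gives m(q - 1) = q² - 1.
  have hm : (m : k) = q + 1 := by
    have h1 := sum_lines (q := q) (M := k) E hexp (fun f => 1 - if f = 1 then 1 else 0) (by simp)
    simp only [Finset.sum_sub_distrib, Finset.sum_const, hcE, hcL, OneMemClass.coe_eq_one,
      Finset.sum_ite_eq', Finset.mem_univ, if_true, nsmul_eq_mul, mul_one, Finset.card_univ] at h1
    apply mul_right_cancel₀ hq1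
    push_cast at h1
    linear_combination h1
  have key : x = ∑ L : {L : Subgroup H // L ≤ E ∧ Nat.card L = q}, avg L.1 x - q • avg E x := by
    refine char_injective (funext fun h => ?_)
    rw [map_sub, map_sum, Pi.sub_apply, Finset.sum_apply, map_nsmul, Pi.smul_apply, char_avg]
    -- Subtracting `char x h` makes the summand vanish at f = 1, as `sum_lines` requires.
    have h1 := sum_lines (q := q) (M := k) E hexp (fun f => char x (f * h) - char x h) (by simp)
    have h2 : ∑ L : {L : Subgroup H // L ≤ E ∧ Nat.card L = q}, char (avg L.1 x) h =
        (q : k)⁻¹ * ∑ L : {L : Subgroup H // L ≤ E ∧ Nat.card L = q},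
          ∑ f : L.1, char x (f * h) := by
      rw [Finset.mul_sum]
      refine Finset.sum_congr rfl fun L _ => ?_
      rw [char_avg, L.2.2]
    rw [h2]
    simp only [Finset.sum_sub_distrib, Finset.sum_const, hcE, hcL, nsmul_eq_mul,
      Finset.card_univ] at h1
    change _ - (m : k) * _ = _ at h1
    rw [hm] at h1
    push_cast at h1
    rw [hcard, nsmul_eq_mul]
    push_cast
    field_simp
    linear_combination -h1
  have hne : ∀ L : Subgroup H, 1 < Nat.card L → L ≠ ⊥ := fun L hL =>
    L.one_lt_card_iff_ne_bot.1 hL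
  rw [key]
  refine sub_mem (sum_mem fun L _ => hx L.1 (hne _ ?_)) (nsmul_mem (hx E (hne _ ?_)) q)
  · rw [L.2.2]
    exact hq.out.one_lt
  · rw [hcard]
    exact Nat.one_lt_pow two_ne_zero hq.out.one_lt

end CentralElementary

end RepRing

namespace RepRing

open GrothendieckRing

/-! ### A noncentral subgroup of type C_q × C_q, and the induction -/

section Commutators

variable {H : Type u} [Group H]

/-- The homomorphism `y ↦ [y⁻¹, e]`, for an element `e` that is central modulo a central
subgroup. -/
def commHom (Z : Subgroup H) (hZ : Z ≤ Subgroup.center H) (e : H)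
    (he : ∀ y, y⁻¹ * e * y * e⁻¹ ∈ Z) : H →* Z where
  toFun y := ⟨y⁻¹ * e * y * e⁻¹, he y⟩
  map_one' := Subtype.ext (by simp)
  map_mul' y₁ y₂ := Subtype.ext (by
    have h := Subgroup.mem_center_iff.1 (hZ (he y₁)) y₂⁻¹
    calc (y₁ * y₂)⁻¹ * e * (y₁ * y₂) * e⁻¹
        = y₂⁻¹ * (y₁⁻¹ * e * y₁ * e⁻¹) * (e * y₂ * e⁻¹) := by group
      _ = y₁⁻¹ * e * y₁ * e⁻¹ * (y₂⁻¹ * e * y₂ * e⁻¹) := by rw [h]; group)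

/-- Conjugation by y multiplies e by a central element, so it multiplies e^i by the i-th power of
that element. This decides which central translates of e^i are conjugate to it. -/
theorem conj_pow_eq_commHom_mul (Z : Subgroup H) (hZ : Z ≤ Subgroup.center H) (e : H)
    (he : ∀ y, y⁻¹ * e * y * e⁻¹ ∈ Z) (y : H) (i : ℕ) :
    y⁻¹ * e ^ i * y = (commHom Z hZ e he y : H) ^ i * e ^ i := by
  have h : Commute (y⁻¹ * e * y * e⁻¹) e :=
    (Subgroup.mem_center_iff.1 (hZ (he y)) e).symm
  have h2 := conj_pow (i := i) (a := y⁻¹) (b := e)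
  rw [inv_inv] at h2
  rw [← h2, commHom]
  change _ = (y⁻¹ * e * y * e⁻¹) ^ i * e ^ i
  rw [← h.mul_pow, inv_mul_cancel_right]

end Commutators

variable {q : ℕ} [hq : Fact q.Prime] {H : Type u} [Group H] [Finite H]

/-- C is the centralizer of e and D = ⟨e⟩. Let V be an irreducible complex representation on which Z
acts nontrivially, hence by a nontrivial scalar character. The extensions of this character to Z ×
⟨e⟩ are permuted transitively by H with stabilizer C, and exactly one of them is trivial on e; so V
is induced from its D-invariants, a representation of C. Thus x and u = Ind(`avg D`(Res x)) agree on
the part where Z acts nontrivially, and x - u is inflated from H/Z. The proof checks on characters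
that x - u is invariant under translation by Z. -/
theorem exists_eq_ind_add_avg {k : Type} [Field k] [CharZero k] (Z : Subgroup H)
    (hZ : Z ≤ Subgroup.center H) [Z.Normal] (hcard : Nat.card Z = q) (e : H) (heq : e ^ q = 1)
    (hec : e ∉ Subgroup.center H) (he : ∀ y, y⁻¹ * e * y * e⁻¹ ∈ Z) (x : RepRing k H) :
    ∃ (C : Subgroup H) (D : Subgroup C) (_ : D.Normal), Nat.card C < Nat.card H ∧
      x = ind C.subtype (avg D (pull C.subtype x)) +
        avg Z (x - ind C.subtype (avg D (pull C.subtype x))) := by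
  classical
  have := Fintype.ofFinite H
  let φ := commHom Z hZ e he
  have hmemC : ∀ y, y ∈ φ.ker ↔ e * y = y * e := fun y => by
    rw [MonoidHom.mem_ker, Subtype.ext_iff]
    change y⁻¹ * e * y * e⁻¹ = 1 ↔ _
    rw [mul_inv_eq_one, mul_assoc, inv_mul_eq_iff_eq_mul]
  -- The image is trivial or all of `Z`, which has prime order; a trivial image would make `e`
  -- central. So the centralizer of `e` has index q.
  have hφ : Function.Surjective φ := by
    rw [← MonoidHom.range_eq_top]
    have hp : (Nat.card Z).Prime := hcard ▸ hq.out
    have := Fact.mk hp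
    refine φ.range.eq_bot_or_eq_top_of_prime_card.resolve_left fun h => hec ?_
    rw [MonoidHom.range_eq_bot_iff] at h
    exact Subgroup.mem_center_iff.2 fun y => ((hmemC y).1 (by rw [h]; rfl)).symm
  have hHC : Nat.card H = Nat.card φ.ker * q := by
    rw [← φ.ker.card_mul_index, Subgroup.index_ker, MonoidHom.range_eq_top.2 hφ,
      Subgroup.card_top, hcard]
  have heC : e ∈ φ.ker := (hmemC e).2 rfl
  let e' : φ.ker := ⟨e, heC⟩
  let D : Subgroup φ.ker := Subgroup.zpowers e'
  have he'c : e' ∈ Subgroup.center φ.ker := Subgroup.mem_center_iff.2 fun y =>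
    Subtype.ext ((hmemC y).1 y.2).symm
  have hD : D.Normal := Subgroup.normal_of_le_center (Subgroup.zpowers_le.2 he'c)
  have he1 : e ≠ 1 := fun h => hec (h ▸ Subgroup.one_mem _)
  have hDc : Nat.card D = q := by
    rw [Nat.card_zpowers, ← Subgroup.orderOf_coe]
    exact orderOf_eq_prime heq he1
  have hZC : ∀ z ∈ Z, z ∈ φ.ker := fun z hz =>
    (hmemC z).2 (Subgroup.mem_center_iff.1 (hZ hz) e)
  refine ⟨φ.ker, D, hD, ?_, ?_⟩
  · rw [hHC]
    exact lt_mul_of_one_lt_right Nat.card_pos hq.out.one_lt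
  set u := ind φ.ker.subtype (avg D (pull φ.ker.subtype x)) with hu
  have hfixed : ∀ z ∈ Z, ∀ h, char (x - u) (z * h) = char (x - u) h := by
    intro z hz h
    have hzc := Subgroup.mem_center_iff.1 (hZ hz)
    rw [map_sub, Pi.sub_apply, Pi.sub_apply]
    by_cases hh : h ∈ φ.ker
    · have hformula : ∀ h ∈ φ.ker, char u h = (Nat.card φ.ker : k)⁻¹ * (q : k)⁻¹ *
          ∑ d : D, ∑ t : H, char x (t⁻¹ * (d : φ.ker) * t * h) := by
        intro h hh
        rw [hu, char_ind]
        refine (indChar_subtype_of_normal φ.ker _ ⟨h, hh⟩).trans ?_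
        rw [mul_assoc, Finset.sum_comm, Finset.mul_sum (a := (q : k)⁻¹)]
        congr 1
        refine Finset.sum_congr rfl fun t _ => ?_
        rw [char_avg, hDc]
        congr 1
        refine Finset.sum_congr rfl fun d _ => ?_
        rw [char_pull, ← char_conj x _ t⁻¹]
        simp only [Subgroup.coe_subtype, Subgroup.coe_mul]
        group
      -- For d = e^i ≠ 1, i is prime to q, so z has an i-th root w in `Z`; an element y with φ(y) =
      -- w satisfies y⁻¹dy = zd. Replacing t by yt absorbs z.
      have hS : ∀ d : D, d ≠ 1 → ∑ t : H, char x (t⁻¹ * (d : φ.ker) * t * (z * h)) =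
          ∑ t : H, char x (t⁻¹ * (d : φ.ker) * t * h) := by
        intro d hd
        obtain ⟨i, hi⟩ : ∃ i : ℕ, e ^ i = (d : φ.ker) := by
          obtain ⟨i, hi⟩ := (Submonoid.mem_powers_iff _ _).1
            (mem_powers_iff_mem_zpowers.2 d.2)
          exact ⟨i, congrArg Subtype.val hi⟩
        have hcop : (Nat.card Z).Coprime i := by
          rw [hcard, Nat.Prime.coprime_iff_not_dvd hq.out]
          rintro ⟨c, rfl⟩
          rw [pow_mul, heq, one_pow] at hi
          exact hd (Subtype.ext (Subtype.ext hi.symm))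
        obtain ⟨w, hw⟩ := (powCoprime hcop).surjective ⟨z, hz⟩
        obtain ⟨y, hy⟩ := hφ w
        have hyz : y⁻¹ * (d : φ.ker) * y = z * (d : φ.ker) := by
          rw [← hi, conj_pow_eq_commHom_mul Z hZ e he y i]
          congr 1
          change ((φ y : Z) : H) ^ i = z
          rw [hy]
          exact congrArg Subtype.val hw
        symm
        refine (Fintype.sum_equiv (Equiv.mulLeft y) _ _ fun t => ?_).symm
        refine congrArg (char x) ?_
        have : (y * t)⁻¹ * (d : φ.ker) * (y * t) * h = t⁻¹ * (y⁻¹ * (d : φ.ker) * y) * t * h := by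
          group
        rw [Equiv.coe_mulLeft, this, hyz, ← hzc (d : φ.ker)]
        have h2 := hzc t
        calc t⁻¹ * (d : φ.ker) * t * (z * h) = t⁻¹ * (d : φ.ker) * (t * z) * h := by group
          _ = _ := by rw [h2]; group
      -- Only d = 1 fails to be invariant; it contributes |H| times the value of x, which the factor
      -- 1/(|C| q) = 1/|H| in u normalizes to that value. Hence the defects of x and u cancel.
      have hdiff : (∑ d : D, ∑ t : H, char x (t⁻¹ * (d : φ.ker) * t * (z * h))) -
          ∑ d : D, ∑ t : H, char x (t⁻¹ * (d : φ.ker) * t * h) =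
          Nat.card H * (char x (z * h) - char x h) := by
        rw [← Finset.sum_sub_distrib, Finset.sum_eq_single 1]
        · simp [Nat.card_eq_fintype_card, mul_sub]
        · intro d _ hd
          rw [hS d hd, sub_self]
        · simp
      rw [hformula _ hh, hformula _ (mul_mem (hZC z hz) hh)]
      have hc0 : (Nat.card φ.ker : k) ≠ 0 := by exact_mod_cast Nat.card_pos.ne'
      have hq0 : (q : k) ≠ 0 := by exact_mod_cast hq.out.ne_zero
      rw [hHC] at hdiff
      push_cast at hdiff
      field_simp
      linear_combination -hdiff
    · have hzh : z * h ∉ φ.ker := fun h' => hh ((Subgroup.mul_mem_cancel_left _ (hZC z hz)).1 h')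
      -- Off C the induced character vanishes, and h is conjugate to zh by e^j, where φ(h)^j = z;
      -- such j exists because φ(h) ≠ 1 generates `Z`.
      rw [hu, char_ind, indChar_subtype_of_notMem _ _ hh, indChar_subtype_of_notMem _ _ hzh,
        sub_zero, sub_zero]
      have hne : φ h ≠ 1 := hh
      obtain ⟨j, hj⟩ := (Submonoid.mem_powers_iff _ _).1
        (mem_powers_of_prime_card hcard hne : (⟨z, hz⟩ : Z) ∈ Submonoid.powers (φ h))
      have hj' : (φ h : H) ^ j = z := congrArg Subtype.val hj
      have h1 := conj_pow_eq_commHom_mul Z hZ e he h j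
      change _ = (φ h : H) ^ j * _ at h1
      rw [hj'] at h1
      have h2 : e ^ j * h * (e ^ j)⁻¹ = z * h := by
        rw [← hzc h, mul_inv_eq_iff_eq_mul, mul_assoc h, ← h1]
        group
      rw [← h2, char_conj]
  rw [avg_eq_self Z _ hfixed, add_sub_cancel]

/-- The induction on the order: averages over nontrivial normal subgroups come from proper
quotients, and in the noncentral case the remaining piece is induced from a proper subgroup. The
quantification over all power-invariant y in `havg` is needed because that case averages x - u
rather than x. -/
theorem mem_range_lin_aux (hodd : Odd q) (n : ℕ) :
    ∀ {H : Type u} [Group H] [Finite H], Nat.card H = n → IsPGroup q H →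
      ∀ x : RepRing ℂ H, PowInvariant q x → x ∈ (lin ℂ H).range := by
  induction n using Nat.strong_induction_on with
  | _ n ih =>
  intro H _ _ hn hH x hx
  have havg : ∀ (y : RepRing ℂ H), PowInvariant q y → ∀ (N : Subgroup H) [N.Normal], N ≠ ⊥ →
      avg N y ∈ (lin ℂ H).range := by
    intro y hy N _ hN
    refine pull_mem_range_lin _ (ih _ ?_ rfl (hH.to_quotient N) _
      (hy.ind (hH.to_quotient N) hH _))
    rw [← hn, N.card_eq_card_quotient_mul_card_subgroup]
    exact lt_mul_of_one_lt_right Nat.card_pos (N.one_lt_card_iff_ne_bot.2 hN)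
  have hne : ∀ N : Subgroup H, Nat.card N = q → N ≠ ⊥ := fun N hN =>
    N.one_lt_card_iff_ne_bot.1 (hN ▸ hq.out.one_lt)
  by_cases hcyc : IsCyclic H
  · rcases hH.card_eq_or_dvd with h1 | h1
    · have := (Nat.card_eq_one_iff_unique.1 h1).1
      obtain ⟨m, hm⟩ := exists_int_char_one x
      refine ⟨m, char_injective (funext fun h => ?_)⟩
      rw [map_intCast, map_intCast, Subsingleton.elim h 1, hm]
      rfl
    · obtain ⟨g, hg⟩ := exists_prime_orderOf_dvd_card' q h1
      have hN : (Subgroup.zpowers g).Normal := Subgroup.normal_of_le_center fun y _ =>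
        Subgroup.mem_center_iff.2 fun z => IsMulCommutative.is_comm.comm z y
      have hNc : Nat.card (Subgroup.zpowers g) = q := by rw [Nat.card_zpowers, hg]
      have h2 := mem_range_lin_of_isCyclic hH (Subgroup.zpowers g) hNc (hx.sub (hx.avg hH _))
        (by rw [avg_sub, avg_avg, sub_self])
      have h3 := add_mem h2 (havg x hx (Subgroup.zpowers g) (hne _ hNc))
      rwa [sub_add_cancel] at h3
  · obtain ⟨E, hEn, hEc, hEq⟩ := hH.exists_normal_card_sq hodd hcyc
    by_cases hE : E ≤ Subgroup.center H
    · exact mem_range_lin_of_central E hE hEc hEq x (havg x hx)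
    · let Z := E ⊓ Subgroup.center H
      -- |Z| divides q²; it is not 1 because `E` meets the center nontrivially, and not q² because
      -- `E` is not central.
      have hZc : Nat.card Z = q := by
        have hd : Nat.card Z ∣ q ^ 2 := hEc ▸ Subgroup.card_dvd_of_le inf_le_left
        obtain ⟨j, hj, hj'⟩ := (Nat.dvd_prime_pow hq.out).1 hd
        obtain ⟨g, hgE, hgc, hg⟩ := hH.exists_mem_center_of_normal E
          (E.one_lt_card_iff_ne_bot.1 (hEc ▸ Nat.one_lt_pow two_ne_zero hq.out.one_lt))
        interval_cases j
        · rw [pow_zero, Subgroup.card_eq_one] at hj'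
          exact absurd (hj'.le ⟨hgE, hgc⟩ : g ∈ (⊥ : Subgroup H)) hg
        · rw [hj', pow_one]
        · have := Subgroup.eq_of_le_of_card_ge (inf_le_left : Z ≤ E) (by rw [hEc, hj'])
          exact absurd (this ▸ inf_le_right) hE
      have hZcen : Z ≤ Subgroup.center H := inf_le_right
      have hZn : Z.Normal := Subgroup.normal_of_le_center hZcen
      obtain ⟨e, heE, hec⟩ := SetLike.not_le_iff_exists.1 hE
      -- E/Z is normal of order q in the q-group H/Z, hence central there, so commutators with `e`
      -- fall into `Z`.
      have hcomm : ∀ y, y⁻¹ * e * y * e⁻¹ ∈ Z := by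
        let π := QuotientGroup.mk' Z
        have hEn' : (E.map π).Normal := hEn.map π (QuotientGroup.mk'_surjective Z)
        have hEc' : Nat.card (E.map π) = q := by
          have h1 := Subgroup.card_comap_mk' Z (E.map π)
          rw [Subgroup.comap_map_eq_self (by rw [QuotientGroup.ker_mk']; exact inf_le_left), hEc,
            hZc, sq] at h1
          exact (Nat.eq_of_mul_eq_mul_left hq.out.pos h1).symm
        have h2 := (hH.to_quotient Z).le_center_of_card_eq _ hEc' (Subgroup.mem_map_of_mem π heE)
        intro y
        rw [← QuotientGroup.eq_one_iff]
        have h3 := Subgroup.mem_center_iff.1 h2 (π y)⁻¹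
        change (π y)⁻¹ * π e * π y * (π e)⁻¹ = 1
        rw [h3]
        group
      obtain ⟨C, D, hD, hlt, hxe⟩ := exists_eq_ind_add_avg Z hZcen hZc e (hEq e heE) hec hcomm x
      have hC := hH.to_subgroup C
      have hy : PowInvariant q (avg D (pull C.subtype x)) := (hx.pull _).avg hC D
      rw [hxe]
      refine add_mem (ind_mem_range_lin _ C.subtype_injective
        (ih _ (hn ▸ hlt) rfl hC _ hy)) (havg _ (hx.sub (hy.ind hH hC _)) Z (hne Z hZc))

/-- For an odd prime `q`, a virtual complex representation of a `q`-group whose character is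
invariant under powers prime to `q` is a virtual permutation representation. -/
theorem PowInvariant.mem_range_lin (hodd : Odd q) (hH : IsPGroup q H) {x : RepRing ℂ H}
    (hx : PowInvariant q x) : x ∈ (lin ℂ H).range :=
  mem_range_lin_aux hodd _ rfl hH x hx

end RepRing

/-! ### Rational characters and classes fixed by an Adams operation -/

section RationalCharacters

open Polynomial in
-- The Galois conjugation ζ ↦ ζ^n in polynomial form. Writing μ_i = ζ^(a_i), rationality of the sum
-- says that ζ is a root of P = ∑ X^(a_i) - c in ℚ[X]; the primitive root ζ^n has the same minimal
-- polynomial, the cyclotomic one, so it is a root of P too.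
theorem sum_pow_eq_of_coprime {N n : ℕ} (hN : N ≠ 0) (hn : n.Coprime N) {d : ℕ} (μ : Fin d → ℂ)
    (hμ : ∀ i, μ i ^ N = 1) (c : ℚ) (hc : ∑ i, μ i = c) : ∑ i, μ i ^ n = c := by
  have : NeZero N := ⟨hN⟩
  have hζ := Complex.isPrimitiveRoot_exp N hN
  set ζ := Complex.exp (2 * Real.pi * Complex.I / N)
  choose a _ ha using fun i => hζ.eq_pow_of_pow_eq_one (hμ i)
  let P : ℚ[X] := ∑ i, X ^ a i - C c
  have heval : ∀ w : ℂ, aeval w P = ∑ i, w ^ a i - c := fun w => by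
    simp [P]
  have h1 : aeval ζ P = 0 := by
    rw [heval, sub_eq_zero, ← hc]
    exact Finset.sum_congr rfl fun i _ => ha i
  have h2 := minpoly.dvd ℚ ζ h1
  rw [← cyclotomic_eq_minpoly_rat hζ (Nat.pos_of_ne_zero hN),
    cyclotomic_eq_minpoly_rat (hζ.pow_of_coprime n hn) (Nat.pos_of_ne_zero hN)] at h2
  have h3 : aeval (ζ ^ n) P = 0 := by
    obtain ⟨Q, hQ⟩ := h2
    rw [hQ, map_mul, minpoly.aeval, zero_mul]
  rw [heval, sub_eq_zero] at h3
  rw [← h3]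
  refine Finset.sum_congr rfl fun i _ => ?_
  rw [← ha i, ← pow_mul, ← pow_mul, mul_comm]

namespace RepRing

open GrothendieckRing

variable {H : Type u} [Group H] [Finite H]

/-- Rational characters are invariant under powers prime to the order of the group. -/
theorem char_rat_pow (x : RepRing ℚ H) {n : ℕ} (hn : n.Coprime (Nat.card H)) (h : H) :
    char x (h ^ n) = char x h := by
  have key : ∀ V : FinRep ℚ H, V.ρ.character (h ^ n) = V.ρ.character h := by
    intro V
    -- Over ℂ the operator of h is diagonalizable with |H|-th roots of unity as eigenvalues, and the
    -- character at h^m is their m-th power sum; the value at h is rational since V is defined over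
    -- ℚ.
    let W := V.baseChange ℂ
    have hW : ∀ g, W.ρ.character g = (V.ρ.character g : ℂ) := fun g =>
      RepSemiring.char_baseChange_aux ℂ V g
    have hN : (W.ρ h) ^ Nat.card H = 1 := by rw [← map_pow, pow_card_eq_one', map_one]
    obtain ⟨d, b, μ, hμ⟩ := Representation.exists_eigenbasis (W.ρ h) _ Nat.card_pos.ne' hN
    have hpow : ∀ m, W.ρ.character (h ^ m) = ∑ i, μ i ^ m := fun m => by
      rw [Representation.character, map_pow, Representation.trace_pow_eq_psum b _ μ hμ,
        MvPolynomial.psum, map_sum]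
      simp
    have hμN : ∀ i, μ i ^ Nat.card H = 1 := by
      intro i
      have h1 : ∀ m : ℕ, (W.ρ h ^ m) (b i) = μ i ^ m • b i := by
        intro m
        induction m with
        | zero => simp
        | succ m ih => rw [pow_succ', Module.End.mul_apply, ih, map_smul, hμ, smul_smul, pow_succ]
      have h2 := h1 (Nat.card H)
      rw [hN, Module.End.one_apply] at h2
      have h3 : (μ i ^ Nat.card H - 1) • b i = 0 := by rw [sub_smul, ← h2, one_smul, sub_self]
      exact sub_eq_zero.1 ((smul_eq_zero.1 h3).resolve_right (b.ne_zero i))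
    have h1 := hpow 1
    simp only [pow_one] at h1
    have h2 := sum_pow_eq_of_coprime Nat.card_pos.ne' hn μ hμN (V.ρ.character h)
      (by rw [← h1, hW])
    rw [← hpow, hW] at h2
    exact_mod_cast h2
  obtain ⟨a, b, rfl⟩ := exists_sub x
  obtain ⟨V, rfl⟩ := RepSemiring.exists_mk a
  obtain ⟨W, rfl⟩ := RepSemiring.exists_mk b
  simp only [map_sub, char_of, Pi.sub_apply, RepSemiring.char_mk, key]

/-- Lets kernels and preimages over ℚ be tested after extension to ℂ, where the surjectivity
statement lives. -/
theorem baseChange_injective : Function.Injective (baseChange (k := ℚ) ℂ H) := by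
  intro x y h
  refine char_injective (funext fun g => ?_)
  have := congrFun (congrArg char h) g
  rw [char_baseChange, char_baseChange] at this
  exact (algebraMap ℚ ℂ).injective this

theorem baseChange_lin (x : BurnsideRing H) : baseChange ℂ H (lin ℚ H x) = lin ℂ H x := by
  refine char_injective (funext fun g => ?_)
  obtain ⟨a, b, rfl⟩ := exists_sub x
  obtain ⟨X, rfl⟩ := BurnsideSemiring.exists_mk a
  obtain ⟨Y, rfl⟩ := BurnsideSemiring.exists_mk b
  rw [char_baseChange]
  simp only [map_sub, lin, mapRing_of, char_of, Pi.sub_apply, RepSemiring.char_lin, map_natCast]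

theorem adams_baseChange {n : ℕ} (hn : (Nat.card H).Coprime n) (x : RepRing ℚ H) :
    adams n H (baseChange ℂ H x) = baseChange ℂ H x := by
  refine char_injective (funext fun h => ?_)
  rw [char_adams, char_baseChange, char_baseChange, char_rat_pow x hn.symm]

/-- Invariance under ℓ-th powers iterates to ℓ^j-th powers. Each n prime to q is congruent to some
ℓ^j modulo N, and h^n depends only on n modulo the order of h, which divides N. -/
theorem powInvariant_of_adams {N ℓ q : ℕ} [hq : Fact q.Prime] (hℓ : IsPrimitiveRootMod ℓ N)
    (hHN : Nat.card H ∣ N) (hNq : ∃ a, N = q ^ a) {x : RepRing ℂ H} (hx : adams ℓ H x = x) : PowInvariant q x := by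
  intro n hn h
  have h1 : ∀ g, char x (g ^ ℓ) = char x g := fun g => by rw [← char_adams, hx]
  have h2 : ∀ j g, char x (g ^ ℓ ^ j) = char x g := by
    intro j
    induction j with
    | zero => simp
    | succ j ih => intro g; rw [pow_succ, pow_mul, h1, ih]
  obtain ⟨a, rfl⟩ := hNq
  obtain ⟨v, hv, hgen⟩ := hℓ
  have hN0 : NeZero (q ^ a) := ⟨pow_ne_zero a hq.out.ne_zero⟩
  -- The unit group of ℤ/q^a is finite, so the exponent can be taken to be a natural number.
  have hmem := mem_powers_iff_mem_zpowers.2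
    (hgen (ZMod.unitOfCoprime n (hn.symm.pow_right a)))
  obtain ⟨j, hj⟩ := (Submonoid.mem_powers_iff _ _).1 hmem
  have hmod : ((ℓ ^ j : ℕ) : ZMod (q ^ a)) = (n : ℕ) := by
    have := congrArg Units.val hj
    rw [Units.val_pow_eq_pow_val, hv, ZMod.coe_unitOfCoprime] at this
    rw [Nat.cast_pow, this]
  rw [ZMod.natCast_eq_natCast_iff] at hmod
  have h3 : h ^ ℓ ^ j = h ^ n :=
    pow_eq_pow_iff_modEq.2 (hmod.of_dvd ((orderOf_dvd_natCard h).trans hHN))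
  rw [← h3, h2]

end RepRing

end RationalCharacters

/-! ### Assembling the isomorphisms of Green functors -/

namespace GreenFunctor

variable {G : Type u} [Group G]

/-- A morphism of Green functors that is bijective at every subgroup is an isomorphism. -/
noncomputable def Iso.ofBijective {M N : GreenFunctor.{u, v} G} (f : Hom M N)
    (hf : ∀ H, Function.Bijective (f.app H)) : Iso M N where
  app H := RingEquiv.ofBijective (f.app H) (hf H)
  app_res := f.app_res
  app_tr := f.app_tr
  app_conj := f.app_conj

/-- The morphism on a quotient induced by a morphism that vanishes on the ideal. -/
def quotientLift {M N : GreenFunctor.{u, v} G} (I : GreenIdeal M) (f : Hom M N)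
    (hf : ∀ H, ∀ x ∈ I.ideal H, f.app H x = 0) : Hom (M.quotient I) N where
  app H := Ideal.Quotient.lift (I.ideal H) (f.app H) (hf H)
  app_res h x := by
    obtain ⟨x, rfl⟩ := Ideal.Quotient.mk_surjective x
    exact f.app_res h x
  app_tr h x := by
    obtain ⟨x, rfl⟩ := Ideal.Quotient.mk_surjective x
    exact f.app_tr h x
  app_conj g _ _ e x := by
    obtain ⟨x, rfl⟩ := Ideal.Quotient.mk_surjective x
    exact f.app_conj g e x

/-- The corestriction of a morphism to the kernel of `f - 1`. -/
def kerSubOneLift {M N : GreenFunctor.{u, v} G} (f : Hom N N) (g : Hom M N)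
    (hg : ∀ H x, f.app H (g.app H x) = g.app H x) : Hom M (kerSubOne f) where
  app H := (g.app H).codRestrict (kerSubOneRing f H) fun x =>
    (mem_kerSubOneRing f H _).2 (hg H x)
  app_res h x := Subtype.ext (g.app_res h x)
  app_tr h x := Subtype.ext (g.app_tr h x)
  app_conj a _ _ e x := Subtype.ext (g.app_conj a e x)

end GreenFunctor

theorem mainTheorem7 {G : Type u} [Group G] [Finite G] (q : ℕ) (hq : q.Prime) (hodd : Odd q)
    (hG : IsPGroup q G) (ℓ : ℕ) (hℓ : IsPrimitiveRootMod ℓ (Nat.card G)) :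
    ∃ (e₁ : GreenFunctor.Iso ((burnsideGreen G).quotient (linHom ℂ G).ker) (repGreen ℚ G))
      (e₂ : GreenFunctor.Iso (repGreen ℚ G)
        (GreenFunctor.kerSubOne (adamsHom G ℓ hℓ.coprime))),
      (∀ (H : Subgroup G) (x : (burnsideGreen G).obj H),
        e₁.app H (((burnsideGreen G).quotientMk (linHom ℂ G).ker).app H x) =
          (linHom ℚ G).app H x) ∧
      (∀ (H : Subgroup G) (x : (repGreen ℚ G).obj H),
        (GreenFunctor.kerSubOneIncl (adamsHom G ℓ hℓ.coprime)).app H (e₂.app H x) =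
          (baseChangeHom ℚ ℂ G).app H x) := by
  have := Fact.mk hq
  have hcop : ∀ H : Subgroup G, (Nat.card H).Coprime ℓ := fun H =>
    hℓ.coprime.coprime_dvd_left H.card_subgroup_dvd_card
  -- This one statement gives the surjectivity of both isomorphisms. The primitive root condition
  -- modulo |G| serves every subgroup at once.
  have hlin : ∀ (H : Subgroup G) (x : RepRing ℂ H), RepRing.adams ℓ H x = x →
      ∃ a, RepRing.lin ℂ H a = x := fun H x hx =>
    (RepRing.powInvariant_of_adams hℓ H.card_subgroup_dvd_card
      (IsPGroup.iff_card.1 hG) hx).mem_range_lin hodd (hG.to_subgroup H)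
  have hker : ∀ (H : Subgroup G) (a : BurnsideRing H), RepRing.lin ℂ H a = 0 ↔
      RepRing.lin ℚ H a = 0 := fun H a => by
    rw [← RepRing.baseChange_lin, map_eq_zero_iff _ RepRing.baseChange_injective]
  let f₁ : GreenFunctor.Hom ((burnsideGreen G).quotient (linHom ℂ G).ker) (repGreen ℚ G) :=
    GreenFunctor.quotientLift _ (linHom ℚ G) fun H x hx => (hker H x).1 hx
  let f₂ : GreenFunctor.Hom (repGreen ℚ G) (GreenFunctor.kerSubOne (adamsHom G ℓ hℓ.coprime)) :=
    GreenFunctor.kerSubOneLift _ (baseChangeHom ℚ ℂ G) fun H x =>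
      RepRing.adams_baseChange (hcop H) x
  have hf₁ : ∀ H, Function.Bijective (f₁.app H) := by
    intro H
    constructor
    · rw [injective_iff_map_eq_zero]
      intro x hx
      obtain ⟨a, rfl⟩ := Ideal.Quotient.mk_surjective x
      exact Ideal.Quotient.eq_zero_iff_mem.2 ((hker H a).2 hx)
    · intro y
      -- The complexification of a rational class y is fixed by ψ^ℓ, hence comes from a Burnside
      -- class a; injectivity of extension of scalars descends this equality to ℚ.
      obtain ⟨a, ha⟩ := hlin H _ (RepRing.adams_baseChange (hcop H) y)
      refine ⟨Ideal.Quotient.mk _ a, ?_⟩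
      apply RepRing.baseChange_injective
      exact (RepRing.baseChange_lin a).trans ha
  have hf₂ : ∀ H, Function.Bijective (f₂.app H) := by
    intro H
    constructor
    · intro x y h
      exact RepRing.baseChange_injective (congrArg Subtype.val h)
    · rintro ⟨y, hy⟩
      obtain ⟨a, ha⟩ := hlin H y ((GreenFunctor.mem_kerSubOneRing _ H y).1 hy)
      exact ⟨RepRing.lin ℚ H a, Subtype.ext ((RepRing.baseChange_lin a).trans ha)⟩
  exact ⟨.ofBijective f₁ hf₁, .ofBijective f₂ hf₂, fun _ _ => rfl, fun _ _ => rfl⟩
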